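/- Let $(Z,dz)$ be a standard Borel space with a $\sigma$-finite measure (the classical configurations, e.g. a phase space with its Liouville measure, or a countable set with counting measure), and let $\mathcal H$ be a separable complex Hilbert space. Let $X=L^1(Z;\mathcal T(\mathcal H))$ be the Banach space of integrable fields $z\mapsto\psi(z)$ of trace-class operators; hybrid classical-quantum states are the $\psi\in X$ with $\psi(z)\ge 0$ and $\int dz\,\mathrm{tr}\,\psi(z)=1$. Let $(\Lambda_t)_{t\ge0}$ be Markovian dynamics on $X$ with bounded generator, i.e. a norm-continuous one-parameter semigroup of bounded linear operators on $X$ ($\Lambda_0=1$, $\Lambda_{s+t}=\Lambda_s\Lambda_t$), each of which is completely positive ($1_n\otimes\Lambda_t$ is positive for every $n$) and preserves $\int dz\,\mathrm{tr}\,\psi(z)$. Then there is a bounded operator $\mathcal L$ on $X$ with $\frac{d}{dt}\Lambda_t=\mathcal L\Lambda_t$ for all $t\ge 0$, in operator norm, and there are a countable family of bounded operators $L_0=\mathbb 1,L_1,L_2,\dots$ on $\mathcal H$, a bounded measurable field of self-adjoint operators $H(z)$, a measurable field of positive semidefinite matrices $\lambda(z)=(\lambda^{\alpha\beta}(z))$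 with $\lambda^{0\alpha}=\lambda^{\alpha0}=0$, and a measurable family of matrix-valued measures $W^{\alpha\beta}(z|z')\,dz$ (not necessarily absolutely continuous in $z$), all of whose values are positive semidefinite Hermitian matrices and which have no mass at $z=z'$, such that for every $\psi\in X$ and almost every $z$ (summation over repeated indices) \begin{align*} (\mathcal L\psi)(z)={}&-i[H(z),\psi(z)]+\lambda^{\alpha\beta}(z)\Big(L_\alpha\psi(z)L_\beta^\dagger-\tfrac12\{L_\beta^\dagger L_\alpha,\psi(z)\}\Big)\\ &+\int dz'\,W^{\alpha\beta}(z|z')\,L_\alpha\psi(z')L_\beta^\dagger-\tfrac12W^{\alpha\beta}(z)\{L_\beta^\dagger L_\alpha,\psi(z)\}, \end{align*} where $W^{\alpha\beta}(z)=\int dz'\,W^{\alpha\beta}(z'|z)$ is the outgoing flux. The double sums are limits, in trace norm, of the partial sums over $\alpha,\beta<n$, and the jump term is the element $J$ of $X$ with $$\int_A J(z)\,dz=\sum_{\alpha\beta}\int dz'\Big(\int_A W^{\alpha\beta}(z|z')\,dz\Big)L_\alpha\psi(z')L_\beta^\dagger$$ for every measurable $A\subseteq Z$, the integrals over $z'$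 being absolutely convergent in trace norm. If $\mathcal H$ is finite-dimensional, then for any sequence $(L_\alpha)_{\alpha\ge0}$ with $L_0=\mathbb 1$ that spans the operators on $\mathcal H$ (in particular, a Hilbert-Schmidt orthogonal basis whose other elements are traceless, continued by zeros) there are $H$, $\lambda$ and $W$ as above for which $\mathcal L$ has this form with these $L_\alpha$. -/

import Mathlib

open MeasureTheory Filter Topology InnerProductSpace
open scoped ComplexOrder

noncomputable section

/-! ### Trace-class operators on a complex Hilbert space -/

section TraceClass

variable {H : Type*} [NormedAddCommGroup H] [InnerProductSpace ℂ H]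

/-- `A = ∑ₙ |xₙ⟩⟨yₙ|` with `∑ₙ ‖xₙ‖ ‖yₙ‖ < ∞`. -/
def IsNuclearRep (A : H →L[ℂ] H) (x y : ℕ → H) : Prop :=
  Summable (fun n => ‖x n‖ * ‖y n‖) ∧ HasSum (fun n => rankOne ℂ (x n) (y n)) A

/-- The trace norm `‖A‖₁`, in its nuclear form: the infimum of `∑ₙ ‖xₙ‖ ‖yₙ‖` over all
representations `A = ∑ₙ |xₙ⟩⟨yₙ|`. -/
def traceNorm (A : H →L[ℂ] H) : ℝ :=
  sInf {r : ℝ | ∃ x y : ℕ → H, IsNuclearRep A x y ∧ r = ∑' n, ‖x n‖ * ‖y n‖}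

theorem IsNuclearRep.zero : IsNuclearRep (0 : H →L[ℂ] H) (fun _ => 0) (fun _ => 0) := by
  constructor <;> simp [summable_zero, hasSum_zero]

theorem IsNuclearRep.smul {A : H →L[ℂ] H} {x y : ℕ → H} (h : IsNuclearRep A x y) (c : ℂ) :
    IsNuclearRep (c • A) (fun n => c • x n) y := by
  refine ⟨?_, ?_⟩
  · simpa [norm_smul, mul_assoc] using h.1.mul_left ‖c‖
  · simpa using h.2.const_smul c

theorem IsNuclearRep.add {A B : H →L[ℂ] H} {x y x' y' : ℕ → H} (h : IsNuclearRep A x y)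
    (h' : IsNuclearRep B x' y') :
    ∃ u v : ℕ → H, IsNuclearRep (A + B) u v ∧
      ∑' n, ‖u n‖ * ‖v n‖ = ∑' n, ‖x n‖ * ‖y n‖ + ∑' n, ‖x' n‖ * ‖y' n‖ := by
  have k1 : HasSum (fun s : ℕ ⊕ ℕ => ‖Sum.elim x x' s‖ * ‖Sum.elim y y' s‖)
      (∑' n, ‖x n‖ * ‖y n‖ + ∑' n, ‖x' n‖ * ‖y' n‖) := HasSum.sum h.1.hasSum h'.1.hasSum
  have k2 : HasSum (fun s : ℕ ⊕ ℕ => rankOne ℂ (Sum.elim x x' s) (Sum.elim y y' s)) (A + B) :=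
    HasSum.sum h.2 h'.2
  have l1 := (Equiv.hasSum_iff Equiv.natSumNatEquivNat.symm).2 k1
  have l2 := (Equiv.hasSum_iff Equiv.natSumNatEquivNat.symm).2 k2
  exact ⟨fun n => Sum.elim x x' (Equiv.natSumNatEquivNat.symm n),
    fun n => Sum.elim y y' (Equiv.natSumNatEquivNat.symm n), ⟨l1.summable, l2⟩, l1.tsum_eq⟩

theorem traceNorm_nonneg (A : H →L[ℂ] H) : 0 ≤ traceNorm A := by
  refine Real.sInf_nonneg ?_
  rintro r ⟨x, y, -, rfl⟩
  exact tsum_nonneg fun n => by positivity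

theorem traceNorm_le {A : H →L[ℂ] H} {x y : ℕ → H} (h : IsNuclearRep A x y) :
    traceNorm A ≤ ∑' n, ‖x n‖ * ‖y n‖ := by
  refine csInf_le ⟨0, ?_⟩ ⟨x, y, h, rfl⟩
  rintro r ⟨x, y, -, rfl⟩
  exact tsum_nonneg fun n => by positivity

theorem exists_rep_lt {A : H →L[ℂ] H} (hA : ∃ x y, IsNuclearRep A x y) {ε : ℝ} (hε : 0 < ε) :
    ∃ x y, IsNuclearRep A x y ∧ ∑' n, ‖x n‖ * ‖y n‖ < traceNorm A + ε := by
  obtain ⟨x, y, h⟩ := hA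
  obtain ⟨r, ⟨x, y, h, rfl⟩, hr⟩ := Real.lt_sInf_add_pos
    (s := {r : ℝ | ∃ x y : ℕ → H, IsNuclearRep A x y ∧ r = ∑' n, ‖x n‖ * ‖y n‖})
    ⟨_, x, y, h, rfl⟩ hε
  exact ⟨x, y, h, hr⟩

theorem opNorm_le_traceNorm {A : H →L[ℂ] H} (hA : ∃ x y, IsNuclearRep A x y) :
    ‖A‖ ≤ traceNorm A := by
  refine le_of_forall_pos_le_add fun ε hε => ?_
  obtain ⟨x, y, h, hlt⟩ := exists_rep_lt hA hε
  refine le_trans ?_ hlt.le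
  rw [← h.2.tsum_eq]
  have := norm_tsum_le_tsum_norm (f := fun n => rankOne ℂ (x n) (y n)) (by simpa using h.1)
  simpa using this

theorem traceNorm_add_le {A B : H →L[ℂ] H} (hA : ∃ x y, IsNuclearRep A x y)
    (hB : ∃ x y, IsNuclearRep B x y) : traceNorm (A + B) ≤ traceNorm A + traceNorm B := by
  refine le_of_forall_pos_le_add fun ε hε => ?_
  obtain ⟨x, y, h, hlt⟩ := exists_rep_lt hA (half_pos hε)
  obtain ⟨x', y', h', hlt'⟩ := exists_rep_lt hB (half_pos hε)
  obtain ⟨u, v, k, hk⟩ := h.add h'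
  have := traceNorm_le k
  linarith

theorem traceNorm_smul_le {A : H →L[ℂ] H} (hA : ∃ x y, IsNuclearRep A x y) (c : ℂ) :
    traceNorm (c • A) ≤ ‖c‖ * traceNorm A := by
  refine le_of_forall_pos_le_add fun ε hε => ?_
  obtain ⟨x, y, h, hlt⟩ := exists_rep_lt hA (ε := ε / (‖c‖ + 1)) (by positivity)
  have h1 := traceNorm_le (h.smul c)
  simp only [norm_smul, mul_assoc, tsum_mul_left] at h1
  have h2 : ‖c‖ * (ε / (‖c‖ + 1)) ≤ ε := by
    rw [mul_div_assoc', div_le_iff₀ (by positivity)]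
    nlinarith [norm_nonneg c]
  nlinarith [mul_le_mul_of_nonneg_left hlt.le (norm_nonneg c)]

variable (H) in
/-- The trace-class operators as a linear subspace of the bounded operators. -/
def traceClassSubmodule : Submodule ℂ (H →L[ℂ] H) where
  carrier := {A | ∃ x y, IsNuclearRep A x y}
  zero_mem' := ⟨_, _, IsNuclearRep.zero⟩
  add_mem' := by
    rintro A B ⟨x, y, h⟩ ⟨x', y', h'⟩
    obtain ⟨u, v, k, -⟩ := h.add h'
    exact ⟨u, v, k⟩
  smul_mem' := by
    rintro c A ⟨x, y, h⟩
    exact ⟨_, _, h.smul c⟩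

variable (H) in
/-- The space of trace-class operators; it carries the trace norm, not the operator norm. -/
def TraceClass : Type _ := traceClassSubmodule H

namespace TraceClass

/-- The underlying bounded operator. -/
def op (σ : TraceClass H) : H →L[ℂ] H := Subtype.val (p := (· ∈ traceClassSubmodule H)) σ

instance : AddCommGroup (TraceClass H) := inferInstanceAs (AddCommGroup (traceClassSubmodule H))
instance : Module ℂ (TraceClass H) := inferInstanceAs (Module ℂ (traceClassSubmodule H))
instance : Norm (TraceClass H) := ⟨fun σ => traceNorm σ.op⟩

theorem rep (σ : TraceClass H) : ∃ x y, IsNuclearRep σ.op x y :=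
  Subtype.prop (p := (· ∈ traceClassSubmodule H)) σ

theorem ext' {σ τ : TraceClass H} (h : σ.op = τ.op) : σ = τ :=
  Subtype.ext (p := (· ∈ traceClassSubmodule H)) h

theorem op_add (σ τ : TraceClass H) : (σ + τ).op = σ.op + τ.op := rfl
theorem op_smul (c : ℂ) (σ : TraceClass H) : (c • σ).op = c • σ.op := rfl
theorem op_zero : (0 : TraceClass H).op = 0 := rfl
theorem op_sub (σ τ : TraceClass H) : (σ - τ).op = σ.op - τ.op := rfl
theorem norm_def (σ : TraceClass H) : ‖σ‖ = traceNorm σ.op := rfl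

theorem normCore : NormedSpace.Core ℂ (TraceClass H) where
  norm_nonneg σ := traceNorm_nonneg _
  norm_smul c σ := by
    refine le_antisymm (traceNorm_smul_le σ.rep c) ?_
    by_cases hc : c = 0
    · rw [hc, norm_zero, zero_mul]
      exact traceNorm_nonneg _
    have h := traceNorm_smul_le (c • σ).rep c⁻¹
    rw [op_smul, smul_smul, inv_mul_cancel₀ hc, one_smul, norm_inv,
      inv_mul_eq_div, le_div_iff₀ (norm_pos_iff.2 hc), mul_comm] at h
    exact h
  norm_triangle σ τ := traceNorm_add_le σ.rep τ.rep
  norm_eq_zero_iff σ := by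
    constructor
    · intro h
      have := opNorm_le_traceNorm σ.rep
      rw [← norm_def, h] at this
      exact ext' (norm_le_zero_iff.1 this)
    · rintro rfl
      refine le_antisymm ?_ (traceNorm_nonneg _)
      rw [norm_def, op_zero]
      have := traceNorm_le (IsNuclearRep.zero (H := H))
      simp only [norm_zero, mul_zero, tsum_zero] at this
      exact this

instance : NormedAddCommGroup (TraceClass H) := NormedAddCommGroup.ofCore normCore
instance : NormedSpace ℂ (TraceClass H) := NormedSpace.ofCore normCore

theorem exists_hasSum {v : ℕ → TraceClass H} (hv : Summable fun n => ‖v n‖) {ε : ℝ}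
    (hε : 0 < ε) [CompleteSpace H] :
    ∃ σ : TraceClass H, HasSum (fun n => (v n).op) σ.op ∧ ‖σ‖ ≤ ∑' n, ‖v n‖ + ε := by
  obtain ⟨δ, hδ0, c, hδ, hc⟩ := posSumOfEncodable hε ℕ
  choose x y hxy hlt using fun n => exists_rep_lt (v n).rep (hδ0 n)
  have hsum : Summable fun p : ℕ × ℕ => ‖x p.1 p.2‖ * ‖y p.1 p.2‖ := by
    rw [summable_prod_of_nonneg (fun p => by positivity)]
    refine ⟨fun n => (hxy n).1, Summable.of_nonneg_of_le (fun n => tsum_nonneg fun m => ?_)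
      (fun n => (hlt n).le) (hv.add hδ.summable)⟩
    positivity
  have hop : Summable fun p : ℕ × ℕ => rankOne ℂ (x p.1 p.2) (y p.1 p.2) :=
    Summable.of_norm (by simpa using hsum)
  have e := Nat.pairEquiv.symm
  have h1 := (Equiv.hasSum_iff e).2 hsum.hasSum
  have h2 := (Equiv.hasSum_iff e).2 hop.hasSum
  have hrep : IsNuclearRep (∑' p : ℕ × ℕ, rankOne ℂ (x p.1 p.2) (y p.1 p.2))
      (fun n => x (e n).1 (e n).2) (fun n => y (e n).1 (e n).2) := ⟨h1.summable, h2⟩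
  refine ⟨(⟨_, _, _, hrep⟩ : traceClassSubmodule H), ?_, ?_⟩
  · exact hop.hasSum.prod_fiberwise fun n => (hxy n).2
  · refine (traceNorm_le hrep).trans ?_
    have h3 : ∑' n, ‖x (e n).1 (e n).2‖ * ‖y (e n).1 (e n).2‖ =
        ∑' p : ℕ × ℕ, ‖x p.1 p.2‖ * ‖y p.1 p.2‖ := h1.tsum_eq
    rw [h3, hsum.tsum_prod]
    have h4 : Summable fun n => ∑' m, ‖x n m‖ * ‖y n m‖ :=
      Summable.of_nonneg_of_le (fun n => tsum_nonneg fun m => by positivity)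
        (fun n => (hlt n).le) (hv.add hδ.summable)
    have h5 : ∑' n, ∑' m, ‖x n m‖ * ‖y n m‖ ≤ ∑' n, (‖v n‖ + δ n) :=
      h4.tsum_le_tsum (fun n => (hlt n).le) (hv.add hδ.summable)
    rw [hv.tsum_add hδ.summable, hδ.tsum_eq] at h5
    linarith

theorem op_sum (s : Finset ℕ) (v : ℕ → TraceClass H) :
    (∑ n ∈ s, v n).op = ∑ n ∈ s, (v n).op := by
  classical
  induction s using Finset.induction_on with
  | empty => rfl
  | insert a s ha ih => rw [Finset.sum_insert ha, Finset.sum_insert ha, op_add, ih]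

/-- The trace-class operators form a Banach space. -/
instance [CompleteSpace H] : CompleteSpace (TraceClass H) := by
  refine NormedAddCommGroup.completeSpace_of_summable_imp_tendsto fun u hu => ?_
  obtain ⟨σ, hσ, -⟩ := exists_hasSum hu one_pos
  refine ⟨σ, ?_⟩
  rw [tendsto_iff_norm_sub_tendsto_zero]
  refine squeeze_zero (fun _ => norm_nonneg _) (fun N => ?_)
    (tendsto_sum_nat_add fun n => ‖u n‖)
  refine le_of_forall_pos_le_add fun ε hε => ?_
  obtain ⟨τ, hτ, hle⟩ := exists_hasSum (v := fun n => u (n + N))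
    ((summable_nat_add_iff N).2 hu) hε
  have key : σ - ∑ n ∈ Finset.range N, u n = τ := by
    apply ext'
    rw [op_sub, op_sum]
    exact ((hasSum_nat_add_iff' N).2 hσ).unique hτ
  rw [← norm_neg, neg_sub, key]
  exact hle

variable [CompleteSpace H]

/-- `B σ C` for bounded operators `B`, `C` and a trace-class operator `σ`. -/
def sandwich (B : H →L[ℂ] H) (σ : TraceClass H) (C : H →L[ℂ] H) : TraceClass H :=
  ⟨B ∘L σ.op ∘L C, by
    obtain ⟨x, y, h⟩ := σ.rep
    refine ⟨fun n => B (x n), fun n => ContinuousLinearMap.adjoint C (y n), ?_, ?_⟩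
    · refine Summable.of_nonneg_of_le (fun n => by positivity) (fun n => ?_)
        (h.1.mul_left (‖B‖ * ‖ContinuousLinearMap.adjoint C‖))
      calc _ ≤ (‖B‖ * ‖x n‖) * (‖ContinuousLinearMap.adjoint C‖ * ‖y n‖) := by
            gcongr <;> exact ContinuousLinearMap.le_opNorm _ _
        _ = _ := by ring
    · have h1 := ((ContinuousLinearMap.compL ℂ H H H B).hasSum
        (((ContinuousLinearMap.compL ℂ H H H).flip C).hasSum h.2))
      simpa [InnerProductSpace.rankOne_comp, InnerProductSpace.comp_rankOne] using h1⟩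

theorem op_sandwich (B : H →L[ℂ] H) (σ : TraceClass H) (C : H →L[ℂ] H) :
    (sandwich B σ C).op = B ∘L σ.op ∘L C := rfl

/-- The commutator `[B, σ]`. -/
def comm (B : H →L[ℂ] H) (σ : TraceClass H) : TraceClass H := sandwich B σ 1 - sandwich 1 σ B

/-- The anticommutator `{B, σ}`. -/
def anticomm (B : H →L[ℂ] H) (σ : TraceClass H) : TraceClass H := sandwich B σ 1 + sandwich 1 σ B

/-- The trace `∑ᵢ ⟨bᵢ, σ bᵢ⟩` along a Hilbert basis `b` (for a trace-class operator it does not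
depend on the choice of `b`). -/
def trace (σ : TraceClass H) : ℂ :=
  ∑' i, inner ℂ ((exists_hilbertBasis ℂ H).choose_spec.choose i)
    (σ.op ((exists_hilbertBasis ℂ H).choose_spec.choose i))

end TraceClass

end TraceClass

/-! ### Hybrid classical-quantum dynamics -/

section Hybrid

variable {Z H : Type*} [MeasurableSpace Z] [NormedAddCommGroup H] [InnerProductSpace ℂ H]
  [CompleteSpace H]

variable (H) in
/-- The complex Banach space spanned by the hybrid states: classes of integrable fields
`z ↦ ψ(z)` of trace-class operators, with norm `∫ ‖ψ(z)‖₁ dz`, where `dz` is `μ`. -/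
abbrev HybridSpace (μ : Measure Z) : Type _ := Lp (TraceClass H) 1 μ

/-- An `n × n` matrix of elements of the hybrid space is positive if at almost every `z` the
operator matrix `(ψᵢⱼ(z))` is positive on `Hⁿ`. -/
def IsPositiveMatrix {μ : Measure Z} {n : ℕ} (ψ : Fin n → Fin n → HybridSpace H μ) : Prop :=
  ∀ᵐ z ∂μ, ∀ x : Fin n → H, 0 ≤ ∑ i, ∑ j, inner ℂ (x i) ((ψ i j z).op (x j))

/-- Complete positivity: all amplifications `1ₙ ⊗ Λ` preserve positivity. -/
def IsCompletelyPositive {μ : Measure Z} (Λ : HybridSpace H μ →L[ℂ] HybridSpace H μ) : Prop :=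
  ∀ (n : ℕ) (ψ : Fin n → Fin n → HybridSpace H μ),
    IsPositiveMatrix ψ → IsPositiveMatrix (fun i j => Λ (ψ i j))

/-- Preservation of `∫ tr ψ(z) dz`. -/
def IsTracePreserving {μ : Measure Z} (Λ : HybridSpace H μ →L[ℂ] HybridSpace H μ) : Prop :=
  ∀ ψ : HybridSpace H μ, ∫ z, (Λ ψ z).trace ∂μ = ∫ z, (ψ z).trace ∂μ

/-- Markovian (time-homogeneous) linear completely positive trace-preserving dynamics on hybrid
states; only times `t ≥ 0` matter. -/
structure IsCQDynamics {μ : Measure Z} (Λ : ℝ → HybridSpace H μ →L[ℂ] HybridSpace H μ) :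
    Prop where
  map_zero : Λ 0 = 1
  map_add : ∀ s t : ℝ, 0 ≤ s → 0 ≤ t → Λ (s + t) = Λ s ∘L Λ t
  completelyPositive : ∀ t : ℝ, 0 ≤ t → IsCompletelyPositive (Λ t)
  tracePreserving : ∀ t : ℝ, 0 ≤ t → IsTracePreserving (Λ t)

/-- `∑_{α,β} f α β = s`, as the limit of the partial sums over `α, β < n`. -/
def HasDoubleSum {E : Type*} [AddCommMonoid E] [TopologicalSpace E] (f : ℕ → ℕ → E) (s : E) :
    Prop :=
  Tendsto (fun n => ∑ α ∈ Finset.range n, ∑ β ∈ Finset.range n, f α β) atTop (𝓝 s)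

variable (Z H) in
/-- The coefficients of a hybrid master equation. The rate `W^{αβ}(z|z') dz` of jumping from `z'`
to `z` is a matrix-valued measure: `W z' A α β` stands for `∫_A W^{αβ}(z|z') dz`. -/
structure CQCoefficients where
  /-- the Hamiltonian -/
  ham : Z → H →L[ℂ] H
  /-- the couplings of the pure Lindblad term -/
  lam : Z → Matrix ℕ ℕ ℂ
  /-- the jump rates -/
  W : Z → VectorMeasure Z (Matrix ℕ ℕ ℂ)
  ham_selfAdjoint : ∀ z, IsSelfAdjoint (ham z)
  ham_bounded : ∃ C : ℝ, ∀ z, ‖ham z‖ ≤ C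
  ham_measurable : ∀ x y : H, Measurable fun z => inner ℂ x (ham z y)
  lam_posSemidef : ∀ z, (lam z).PosSemidef
  lam_measurable : ∀ α β, Measurable fun z => lam z α β
  /-- the pure Lindblad term involves only the indices `α, β ≠ 0` -/
  lam_zero : ∀ z α, lam z 0 α = 0 ∧ lam z α 0 = 0
  W_posSemidef : ∀ (z' : Z) (A : Set Z), MeasurableSet A → (W z' A).PosSemidef
  W_measurable : ∀ (A : Set Z) (α β : ℕ), MeasurableSet A → Measurable fun z' => W z' A α β
  /-- `W` describes changes of the classical state: it has no mass at `z = z'` -/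
  W_diag : ∀ z, W z {z} = 0

/-- The outgoing flux `W^{αβ}(z) = ∫ W^{αβ}(z'|z) dz'`. -/
def CQCoefficients.flux (c : CQCoefficients Z H) (z : Z) : Matrix ℕ ℕ ℂ := c.W z Set.univ

/-- The operator `𝓛` is given by the hybrid master equation with Lindblad operators `L` and
coefficients `c`:
`(𝓛ψ)(z) = -i[H(z), ψ(z)] + λ^{αβ}(z) (L_α ψ(z) L_β† - ½{L_β† L_α, ψ(z)})`
`  + ∫ dz' W^{αβ}(z|z') L_α ψ(z') L_β† - ½ W^{αβ}(z) {L_β† L_α, ψ(z)}`.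
The jump term is the element `J` of the hybrid space with
`∫_A J(z) dz = ∑_{αβ} ∫ dz' (∫_A W^{αβ}(z|z') dz) L_α ψ(z') L_β†` for all measurable `A`.
All sums converge in trace norm. -/
def CQCoefficients.IsMasterEquation (c : CQCoefficients Z H) (L : ℕ → H →L[ℂ] H) {μ : Measure Z}
    (𝓛 : HybridSpace H μ →L[ℂ] HybridSpace H μ) : Prop :=
  ∀ ψ : HybridSpace H μ, ∃ J : HybridSpace H μ,
    (∀ A : Set Z, MeasurableSet A →
      (∀ α β, Integrable
        (fun z' => c.W z' A α β • (ψ z').sandwich (L α) (star (L β))) μ) ∧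
      HasDoubleSum
        (fun α β => ∫ z', c.W z' A α β • (ψ z').sandwich (L α) (star (L β)) ∂μ)
        (∫ z in A, J z ∂μ)) ∧
    ∀ᵐ z ∂μ, ∃ D N : TraceClass H,
      HasDoubleSum (fun α β => c.lam z α β •
        ((ψ z).sandwich (L α) (star (L β))
          - (1 / 2 : ℂ) • (ψ z).anticomm (star (L β) * L α))) D ∧
      HasDoubleSum (fun α β => (1 / 2 * c.flux z α β : ℂ) •
        (ψ z).anticomm (star (L β) * L α)) N ∧
      𝓛 ψ z = -Complex.I • (ψ z).comm (c.ham z) + D + (J z - N)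

end Hybrid

end

/-!
The generator exists by averaging: `∫₀^δ Λ` is invertible for small `δ`, and this makes `Λ`
differentiable (`exists_generator`). The work is in the structure of the generator `S`.

A strictly positive integrable weight `w` turns `μ` into an equivalent finite measure, and `S` is
studied through its blocks `block ω S A B : σ ↦ ∫_A S(w 1_B ⊗ σ) dμ`, which are maps of the trace
class, additive in both sets and bounded by `‖S‖ (w μ)(B)`. The derivative of complete positivity at
time `0` says that a block is completely positive for disjoint `A`, `B`, and in general
conditionally completely positive: the identity, which is subtracted in the difference quotient,
only contributes on `A ∩ B`, and there only to families of vectors with `∑ ⟨xᵢ, fᵢ⟩ ≠ 0`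
(`sum_kernelForm_generator_nonneg`). A hermitian conditionally completely positive map of the trace
class becomes completely positive when a drift `σ ↦ Kσ + σK†` is subtracted, with `K` bounded by
twice its norm (`IsCCP.isCP_sub_drift`). For a finite measurable partition this is done in each
diagonal block. Along an ultrafilter of partitions the resulting operators converge weakly to an
additive operator-valued set function dominated by `w μ` (`exists_drift_measure`), whose density
(`exists_operator_density`) is a bounded field `K`. So `S = Φ + (ψ ↦ Kψ + ψK†)`, where all blocks
of `Φ` are completely positive (`exists_drift_field`).

Next `Φ` is disintegrated. For a finite family of vectors, the quadratic form of the blocks of `Φ`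
is a nonnegative bimeasure in `(A, B)`, dominated in `B` by a multiple of `w μ`. Over a standard
Borel space a bimeasure is given by a kernel (`IsBimeasure.exists_kernel`, `exists_family_kernel`).
Polarization of these kernels gives the matrix-valued kernel `W(z, A)` of `Φ` in the basis
of matrix units `|eᵢ⟩⟨eₖ|`; off a null set it is positive semidefinite, for all coefficient vectors
and all `A` simultaneously (`exists_choiKernel`).

The double sums over matrix units converge in trace norm, although only square partial sums in an
enumeration of the pairs `(i, k)` are taken (`IsChoiMatrix.exists_hasMatrixSum`). A positive
semidefinite matrix over `ℕ` is `c c†` with `c` lower triangular, so that the `n`-th partial sum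
uses exactly the Kraus operators `∑_{α<n} c_{αm} L_α`. These form a truncated Stinespring operator
`V_n : H → ℓ²(ℕ; H)`. With the pairing `Nat.pair`, the first pairs form a matrix whose nonempty
rows have one of two lengths, except for one row; hence `‖V_n‖² ≤ 3C` when `C` bounds the
untruncated map (`IsKrausCoeff.bound_cutoff`). On basis vectors, `V_n` and `V_n†` are partial sums
of orthogonal series, so both converge strongly, and `V_n† V_n` converges strongly as well.

The mass of `W(z, ·)` at `z` gives `λ`, the rest gives the jump term. Since `∫ tr Sψ = 0` for all
`ψ`, at almost every `z` the hermitian part of `K` is minus half of the operators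
`∑ λ^{αβ} L_β† L_α + ∑ W^{αβ}(z) L_β† L_α`, and the antihermitian part of `K` is
`-i` times the Hamiltonian (`exists_isMasterEquation`).

In finite dimension only finitely many matrix units are nonzero. They are expanded in the given
operators `L_α`, which transforms `W` by a congruence (`IsMatrixKernel.changeOfOperators`). The
terms of the diagonal part with `α = 0` or `β = 0` then have the form of a drift, since `L₀ = 1`,
and are moved into `K` (`sum_eq_dropZero_add_drift`).
-/

/-! ### Norm-continuous one-parameter semigroups -/

section Semigroup

variable {A : Type*} [NormedRing A] [CompleteSpace A]

theorem continuousOn_of_semigroup {Λ : ℝ → A} (h0 : Λ 0 = 1)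
    (hadd : ∀ s t : ℝ, 0 ≤ s → 0 ≤ t → Λ (s + t) = Λ s * Λ t)
    (hcont : ContinuousWithinAt Λ (Set.Ici 0) 0) : ContinuousOn Λ (Set.Ici 0) := by
  have hpos : Tendsto (fun h : ℝ => max h 0) (𝓝 0) (𝓝[Set.Ici 0] 0) := by
    refine tendsto_nhdsWithin_iff.2 ⟨?_, Eventually.of_forall fun h => le_max_right (a := h) (b := 0)⟩
    have : Continuous fun h : ℝ => max h 0 := by fun_prop
    simpa using this.tendsto 0
  have hΛ : Tendsto (fun h : ℝ => Λ (max h 0)) (𝓝 0) (𝓝 1) := by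
    have := hcont.tendsto.comp hpos
    rwa [h0] at this
  have hinv : Tendsto (fun h : ℝ => Ring.inverse (Λ (max h 0))) (𝓝 0) (𝓝 1) := by
    have := (NormedRing.inverse_continuousAt (1 : Aˣ)).tendsto.comp
      (by simpa using hΛ)
    simpa [Function.comp_def] using this
  have hunit : ∀ᶠ h : ℝ in 𝓝 0, IsUnit (Λ (max h 0)) := by
    have := hΛ (Units.nhds (1 : Aˣ))
    filter_upwards [this] with h hh using hh
  intro t ht
  have ht' : (0 : ℝ) ≤ t := ht
  have hsub : Tendsto (fun s : ℝ => s - t) (𝓝[Set.Ici 0] t) (𝓝 0) := by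
    have : Continuous fun s : ℝ => s - t := by fun_prop
    simpa using (this.tendsto t).mono_left nhdsWithin_le_nhds
  have hsub' : Tendsto (fun s : ℝ => t - s) (𝓝[Set.Ici 0] t) (𝓝 0) := by
    have : Continuous fun s : ℝ => t - s := by fun_prop
    simpa using (this.tendsto t).mono_left nhdsWithin_le_nhds
  -- `Λ s = Λ t Λ(t - s)⁻¹ Λ(s - t)`, with the convention that negative times are cut off at `0`
  have key : (fun s => Λ t * Ring.inverse (Λ (max (t - s) 0)) * Λ (max (s - t) 0))
      =ᶠ[𝓝[Set.Ici 0] t] Λ := by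
    filter_upwards [hsub'.eventually hunit, self_mem_nhdsWithin] with s hs hs0
    rcases le_total s t with h | h
    · have h1 : max (s - t) 0 = 0 := max_eq_right (by linarith)
      have h2 : max (t - s) 0 = t - s := max_eq_left (by linarith)
      rw [h1, h0, mul_one, h2]
      rw [h2] at hs
      have : Λ t = Λ s * Λ (t - s) := by
        rw [← hadd s (t - s) hs0 (by linarith)]; congr 1; ring
      rw [this, mul_assoc, Ring.mul_inverse_cancel _ hs, mul_one]
    · have h1 : max (s - t) 0 = s - t := max_eq_left (by linarith)
      have h2 : max (t - s) 0 = 0 := max_eq_right (by linarith)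
      rw [h2, h0, Ring.inverse_one, mul_one, h1, ← hadd t (s - t) ht' (by linarith)]
      congr 1; ring
  have hlim := (tendsto_const_nhds (x := Λ t)).mul (hinv.comp hsub') |>.mul (hΛ.comp hsub)
  rw [mul_one, mul_one] at hlim
  exact hlim.congr' key

/-- A norm-continuous semigroup has a bounded generator: for small `δ > 0` the average
`V = ∫₀^δ Λ` is invertible, and `Λ t = V⁻¹ ∫ₜ^{t+δ} Λ` is differentiable with derivative
`V⁻¹ (Λ δ - 1) Λ t`. -/
theorem exists_generator [NormedAlgebra ℝ A] {Λ : ℝ → A} (h0 : Λ 0 = 1)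
    (hadd : ∀ s t : ℝ, 0 ≤ s → 0 ≤ t → Λ (s + t) = Λ s * Λ t)
    (hcont : ContinuousWithinAt Λ (Set.Ici 0) 0) :
    ∃ G : A, ∀ t : ℝ, 0 ≤ t → HasDerivWithinAt Λ (G * Λ t) (Set.Ici 0) t := by
  have hc := continuousOn_of_semigroup h0 hadd hcont
  set M : ℝ → A := fun t => Λ (max t 0) with hM
  have hMΛ : ∀ t, 0 ≤ t → M t = Λ t := fun t ht => by simp [hM, max_eq_left ht]
  have hMc : Continuous M := by
    refine hc.comp_continuous (by fun_prop) fun t => ?_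
    exact le_max_right t 0
  have hI : ∀ a b : ℝ, IntervalIntegrable M volume a b := fun a b => hMc.intervalIntegrable a b
  have hF : ∀ t, HasDerivAt (fun u => ∫ s in (0 : ℝ)..u, M s) (M t) t := fun t =>
    intervalIntegral.integral_hasDerivAt_right (hI _ _)
      hMc.stronglyMeasurable.stronglyMeasurableAtFilter hMc.continuousAt
  -- the average of `M` over `[0, δ]` tends to `M 0 = 1` as `δ → 0`, hence is eventually invertible
  obtain ⟨δ, hδ, hV⟩ : ∃ δ : ℝ, 0 < δ ∧ IsUnit (∫ s in (0 : ℝ)..δ, M s) := by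
    have hd := (hasDerivAt_iff_tendsto_slope.1 (hF 0)).mono_left
      (nhdsWithin_mono (0 : ℝ) (t := {0}ᶜ) (s := Set.Ioi 0) fun x hx => ne_of_gt hx)
    have hM0 : M 0 = ((1 : Aˣ) : A) := by rw [hMΛ 0 le_rfl, h0]; rfl
    rw [hM0] at hd
    have h1 := hd (Units.nhds (1 : Aˣ))
    obtain ⟨δ, hδu, hδ⟩ := (Filter.Eventually.and (Filter.mem_map.1 h1) self_mem_nhdsWithin).exists
    refine ⟨δ, hδ, ?_⟩
    have h2 : IsUnit (slope (fun u => ∫ s in (0 : ℝ)..u, M s) 0 δ) := hδu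
    have hne : δ ≠ 0 := ne_of_gt hδ
    have h3 : (∫ s in (0 : ℝ)..δ, M s) =
        algebraMap ℝ A δ * slope (fun u => ∫ s in (0 : ℝ)..u, M s) 0 δ := by
      rw [slope_def_module, ← Algebra.smul_def, smul_smul, sub_zero, mul_inv_cancel₀ hne, one_smul]
      simp
    rw [h3]
    exact ((isUnit_iff_ne_zero.2 hne).map (algebraMap ℝ A)).mul h2
  obtain ⟨V, hV⟩ := hV
  refine ⟨(↑V⁻¹ : A) * (Λ δ - 1), fun t ht => ?_⟩
  have hrep : ∀ u : ℝ, 0 ≤ u →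
      Λ u = (↑V⁻¹ : A) * ((∫ s in (0 : ℝ)..(u + δ), M s) - ∫ s in (0 : ℝ)..u, M s) := by
    intro u hu
    have h1 : (∫ s in (0 : ℝ)..δ, M s) * Λ u =
        (∫ s in (0 : ℝ)..(u + δ), M s) - ∫ s in (0 : ℝ)..u, M s := by
      rw [intervalIntegral.integral_interval_sub_left (hI _ _) (hI _ _)]
      have h2 : ∫ s in u..(u + δ), M s = ∫ s in (0 : ℝ)..δ, M (s + u) := by
        rw [intervalIntegral.integral_comp_add_right (fun s => M s)]
        congr 1 <;> ring
      rw [h2]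
      have h3 : ∫ s in (0 : ℝ)..δ, M (s + u) = ∫ s in (0 : ℝ)..δ, M s * Λ u := by
        refine intervalIntegral.integral_congr fun s hs => ?_
        rw [Set.uIcc_of_le hδ.le] at hs
        rw [hMΛ _ (by linarith [hs.1]), hMΛ _ hs.1, hadd _ _ hs.1 hu]
      rw [h3]
      exact (((ContinuousLinearMap.mul ℝ A).flip (Λ u)).intervalIntegral_comp_comm (hI 0 δ)).symm
    rw [← h1, ← hV, Units.inv_mul_cancel_left]
  have hd : HasDerivAt
      (fun u => (↑V⁻¹ : A) * ((∫ s in (0 : ℝ)..(u + δ), M s) - ∫ s in (0 : ℝ)..u, M s))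
      ((↑V⁻¹ : A) * (M (t + δ) - M t)) t :=
    ((HasDerivAt.comp_add_const t δ (hF (t + δ))).sub (hF t)).const_mul _
  rw [hMΛ _ (by linarith), hMΛ _ ht, add_comm t δ, hadd _ _ hδ.le ht] at hd
  have e : (↑V⁻¹ : A) * (Λ δ * Λ t - Λ t) = (↑V⁻¹ : A) * (Λ δ - 1) * Λ t := by
    rw [mul_assoc, sub_mul, one_mul]
  rw [e] at hd
  exact hd.hasDerivWithinAt.congr (fun u hu => hrep u hu) (hrep t ht)

end Semigroup

/-! ### Trace-class operators: rank-one operators, sandwiches and the trace -/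

section StrongLimit

variable {E F : Type*} [NormedAddCommGroup E] [NormedSpace ℂ E] [NormedAddCommGroup F]
  [NormedSpace ℂ F]

theorem tendsto_of_tendsto_on_total {T : ℕ → E →L[ℂ] F} {T' : E →L[ℂ] F} {C : ℝ}
    (hC : ∀ n, ‖T n‖ ≤ C) {S : Set E} (hS : Dense (Submodule.span ℂ S : Set E))
    (h : ∀ s ∈ S, Tendsto (fun n => T n s) atTop (𝓝 (T' s))) (x : E) :
    Tendsto (fun n => T n x) atTop (𝓝 (T' x)) := by
  have hspan : ∀ x ∈ Submodule.span ℂ S, Tendsto (fun n => T n x) atTop (𝓝 (T' x)) := by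
    intro x hx
    induction hx using Submodule.span_induction with
    | mem x hx => exact h x hx
    | zero => simp
    | add x y _ _ hx hy => simpa using hx.add hy
    | smul c x _ hx => simpa using hx.const_smul c
  have hC0 : 0 ≤ C := (norm_nonneg _).trans (hC 0)
  rw [Metric.tendsto_atTop]
  intro ε hε
  obtain ⟨y, hy, hxy⟩ := Metric.dense_iff.1 hS x (ε / (2 * (C + ‖T'‖ + 1))) (by positivity)
  rw [Metric.mem_ball, dist_comm, dist_eq_norm] at hy
  obtain ⟨N, hN⟩ := Metric.tendsto_atTop.1 (hspan y hxy) (ε / 2) (by positivity)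
  refine ⟨N, fun n hn => ?_⟩
  have h1 := hN n hn
  rw [dist_eq_norm] at h1 ⊢
  have e : T n x - T' x = T n (x - y) + (T n y - T' y) - T' (x - y) := by
    simp only [map_sub]; abel
  have h2 : ‖T n (x - y)‖ ≤ C * ‖x - y‖ := (T n).le_of_opNorm_le (hC n) _
  have h3 : ‖T' (x - y)‖ ≤ ‖T'‖ * ‖x - y‖ := T'.le_opNorm _
  have h4 : (C + ‖T'‖ + 1) * ‖x - y‖ < ε / 2 := by
    rw [lt_div_iff₀ (by positivity)] at hy
    nlinarith
  rw [e]
  have := norm_sub_le (T n (x - y) + (T n y - T' y)) (T' (x - y))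
  have := norm_add_le (T n (x - y)) (T n y - T' y)
  nlinarith [norm_nonneg (x - y)]

/-- A bounded sequence of operators that converges on a total set converges strongly. -/
theorem exists_strong_limit [CompleteSpace F] {T : ℕ → E →L[ℂ] F} {C : ℝ}
    (hC : ∀ n, ‖T n‖ ≤ C) {S : Set E} (hS : Dense (Submodule.span ℂ S : Set E))
    (h : ∀ s ∈ S, ∃ a, Tendsto (fun n => T n s) atTop (𝓝 a)) :
    ∃ T' : E →L[ℂ] F, ‖T'‖ ≤ C ∧ ∀ x, Tendsto (fun n => T n x) atTop (𝓝 (T' x)) := by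
  have hC0 : 0 ≤ C := (norm_nonneg _).trans (hC 0)
  have hspan : ∀ x ∈ Submodule.span ℂ S, ∃ a, Tendsto (fun n => T n x) atTop (𝓝 a) := by
    intro x hx
    induction hx using Submodule.span_induction with
    | mem x hx => exact h x hx
    | zero => exact ⟨0, by simp⟩
    | add x y _ _ hx hy =>
      obtain ⟨a, ha⟩ := hx
      obtain ⟨b, hb⟩ := hy
      exact ⟨a + b, by simpa using ha.add hb⟩
    | smul c x _ hx =>
      obtain ⟨a, ha⟩ := hx
      exact ⟨c • a, by simpa using ha.const_smul c⟩
  have hlim : ∀ x, ∃ a, Tendsto (fun n => T n x) atTop (𝓝 a) := by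
    intro x
    refine cauchySeq_tendsto_of_complete (Metric.cauchySeq_iff'.2 fun ε hε => ?_)
    obtain ⟨y, hy, hxy⟩ := Metric.dense_iff.1 hS x (ε / (4 * (C + 1))) (by positivity)
    rw [Metric.mem_ball, dist_comm, dist_eq_norm] at hy
    obtain ⟨a, ha⟩ := hspan y hxy
    obtain ⟨N, hN⟩ := Metric.cauchySeq_iff'.1 ha.cauchySeq (ε / 2) (by positivity)
    refine ⟨N, fun n hn => ?_⟩
    have h1 := hN n hn
    rw [dist_eq_norm] at h1 ⊢
    have e : T n x - T N x = T n (x - y) + (T n y - T N y) - T N (x - y) := by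
      simp only [map_sub]; abel
    have h2 : ‖T n (x - y)‖ ≤ C * ‖x - y‖ := (T n).le_of_opNorm_le (hC n) _
    have h3 : ‖T N (x - y)‖ ≤ C * ‖x - y‖ := (T N).le_of_opNorm_le (hC N) _
    have h4 : (C + 1) * ‖x - y‖ < ε / 4 := by
      rw [lt_div_iff₀ (by positivity)] at hy
      nlinarith
    rw [e]
    have := norm_sub_le (T n (x - y) + (T n y - T N y)) (T N (x - y))
    have := norm_add_le (T n (x - y)) (T n y - T N y)
    nlinarith [norm_nonneg (x - y)]
  choose f hf using hlim
  let g : E →ₗ[ℂ] F :=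
    { toFun := f
      map_add' := fun x y => tendsto_nhds_unique (hf (x + y)) (by simpa using (hf x).add (hf y))
      map_smul' := fun c x =>
        tendsto_nhds_unique (hf (c • x)) (by simpa using (hf x).const_smul c) }
  have hg : ∀ x, ‖g x‖ ≤ C * ‖x‖ := fun x =>
    le_of_tendsto (hf x).norm (Eventually.of_forall fun n => (T n).le_of_opNorm_le (hC n) x)
  exact ⟨g.mkContinuous C hg, g.mkContinuous_norm_le hC0 hg, hf⟩

theorem summable_of_pairwise_inner_eq_zero {E : Type*} [NormedAddCommGroup E]
    [InnerProductSpace ℂ E] [CompleteSpace E] {v : ℕ → E}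
    (horth : ∀ i j, i ≠ j → inner ℂ (v i) (v j) = 0) (hs : Summable fun i => ‖v i‖ ^ 2) :
    Summable v := by
  rw [summable_iff_vanishing_norm]
  intro ε hε
  obtain ⟨s, hs⟩ := summable_iff_vanishing_norm.1 hs (ε ^ 2) (by positivity)
  refine ⟨s, fun t ht => ?_⟩
  have h1 := hs t ht
  have h2 : ‖∑ i ∈ t, v i‖ ^ 2 = ∑ i ∈ t, ‖v i‖ ^ 2 := by
    have : (inner ℂ (∑ i ∈ t, v i) (∑ i ∈ t, v i) : ℂ) = ∑ i ∈ t, inner ℂ (v i) (v i) := by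
      rw [sum_inner]
      refine Finset.sum_congr rfl fun i hi => ?_
      rw [inner_sum, Finset.sum_eq_single i (fun j _ hj => horth i j hj.symm) (fun h => (h hi).elim)]
    simp only [inner_self_eq_norm_sq_to_K] at this
    exact_mod_cast this
  rw [← h2] at h1
  rw [Real.norm_of_nonneg (by positivity)] at h1
  exact lt_of_pow_lt_pow_left₀ 2 hε.le h1

end StrongLimit

section TraceClassMore

variable {H : Type*} [NormedAddCommGroup H] [InnerProductSpace ℂ H]

/-- The rank-one operators `|x⟩⟨y|` as a nuclear representation with one term. -/
theorem IsNuclearRep.rankOne (x y : H) : IsNuclearRep (InnerProductSpace.rankOne ℂ x y)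
    (Pi.single 0 x) (Pi.single 0 y) := by
  have h0 : ∀ n ∉ ({0} : Finset ℕ), Pi.single (M := fun _ => H) 0 x n = 0 := by
    intro n hn
    rw [Pi.single_eq_of_ne]; simpa using hn
  refine ⟨summable_of_ne_finset_zero (s := {0}) fun n hn => by rw [h0 n hn]; simp, ?_⟩
  have := hasSum_sum_of_ne_finset_zero (s := {0}) (L := .unconditional ℕ)
    (f := fun n => InnerProductSpace.rankOne ℂ (Pi.single (M := fun _ => H) 0 x n)
      (Pi.single (M := fun _ => H) 0 y n)) fun n hn => by rw [h0 n hn]; simp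
  simpa using this

namespace TraceClass

/-- The rank-one operator `|x⟩⟨y|`. -/
noncomputable def ketbra (x y : H) : TraceClass H := ⟨rankOne ℂ x y, _, _, IsNuclearRep.rankOne x y⟩

theorem op_ketbra (x y : H) : (ketbra x y).op = rankOne ℂ x y := rfl

theorem op_ketbra_apply (x y z : H) : (ketbra x y).op z = (inner ℂ y z : ℂ) • x := by
  rw [op_ketbra, rankOne_apply]

theorem norm_ketbra_le (x y : H) : ‖ketbra x y‖ ≤ ‖x‖ * ‖y‖ := by
  refine (traceNorm_le (IsNuclearRep.rankOne x y)).trans (le_of_eq ?_)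
  rw [tsum_eq_single 0 fun n hn => by simp [Pi.single_eq_of_ne hn]]
  simp

theorem ketbra_add_left (x x' y : H) : ketbra (x + x') y = ketbra x y + ketbra x' y :=
  ext' (by simp [op_add, op_ketbra])

theorem ketbra_smul_left (c : ℂ) (x y : H) : ketbra (c • x) y = c • ketbra x y :=
  ext' (by simp [op_smul, op_ketbra])

theorem ketbra_zero_left (y : H) : ketbra 0 y = 0 := ext' (by simp [op_zero, op_ketbra])

theorem ketbra_zero_right (x : H) : ketbra x 0 = 0 := ext' (by simp [op_zero, op_ketbra])

theorem op_fsum {ι : Type*} (s : Finset ι) (v : ι → TraceClass H) :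
    (∑ n ∈ s, v n).op = ∑ n ∈ s, (v n).op :=
  map_sum (⟨⟨op, op_zero⟩, op_add⟩ : TraceClass H →+ (H →L[ℂ] H)) v s

variable (H) in
/-- The inclusion of the trace-class operators into the bounded operators. -/
noncomputable def opL : TraceClass H →L[ℂ] (H →L[ℂ] H) :=
  LinearMap.mkContinuous
    { toFun := op, map_add' := op_add, map_smul' := op_smul } 1
    fun σ => by rw [one_mul]; exact opNorm_le_traceNorm σ.rep

theorem norm_op_le (σ : TraceClass H) : ‖σ.op‖ ≤ ‖σ‖ := opNorm_le_traceNorm σ.rep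

/-- The matrix element `⟨x, σ y⟩` as a functional of `σ`. -/
noncomputable def elemL (x y : H) : TraceClass H →L[ℂ] ℂ :=
  (innerSL ℂ x).comp ((ContinuousLinearMap.apply ℂ H y).comp (opL H))

theorem elemL_apply (x y : H) (σ : TraceClass H) : elemL x y σ = inner ℂ x (σ.op y) := rfl

variable [CompleteSpace H]

theorem hasSum_ketbra {σ : TraceClass H} {x y : ℕ → H} (h : IsNuclearRep σ.op x y) :
    HasSum (fun n => ketbra (x n) (y n)) σ := by
  have hs : Summable fun n => ketbra (x n) (y n) :=
    Summable.of_norm (Summable.of_nonneg_of_le (fun n => norm_nonneg _)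
      (fun n => norm_ketbra_le _ _) h.1)
  have h2 := (opL H).hasSum hs.hasSum
  have h3 : (∑' n, ketbra (x n) (y n)).op = σ.op := h2.unique h.2
  rw [← ext' h3]
  exact hs.hasSum

theorem dense_span_ketbra :
    Dense (Submodule.span ℂ (Set.range fun p : H × H => ketbra p.1 p.2) : Set (TraceClass H)) := by
  intro σ
  obtain ⟨x, y, h⟩ := σ.rep
  refine mem_closure_of_tendsto (hasSum_ketbra h) (Eventually.of_forall fun s => ?_)
  exact Submodule.sum_mem _ fun n _ => Submodule.subset_span ⟨(x n, y n), rfl⟩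

theorem clm_ext {F : Type*} [NormedAddCommGroup F] [NormedSpace ℂ F]
    {f g : TraceClass H →L[ℂ] F} (h : ∀ x y, f (ketbra x y) = g (ketbra x y)) : f = g := by
  ext σ
  obtain ⟨x, y, hr⟩ := σ.rep
  have h1 := f.hasSum (hasSum_ketbra hr)
  simp only [h] at h1
  exact h1.unique (g.hasSum (hasSum_ketbra hr))

theorem norm_clm_le {F : Type*} [NormedAddCommGroup F] [NormedSpace ℂ F]
    (f : TraceClass H →L[ℂ] F) {C : ℝ} (hC : 0 ≤ C)
    (h : ∀ x y, ‖f (ketbra x y)‖ ≤ C * (‖x‖ * ‖y‖)) : ‖f‖ ≤ C := by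
  refine f.opNorm_le_bound hC fun σ => le_of_forall_pos_le_add fun ε hε => ?_
  obtain ⟨x, y, hr, hlt⟩ := exists_rep_lt σ.rep (ε := ε / (C + 1)) (by positivity)
  have h1 := f.hasSum (hasSum_ketbra hr)
  have h2 : ‖f σ‖ ≤ C * ∑' n, ‖x n‖ * ‖y n‖ :=
    h1.norm_le_of_bounded (hr.1.mul_left C).hasSum (fun n => h _ _) |>.trans_eq tsum_mul_left
  have h3 : C * (ε / (C + 1)) ≤ ε := by
    rw [mul_div_assoc', div_le_iff₀ (by positivity)]
    nlinarith
  have h4 : ∑' n, ‖x n‖ * ‖y n‖ ≤ ‖σ‖ + ε / (C + 1) := hlt.le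
  nlinarith [mul_le_mul_of_nonneg_left h4 hC]

/-- A bounded sequence of operators on the trace class converges strongly as soon as it converges
on the rank-one operators. -/
theorem exists_strong_limit {F : Type*} [NormedAddCommGroup F] [NormedSpace ℂ F] [CompleteSpace F]
    {T : ℕ → TraceClass H →L[ℂ] F} {C : ℝ} (hC : ∀ n, ‖T n‖ ≤ C)
    (h : ∀ x y, ∃ a, Tendsto (fun n => T n (ketbra x y)) atTop (𝓝 a)) :
    ∃ T' : TraceClass H →L[ℂ] F, ‖T'‖ ≤ C ∧ ∀ σ, Tendsto (fun n => T n σ) atTop (𝓝 (T' σ)) :=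
  _root_.exists_strong_limit hC dense_span_ketbra (by rintro _ ⟨p, rfl⟩; exact h _ _)

theorem tendsto_of_tendsto_ketbra {F : Type*} [NormedAddCommGroup F] [NormedSpace ℂ F]
    {T : ℕ → TraceClass H →L[ℂ] F} {T' : TraceClass H →L[ℂ] F} {C : ℝ} (hC : ∀ n, ‖T n‖ ≤ C)
    (h : ∀ x y, Tendsto (fun n => T n (ketbra x y)) atTop (𝓝 (T' (ketbra x y))))
    (σ : TraceClass H) : Tendsto (fun n => T n σ) atTop (𝓝 (T' σ)) :=
  tendsto_of_tendsto_on_total hC dense_span_ketbra (by rintro _ ⟨p, rfl⟩; exact h _ _) σ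

/-! #### Sandwiches -/

theorem sandwich_ketbra (B C : H →L[ℂ] H) (x y : H) :
    sandwich B (ketbra x y) C = ketbra (B x) (star C y) := by
  apply ext'
  rw [op_sandwich, op_ketbra, op_ketbra, ContinuousLinearMap.star_eq_adjoint,
    rankOne_comp, comp_rankOne]

theorem norm_sandwich_le (B : H →L[ℂ] H) (σ : TraceClass H) (C : H →L[ℂ] H) :
    ‖sandwich B σ C‖ ≤ ‖B‖ * ‖C‖ * ‖σ‖ := by
  refine le_of_forall_pos_le_add fun ε hε => ?_
  obtain ⟨x, y, hr, hlt⟩ := exists_rep_lt σ.rep (ε := ε / (‖B‖ * ‖C‖ + 1)) (by positivity)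
  have hn : ∀ n, ‖B (x n)‖ * ‖star C (y n)‖ ≤ ‖B‖ * ‖C‖ * (‖x n‖ * ‖y n‖) := fun n => by
    calc _ ≤ (‖B‖ * ‖x n‖) * (‖star C‖ * ‖y n‖) := by
            gcongr <;> exact ContinuousLinearMap.le_opNorm _ _
        _ = _ := by rw [norm_star]; ring
  have hrep : IsNuclearRep (sandwich B σ C).op (fun n => B (x n)) (fun n => star C (y n)) := by
    refine ⟨Summable.of_nonneg_of_le (fun n => by positivity) hn (hr.1.mul_left _), ?_⟩
    have h1 := ((ContinuousLinearMap.compL ℂ H H H B).hasSum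
        (((ContinuousLinearMap.compL ℂ H H H).flip C).hasSum hr.2))
    simpa [InnerProductSpace.rankOne_comp, InnerProductSpace.comp_rankOne, op_sandwich,
      ContinuousLinearMap.star_eq_adjoint] using h1
  have h2 := (traceNorm_le hrep).trans
    (hrep.1.tsum_le_tsum hn (hr.1.mul_left _))
  rw [tsum_mul_left] at h2
  have h3 : (‖B‖ * ‖C‖) * (ε / (‖B‖ * ‖C‖ + 1)) ≤ ε := by
    rw [mul_div_assoc', div_le_iff₀ (by positivity)]
    nlinarith [mul_nonneg (norm_nonneg B) (norm_nonneg C)]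
  have h4 : ∑' n, ‖x n‖ * ‖y n‖ ≤ ‖σ‖ + ε / (‖B‖ * ‖C‖ + 1) := hlt.le
  have h5 : ‖sandwich B σ C‖ ≤ ‖B‖ * ‖C‖ * ∑' n, ‖x n‖ * ‖y n‖ := h2
  nlinarith [mul_le_mul_of_nonneg_left h4 (mul_nonneg (norm_nonneg B) (norm_nonneg C))]

/-- `σ ↦ B σ C` as a bounded operator on the trace class. -/
noncomputable def sandwichL (B C : H →L[ℂ] H) : TraceClass H →L[ℂ] TraceClass H :=
  LinearMap.mkContinuous
    { toFun := fun σ => sandwich B σ C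
      map_add' := fun σ τ => ext' (by simp [op_sandwich, op_add])
      map_smul' := fun c σ => ext' (by simp [op_sandwich, op_smul]) } (‖B‖ * ‖C‖)
    fun σ => norm_sandwich_le B σ C

theorem sandwichL_apply (B C : H →L[ℂ] H) (σ : TraceClass H) :
    sandwichL B C σ = sandwich B σ C := rfl

theorem norm_sandwichL_le (B C : H →L[ℂ] H) : ‖sandwichL B C‖ ≤ ‖B‖ * ‖C‖ :=
  LinearMap.mkContinuous_norm_le _ (by positivity) _

theorem sandwichL_add_left (B B' C : H →L[ℂ] H) :
    sandwichL (B + B') C = sandwichL B C + sandwichL B' C := by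
  ext σ; exact ext' (by simp [sandwichL_apply, op_sandwich, op_add])

theorem sandwichL_add_right (B C C' : H →L[ℂ] H) :
    sandwichL B (C + C') = sandwichL B C + sandwichL B C' := by
  ext σ; exact ext' (by simp [sandwichL_apply, op_sandwich, op_add])

theorem sandwichL_smul_left (c : ℂ) (B C : H →L[ℂ] H) :
    sandwichL (c • B) C = c • sandwichL B C := by
  ext σ; exact ext' (by simp [sandwichL_apply, op_sandwich, op_smul])

theorem sandwichL_smul_right (c : ℂ) (B C : H →L[ℂ] H) :
    sandwichL B (c • C) = c • sandwichL B C := by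
  ext σ; exact ext' (by simp [sandwichL_apply, op_sandwich, op_smul])

theorem sandwichL_zero_left (C : H →L[ℂ] H) : sandwichL 0 C = 0 := by
  simpa using sandwichL_smul_left 0 0 C

theorem sandwichL_zero_right (B : H →L[ℂ] H) : sandwichL B 0 = 0 := by
  simpa using sandwichL_smul_right 0 B 0

theorem sandwichL_sum_left {ι : Type*} (s : Finset ι) (B : ι → H →L[ℂ] H) (C : H →L[ℂ] H) :
    sandwichL (∑ i ∈ s, B i) C = ∑ i ∈ s, sandwichL (B i) C :=
  map_sum (⟨⟨fun B => sandwichL B C, sandwichL_zero_left C⟩, fun B B' =>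
    sandwichL_add_left B B' C⟩ : (H →L[ℂ] H) →+ _) B s

theorem sandwichL_sum_right {ι : Type*} (s : Finset ι) (B : H →L[ℂ] H) (C : ι → H →L[ℂ] H) :
    sandwichL B (∑ i ∈ s, C i) = ∑ i ∈ s, sandwichL B (C i) :=
  map_sum (⟨⟨fun C => sandwichL B C, sandwichL_zero_right B⟩, fun C C' =>
    sandwichL_add_right B C C'⟩ : (H →L[ℂ] H) →+ _) C s

/-- The anticommutator `σ ↦ {B, σ}` as a bounded operator on the trace class. -/
noncomputable def anticommL (B : H →L[ℂ] H) : TraceClass H →L[ℂ] TraceClass H := sandwichL B 1 + sandwichL 1 B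

theorem anticommL_apply (B : H →L[ℂ] H) (σ : TraceClass H) : anticommL B σ = anticomm B σ := rfl

theorem anticommL_add (B B' : H →L[ℂ] H) : anticommL (B + B') = anticommL B + anticommL B' := by
  rw [anticommL, anticommL, anticommL, sandwichL_add_left, sandwichL_add_right]; abel

theorem anticommL_smul (c : ℂ) (B : H →L[ℂ] H) : anticommL (c • B) = c • anticommL B := by
  rw [anticommL, anticommL, sandwichL_smul_left, sandwichL_smul_right, smul_add]

theorem anticommL_zero : anticommL (0 : H →L[ℂ] H) = 0 := by
  rw [anticommL, sandwichL_zero_left, sandwichL_zero_right, add_zero]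

theorem anticommL_sum {ι : Type*} (s : Finset ι) (B : ι → H →L[ℂ] H) :
    anticommL (∑ i ∈ s, B i) = ∑ i ∈ s, anticommL (B i) :=
  map_sum (⟨⟨anticommL, anticommL_zero⟩, anticommL_add⟩ : (H →L[ℂ] H) →+ _) B s

/-! #### The trace -/

theorem hasSum_trace {ι : Type*} (b : HilbertBasis ι ℂ H) {σ : TraceClass H} {x y : ℕ → H}
    (h : IsNuclearRep σ.op x y) :
    HasSum (fun i => inner ℂ (b i) (σ.op (b i))) (∑' n, inner ℂ (y n) (x n)) := by
  have h1 : ∀ n, HasSum (fun i => inner ℂ (y n) (b i) * inner ℂ (b i) (x n)) (inner ℂ (y n) (x n)) :=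
    fun n => b.hasSum_inner_mul_inner _ _
  have hsq : ∀ z : H, HasSum (fun i => ‖inner ℂ (b i) z‖ ^ 2) (‖z‖ ^ 2) := by
    intro z
    have h2 := b.hasSum_inner_mul_inner z z
    have h3 : ∀ i, (inner ℂ z (b i) * inner ℂ (b i) z : ℂ) = ((‖inner ℂ (b i) z‖ ^ 2 : ℝ) : ℂ) := by
      intro i
      rw [← inner_conj_symm z (b i), Complex.conj_mul']
      push_cast; rfl
    simp only [h3, inner_self_eq_norm_sq_to_K] at h2
    exact Complex.hasSum_ofReal.1 (by push_cast at h2 ⊢; exact h2)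
  have h2 : ∀ n, Summable fun i => ‖(inner ℂ (y n) (b i) * inner ℂ (b i) (x n) : ℂ)‖ := fun n => by
    refine Summable.of_nonneg_of_le (fun i => norm_nonneg _) (fun i => ?_)
      ((hsq (x n)).summable.add (hsq (y n)).summable)
    rw [norm_mul, norm_inner_symm (y n)]
    nlinarith [sq_nonneg (‖(inner ℂ (b i) (x n) : ℂ)‖ - ‖(inner ℂ (b i) (y n) : ℂ)‖),
      sq_nonneg ‖(inner ℂ (b i) (x n) : ℂ)‖, sq_nonneg ‖(inner ℂ (b i) (y n) : ℂ)‖]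
  have h3 : ∀ n, ∑' i, ‖(inner ℂ (y n) (b i) * inner ℂ (b i) (x n) : ℂ)‖ ≤ ‖x n‖ * ‖y n‖ := fun n => by
    have := Real.inner_le_Lp_mul_Lq_tsum_of_nonneg (p := 2) (q := 2)
      (Real.HolderConjugate.two_two) (f := fun i => ‖(inner ℂ (b i) (x n) : ℂ)‖)
      (g := fun i => ‖(inner ℂ (b i) (y n) : ℂ)‖) (fun _ => norm_nonneg _) (fun _ => norm_nonneg _)
      (by simpa using (hsq (x n)).summable) (by simpa using (hsq (y n)).summable)
    have h4 := this
    simp only [Real.rpow_two, (hsq _).tsum_eq] at h4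
    rw [← Real.sqrt_eq_rpow, ← Real.sqrt_eq_rpow, Real.sqrt_sq (norm_nonneg _),
      Real.sqrt_sq (norm_nonneg _)] at h4
    refine le_trans (le_of_eq (tsum_congr fun i => ?_)) h4
    rw [norm_mul, norm_inner_symm (y n), mul_comm]
  have hsum : Summable fun p : ℕ × ι => (inner ℂ (y p.1) (b p.2) * inner ℂ (b p.2) (x p.1) : ℂ) := by
    refine Summable.of_norm ((summable_prod_of_nonneg fun p => norm_nonneg _).2 ⟨h2, ?_⟩)
    exact Summable.of_nonneg_of_le (fun n => tsum_nonneg fun _ => norm_nonneg _) h3 h.1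
  have h5 := hsum.hasSum.prod_fiberwise h1
  have h6 : HasSum (fun p : ι × ℕ => (inner ℂ (y p.2) (b p.1) * inner ℂ (b p.1) (x p.2) : ℂ))
      (∑' n, inner ℂ (y n) (x n)) := by
    rw [h5.tsum_eq]
    exact (Equiv.hasSum_iff (Equiv.prodComm ι ℕ)).2 hsum.hasSum
  refine h6.prod_fiberwise fun i => ?_
  have h7 := (elemL (b i) (b i)).hasSum (hasSum_ketbra h)
  simpa [elemL_apply, op_ketbra_apply, inner_smul_right] using h7

theorem trace_eq_tsum {σ : TraceClass H} {x y : ℕ → H} (h : IsNuclearRep σ.op x y) :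
    σ.trace = ∑' n, inner ℂ (y n) (x n) := by
  have hb := (exists_hilbertBasis ℂ H).choose_spec.choose_spec
  exact (hasSum_trace _ h).tsum_eq

variable (H) in
/-- The trace as a bounded functional. -/
noncomputable def traceL : TraceClass H →L[ℂ] ℂ :=
  LinearMap.mkContinuous
    { toFun := trace
      map_add' := fun σ τ => by
        obtain ⟨x, y, h⟩ := σ.rep
        obtain ⟨x', y', h'⟩ := τ.rep
        obtain ⟨u, v, k⟩ := (σ + τ).rep
        refine (hasSum_trace (exists_hilbertBasis ℂ H).choose_spec.choose k).tsum_eq.trans ?_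
        rw [← (hasSum_trace (exists_hilbertBasis ℂ H).choose_spec.choose k).tsum_eq]
        refine HasSum.tsum_eq ?_
        have := (hasSum_trace (exists_hilbertBasis ℂ H).choose_spec.choose h).add
          (hasSum_trace (exists_hilbertBasis ℂ H).choose_spec.choose h')
        rw [trace_eq_tsum h, trace_eq_tsum h']
        simpa [op_add, inner_add_right] using this
      map_smul' := fun c σ => by
        obtain ⟨x, y, h⟩ := σ.rep
        have := (hasSum_trace (exists_hilbertBasis ℂ H).choose_spec.choose h).mul_left c
        rw [RingHom.id_apply, trace_eq_tsum h]
        refine HasSum.tsum_eq ?_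
        simpa [op_smul, inner_smul_right] using this } 1
    fun σ => by
      refine le_of_forall_pos_le_add fun ε hε => ?_
      obtain ⟨x, y, h, hlt⟩ := exists_rep_lt σ.rep hε
      have h1 : ‖∑' n, (inner ℂ (y n) (x n) : ℂ)‖ ≤ ∑' n, ‖x n‖ * ‖y n‖ :=
        tsum_of_norm_bounded h.1.hasSum fun n => by
          rw [mul_comm]; exact norm_inner_le_norm _ _
      change ‖σ.trace‖ ≤ _
      rw [trace_eq_tsum h, one_mul]
      exact h1.trans hlt.le

theorem traceL_apply (σ : TraceClass H) : traceL H σ = σ.trace := rfl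

theorem trace_ketbra (x y : H) : (ketbra x y).trace = inner ℂ y x := by
  rw [trace_eq_tsum (σ := ketbra x y) (IsNuclearRep.rankOne x y),
    tsum_eq_single 0 fun n hn => by simp [Pi.single_eq_of_ne hn]]
  simp

theorem trace_sandwich (B C : H →L[ℂ] H) (σ : TraceClass H) :
    (sandwich B σ C).trace = (sandwich (C * B) σ 1).trace := by
  have : (traceL H).comp (sandwichL B C) = (traceL H).comp (sandwichL (C * B) 1) := by
    refine clm_ext fun x y => ?_
    simp only [ContinuousLinearMap.comp_apply, sandwichL_apply, sandwich_ketbra, traceL_apply,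
      trace_ketbra, star_one]
    simp [ContinuousLinearMap.star_eq_adjoint, ContinuousLinearMap.adjoint_inner_left]
  exact congrArg (fun f => f σ) this

/-- The trace pairing separates bounded operators. -/
theorem eq_of_trace_sandwich_eq {B C : H →L[ℂ] H}
    (h : ∀ σ, (sandwich B σ 1).trace = (sandwich C σ 1).trace) : B = C := by
  refine ContinuousLinearMap.ext fun x => ext_inner_left ℂ fun y => ?_
  simpa [sandwich_ketbra, trace_ketbra] using h (ketbra x y)

end TraceClass

end TraceClassMore

/-! ### Parseval sequences and Gram vectors -/

section Parseval

variable {H : Type*} [NormedAddCommGroup H] [InnerProductSpace ℂ H]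

/-- A sequence of pairwise orthogonal vectors with `x = ∑ᵢ ⟨eᵢ, x⟩ eᵢ` for all `x`: an orthonormal
basis of `H` continued by zeros, which allows for all separable Hilbert spaces at once. -/
structure IsParsevalSeq (e : ℕ → H) : Prop where
  inner_eq_zero : ∀ i j, i ≠ j → inner ℂ (e i) (e j) = 0
  hasSum : ∀ x, HasSum (fun i => (inner ℂ (e i) x : ℂ) • e i) x

theorem exists_isParsevalSeq [CompleteSpace H] [TopologicalSpace.SeparableSpace H] :
    ∃ e : ℕ → H, IsParsevalSeq e := by
  obtain ⟨ι, b, -⟩ := exists_hilbertBasis ℂ H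
  have : Countable ι := by
    have hb : ∀ i j : ι, i ≠ j → 1 ≤ dist (b i) (b j) := by
      intro i j hij
      have h1 : ‖b i - b j‖ ^ 2 = 2 := by
        rw [@norm_sub_sq ℂ, b.orthonormal.1, b.orthonormal.1, b.orthonormal.2 hij]
        norm_num
      rw [dist_eq_norm]
      nlinarith [norm_nonneg (b i - b j)]
    have hd : DiscreteTopology (Set.range b) := by
      refine DiscreteTopology.of_forall_le_dist (r := 1) one_pos ?_
      rintro ⟨_, i, rfl⟩ ⟨_, j, rfl⟩ hij
      exact hb i j fun h => hij (by simp [h])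
    have : SecondCountableTopology H := UniformSpace.secondCountable_of_separable H
    have hc : Countable (Set.range b) := by
      have := TopologicalSpace.separableSpace_iff_countable (α := Set.range b)
      exact this.1 inferInstance
    have hinj : Function.Injective b := b.orthonormal.linearIndependent.injective
    exact (Set.rangeFactorization_injective.2 hinj).countable
  obtain ⟨f, hf⟩ := exists_injective_nat ι
  refine ⟨Function.extend f b 0, ?_, fun x => ?_⟩
  · intro i j hij
    by_cases hi : ∃ a, f a = i
    · obtain ⟨a, rfl⟩ := hi
      by_cases hj : ∃ a, f a = j
      · obtain ⟨a', rfl⟩ := hj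
        rw [hf.extend_apply, hf.extend_apply]
        exact b.orthonormal.2 fun h => hij (by rw [h])
      · rw [Function.extend_apply' _ _ j hj]; simp
    · rw [Function.extend_apply' _ _ i hi]; simp
  · rw [← hf.hasSum_iff]
    · simpa [Function.comp_def, hf.extend_apply, b.repr_apply_apply] using b.hasSum_repr x
    · intro i hi
      rw [Function.extend_apply' _ _ i (by simpa using hi)]; simp

namespace IsParsevalSeq

variable {e : ℕ → H} (he : IsParsevalSeq e)

include he

theorem inner_self_smul (i : ℕ) : (inner ℂ (e i) (e i) : ℂ) • e i = e i := by
  have := he.hasSum (e i)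
  refine ((hasSum_single i fun j hj => ?_).unique this)
  rw [he.inner_eq_zero j i hj, zero_smul]

theorem norm_le_one (i : ℕ) : ‖e i‖ ≤ 1 := by
  by_cases h : e i = 0
  · simp [h]
  have h1 := congrArg norm (he.inner_self_smul i)
  rw [norm_smul, inner_self_eq_norm_sq_to_K] at h1
  simp only [norm_pow, RCLike.norm_ofReal, abs_norm] at h1
  have h2 : 0 < ‖e i‖ := norm_pos_iff.2 h
  nlinarith

theorem inner_mul_inner (i : ℕ) (x : H) :
    (inner ℂ (e i) (e i) * inner ℂ (e i) x : ℂ) = inner ℂ (e i) x := by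
  conv_rhs => rw [← he.inner_self_smul i]
  rw [inner_smul_left, inner_conj_symm]

theorem hasSum_inner (x y : H) :
    HasSum (fun i => (inner ℂ x (e i) * inner ℂ (e i) y : ℂ)) (inner ℂ x y) := by
  have := (innerSL ℂ x).hasSum (he.hasSum y)
  simpa [inner_smul_right, mul_comm] using this

theorem hasSum_norm_sq (x : H) : HasSum (fun i => ‖(inner ℂ (e i) x : ℂ)‖ ^ 2) (‖x‖ ^ 2) := by
  have h2 := he.hasSum_inner x x
  have h3 : ∀ i, (inner ℂ x (e i) * inner ℂ (e i) x : ℂ) = ((‖inner ℂ (e i) x‖ ^ 2 : ℝ) : ℂ) := by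
    intro i
    rw [← inner_conj_symm x (e i), Complex.conj_mul']
    push_cast; rfl
  simp only [h3, inner_self_eq_norm_sq_to_K] at h2
  exact Complex.hasSum_ofReal.1 (by push_cast at h2 ⊢; exact h2)

theorem sum_norm_sq_le (s : Finset ℕ) (x : H) :
    ∑ i ∈ s, ‖(inner ℂ (e i) x : ℂ)‖ ^ 2 ≤ ‖x‖ ^ 2 :=
  sum_le_hasSum s (fun i _ => by positivity) (he.hasSum_norm_sq x)

theorem norm_sum_smul_sq_le (s : Finset ℕ) (a : ℕ → ℂ) :
    ‖∑ i ∈ s, a i • e i‖ ^ 2 ≤ ∑ i ∈ s, ‖a i‖ ^ 2 := by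
  have : (inner ℂ (∑ i ∈ s, a i • e i) (∑ i ∈ s, a i • e i) : ℂ) =
      ∑ i ∈ s, ((‖a i‖ ^ 2 * ‖e i‖ ^ 2 : ℝ) : ℂ) := by
    rw [sum_inner]
    refine Finset.sum_congr rfl fun i hi => ?_
    rw [inner_sum, Finset.sum_eq_single i]
    · rw [inner_smul_left, inner_smul_right, inner_self_eq_norm_sq_to_K, ← mul_assoc,
        Complex.conj_mul']
      push_cast; rfl
    · intro j _ hj
      rw [inner_smul_left, inner_smul_right, he.inner_eq_zero i j hj.symm, mul_zero, mul_zero]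
    · exact fun h => (h hi).elim
  rw [inner_self_eq_norm_sq_to_K, ← Complex.ofReal_sum] at this
  have h2 : ‖∑ i ∈ s, a i • e i‖ ^ 2 = ∑ i ∈ s, ‖a i‖ ^ 2 * ‖e i‖ ^ 2 := by
    refine Complex.ofReal_injective ?_
    rw [← this]; push_cast; rfl
  rw [h2]
  refine Finset.sum_le_sum fun i _ => ?_
  have := he.norm_le_one i
  have h3 : ‖e i‖ ^ 2 ≤ 1 := pow_le_one₀ (norm_nonneg _) this
  nlinarith [sq_nonneg ‖a i‖]

theorem dense_span : Dense (Submodule.span ℂ (Set.range e) : Set H) := fun x =>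
  mem_closure_of_tendsto (he.hasSum x) (Eventually.of_forall fun _ =>
    Submodule.sum_mem _ fun i _ => Submodule.smul_mem _ _ (Submodule.subset_span ⟨i, rfl⟩))

theorem ext_inner {x y : H} (h : ∀ i, (inner ℂ (e i) x : ℂ) = inner ℂ (e i) y) : x = y := by
  have h1 := he.hasSum x
  simp only [h] at h1
  exact h1.unique (he.hasSum y)

/-- Operators with equal matrices are equal. -/
theorem ext_op {A B : H →L[ℂ] H}
    (h : ∀ i j, (inner ℂ (e i) (A (e j)) : ℂ) = inner ℂ (e i) (B (e j))) : A = B := by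
  have h1 : ∀ j, A (e j) = B (e j) := fun j => he.ext_inner fun i => h i j
  refine ContinuousLinearMap.ext_on he.dense_span ?_
  rintro _ ⟨j, rfl⟩
  exact h1 j

end IsParsevalSeq

end Parseval

/-- A positive semidefinite matrix `w` over `ℕ` factorizes as `w = c c†` with `c` lower
triangular: the entries are the coordinates of Gram vectors of `w` in their Gram-Schmidt basis. -/
theorem Matrix.PosSemidef.exists_triangular {w : Matrix ℕ ℕ ℂ} (hw : w.PosSemidef) :
    ∃ c : ℕ → ℕ → ℂ, (∀ α m, α < m → c α m = 0) ∧
      ∀ α β N, α < N → w α β = ∑ m ∈ Finset.range N, c α m * starRingEnd ℂ (c β m) := by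
  -- Gram vectors, from the reproducing kernel Hilbert space of `w`
  obtain ⟨K, _, _, _, ξ, hξ⟩ : ∃ (K : Type) (_ : NormedAddCommGroup K) (_ : InnerProductSpace ℂ K)
      (_ : CompleteSpace K) (ξ : ℕ → K), ∀ α β, w α β = inner ℂ (ξ β) (ξ α) := by
    let M : Matrix ℕ ℕ (ℂ →L[ℂ] ℂ) := fun x y => w y x • (1 : ℂ →L[ℂ] ℂ)
    have hM : M.PosSemidef := by
      have htfae := (RKHS.posSemidef_tfae (K := M)).out 0 2
      rw [htfae]
      refine ⟨?_, fun v => ?_⟩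
      · refine Matrix.IsHermitian.ext fun i j => ?_
        change star (w i j • (1 : ℂ →L[ℂ] ℂ)) = w j i • (1 : ℂ →L[ℂ] ℂ)
        rw [star_smul, star_one, hw.1.apply j i]
      · have h1 := (hw.transpose).2 v
        rw [Complex.le_def] at h1
        have h2 := h1.1
        refine le_of_le_of_eq h2 ?_
        rw [Finsupp.sum_comm]
        rw [← RCLike.re_eq_complex_re, ← RCLike.conj_re]
        congr 1
        simp only [Finsupp.sum, map_sum]
        refine Finset.sum_congr rfl fun x _ => Finset.sum_congr rfl fun y _ => ?_
        simp [M]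
        ring
    have : Fact M.PosSemidef := ⟨hM⟩
    refine ⟨RKHS.OfKernel M, inferInstance, inferInstance, inferInstance,
      fun x => RKHS.kerFun (RKHS.OfKernel M) x (1 : ℂ), fun α β => ?_⟩
    have h1 := RKHS.kernel_inner (RKHS.OfKernel M) α β (1 : ℂ) (1 : ℂ)
    rw [RKHS.OfKernel.kernel_ofKernel] at h1
    rw [← h1]
    have := hw.1.apply α β
    simp [M]
    exact this.symm
  set η := gramSchmidtNormed ℂ ξ with hη
  have hη0 : ∀ m, η m = ((‖gramSchmidt ℂ ξ m‖ : ℂ)⁻¹) • gramSchmidt ℂ ξ m := fun m => rfl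
  have hη1 : ∀ i j, i ≠ j → inner ℂ (η i) (η j) = 0 := by
    intro i j hij
    rw [hη0, hη0, inner_smul_left, inner_smul_right, gramSchmidt_orthogonal ℂ ξ hij]
    simp
  have hη2 : ∀ i, (inner ℂ (η i) (η i) : ℂ) • η i = η i := by
    intro i
    by_cases h : η i = 0
    · simp [h]
    rw [inner_self_eq_norm_sq_to_K, gramSchmidtNormed_unit_length' h]
    simp
  have hexp : ∀ N, ∀ x ∈ Submodule.span ℂ (η '' Set.Iio N),
      x = ∑ m ∈ Finset.range N, (inner ℂ (η m) x : ℂ) • η m := by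
    intro N x hx
    induction hx using Submodule.span_induction with
    | mem x hx =>
      obtain ⟨j, hj, rfl⟩ := hx
      rw [Finset.sum_eq_single j]
      · exact (hη2 j).symm
      · intro i _ hij
        rw [hη1 i j hij, zero_smul]
      · exact fun h => (h (Finset.mem_range.2 hj)).elim
    | zero => simp
    | add x y _ _ hx hy =>
      simp only [inner_add_right, add_smul, Finset.sum_add_distrib]
      rw [← hx, ← hy]
    | smul c x _ hx =>
      simp only [inner_smul_right, mul_smul]
      rw [← Finset.smul_sum, ← hx]
  have hmem : ∀ α N, α < N → ξ α ∈ Submodule.span ℂ (η '' Set.Iio N) := by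
    intro α N h
    rw [hη, span_gramSchmidtNormed]
    exact Submodule.span_mono (Set.image_mono fun m hm => lt_of_le_of_lt hm h)
      (mem_span_gramSchmidt ℂ ξ (le_refl α))
  refine ⟨fun α m => inner ℂ (η m) (ξ α), fun α m h => ?_, fun α β N h => ?_⟩
  · change inner ℂ (η m) (ξ α) = 0
    rw [hη0, inner_smul_left, gramSchmidt_inv_triangular ℂ ξ h, mul_zero]
  · rw [hξ]
    conv_lhs => rw [hexp N (ξ α) (hmem α N h), inner_sum]
    refine Finset.sum_congr rfl fun m _ => ?_
    rw [inner_smul_right, inner_conj_symm]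

/-! ### Completely positive maps given by a Choi matrix -/

/-- The number of `k` with `Nat.pair i k < N`; see `pair_lt_iff_lt_rowLen`. Since `Nat.pair` fills
squares, the pairs below `N` are a full square of side `s = N.sqrt`, part of the column `s` and part
of the row `s`. -/
def rowLen (N i : ℕ) : ℕ :=
  if i < N.sqrt then (if N.sqrt * N.sqrt + i < N then N.sqrt + 1 else N.sqrt)
  else if i = N.sqrt then N - (N.sqrt * N.sqrt + N.sqrt) else 0

theorem pair_lt_iff_lt_rowLen (N i k : ℕ) : Nat.pair i k < N ↔ k < rowLen N i := by
  have h1 := Nat.sqrt_le N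
  have h2 := Nat.lt_succ_sqrt N
  unfold rowLen Nat.pair
  obtain ⟨s, hs⟩ : ∃ s, N.sqrt = s := ⟨_, rfl⟩
  rw [hs] at h1 h2 ⊢
  rw [Nat.succ_eq_add_one] at h2
  have h2' : N < s * s + 2 * s + 1 := by nlinarith
  have hk : ∀ j, s < j → s * s + 2 * s + 1 ≤ j * j := fun j hj => by nlinarith
  have hk' : ∀ j, j < s → j * j + 2 * j + 1 ≤ s * s := fun j hj => by nlinarith
  have hk2 : k = s → k * k = s * s := fun h => by rw [h]
  have hi2 : i = s → i * i = s * s := fun h => by rw [h]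
  have hk3 := hk k
  have hk4 := hk' k
  have hi3 := hk i
  have hi4 := hk' i
  clear hk hk'
  generalize k * k = kk at *
  generalize i * i = ii at *
  generalize s * s = ss at *
  rcases lt_trichotomy k s with h | h | h <;> rcases lt_trichotomy i s with h' | h' | h' <;>
    split_ifs <;> omega

/-- The rows of the first `N` pairs are cut at `√N` or `√N + 1` or are empty, apart from the row
`√N`. -/
theorem rowLen_cases (N i : ℕ) : rowLen N i = N.sqrt ∨ rowLen N i = N.sqrt + 1 ∨ rowLen N i = 0 ∨
    i = N.sqrt := by
  unfold rowLen; split_ifs <;> simp_all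

section

variable {H : Type*} [NormedAddCommGroup H] [InnerProductSpace ℂ H]

/-- The identity, followed by the matrix units `|eᵢ⟩⟨eₖ|` in the order of the Cantor-type pairing
`Nat.pair`. -/
noncomputable def matUnit (e : ℕ → H) : ℕ → H →L[ℂ] H
  | 0 => 1
  | a + 1 => rankOne ℂ (e a.unpair.1) (e a.unpair.2)

/-- A Choi matrix for the operators `matUnit e`: it is positive semidefinite, does not involve the
identity, and its partial trace over the output index is bounded by `C`. For the completely positive
map `T` with this matrix the last condition says that `tr T(|x⟩⟨x|) ≤ C ‖x‖²`. -/
structure IsChoiMatrix (w : Matrix ℕ ℕ ℂ) (C : ℝ) : Prop where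
  posSemidef : w.PosSemidef
  zero_left : ∀ α, w 0 α = 0
  bound : ∀ (N : ℕ) (x : ℕ → ℂ), ∑ i ∈ Finset.range N, (∑ k ∈ Finset.range N, ∑ l ∈ Finset.range N,
    w (Nat.pair i k + 1) (Nat.pair i l + 1) * x k * starRingEnd ℂ (x l)).re
      ≤ C * ∑ k ∈ Finset.range N, ‖x k‖ ^ 2

end

theorem sum_range_unpair {E : Type*} [AddCommMonoid E] (f : ℕ → ℕ → E) (N : ℕ) :
    ∑ a ∈ Finset.range N, f a.unpair.1 a.unpair.2 =
      ∑ i ∈ Finset.range N, ∑ k ∈ Finset.range (rowLen N i), f i k := by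
  rw [Finset.sum_sigma']
  refine Finset.sum_nbij' (fun a => ⟨a.unpair.1, a.unpair.2⟩) (fun p => Nat.pair p.1 p.2)
    ?_ ?_ ?_ ?_ ?_
  · intro a ha
    rw [Finset.mem_range] at ha
    simp only [Finset.mem_sigma, Finset.mem_range]
    refine ⟨lt_of_le_of_lt (Nat.unpair_left_le a) ha, ?_⟩
    rw [← pair_lt_iff_lt_rowLen, Nat.pair_unpair]
    exact ha
  · rintro ⟨i, k⟩ h
    simp only [Finset.mem_sigma, Finset.mem_range] at h ⊢
    exact (pair_lt_iff_lt_rowLen N i k).2 h.2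
  · intro a _; simp
  · rintro ⟨i, k⟩ _; simp
  · intro a _; rfl

/-- Lower triangular Kraus coefficients `c` of a Choi matrix `w = c c†`. Triangularity lets the
section of `w` by `α, β < N` factorize through the section of `c`. -/
structure IsKrausCoeff (c : ℕ → ℕ → ℂ) (w : Matrix ℕ ℕ ℂ) (C : ℝ) : Prop where
  triangular : ∀ α m, α < m → c α m = 0
  zero_left : ∀ m, c 0 m = 0
  factor : ∀ α β N, α < N → w α β = ∑ m ∈ Finset.range N, c α m * starRingEnd ℂ (c β m)
  bound : ∀ (B N r : ℕ) (x : ℕ → ℂ), r ≤ N → ∑ i ∈ Finset.range N, ∑ m ∈ Finset.range B,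
    ‖∑ k ∈ Finset.range r, c (Nat.pair i k + 1) m * x k‖ ^ 2
      ≤ C * ∑ k ∈ Finset.range r, ‖x k‖ ^ 2

theorem IsChoiMatrix.exists_krausCoeff {w : Matrix ℕ ℕ ℂ} {C : ℝ} (hw : IsChoiMatrix w C) :
    ∃ c, IsKrausCoeff c w C := by
  obtain ⟨c, hc, hf⟩ := hw.posSemidef.exists_triangular
  refine ⟨c, hc, ?_, hf, ?_⟩
  · intro m
    rcases Nat.eq_zero_or_pos m with rfl | h
    · have := hf 0 0 1 one_pos
      rw [hw.zero_left, Finset.sum_range_one, Complex.mul_conj'] at this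
      have h2 : ‖c 0 0‖ = 0 := by
        have := pow_eq_zero_iff (two_ne_zero) |>.1 this.symm
        exact_mod_cast this
      exact norm_eq_zero.1 h2
    · exact hc 0 m h
  · intro B N r x hr
    -- extend `x` by zero from `{0, …, r - 1}`, to use the bound for `w` at the size `N`
    set x' : ℕ → ℂ := fun k => if k < r then x k else 0 with hx'
    have hN : ∀ f : ℕ → ℂ → ℂ, (∀ k, f k 0 = 0) →
        ∑ k ∈ Finset.range N, f k (x' k) = ∑ k ∈ Finset.range r, f k (x k) := by
      intro f hf
      rw [← Finset.sum_subset (Finset.range_mono hr)]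
      · refine Finset.sum_congr rfl fun k hk => ?_
        simp only [hx']
        rw [if_pos (Finset.mem_range.1 hk)]
      · intro k _ hk
        simp only [hx']
        rw [if_neg (by simpa using hk), hf]
    have h1 := hw.bound N x'
    have h2 : ∑ k ∈ Finset.range N, ‖x' k‖ ^ 2 = ∑ k ∈ Finset.range r, ‖x k‖ ^ 2 := by
      have := hN (fun _ z => ((‖z‖ ^ 2 : ℝ) : ℂ)) (by simp)
      exact_mod_cast this
    rw [h2] at h1
    refine le_trans (Finset.sum_le_sum fun i _ => ?_) h1
    -- a range of summation in which all products of Kraus coefficients occurring here are complete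
    obtain ⟨B', hB, hB'⟩ : ∃ B', B ≤ B' ∧ ∀ k < N, Nat.pair i k + 1 < B' := by
      refine ⟨B + ∑ k ∈ Finset.range N, (Nat.pair i k + 2), by omega, fun k hk => ?_⟩
      have := Finset.single_le_sum (f := fun k => Nat.pair i k + 2) (fun _ _ => Nat.zero_le _)
        (Finset.mem_range.2 hk)
      omega
    have h3 : ∑ k ∈ Finset.range N, ∑ l ∈ Finset.range N,
        w (Nat.pair i k + 1) (Nat.pair i l + 1) * x' k * starRingEnd ℂ (x' l) =
        ∑ m ∈ Finset.range B',
          ((‖∑ k ∈ Finset.range r, c (Nat.pair i k + 1) m * x k‖ ^ 2 : ℝ) : ℂ) := by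
      have h4 : ∀ k ∈ Finset.range N, ∀ l ∈ Finset.range N,
          w (Nat.pair i k + 1) (Nat.pair i l + 1) * x' k * starRingEnd ℂ (x' l) =
          ∑ m ∈ Finset.range B', (c (Nat.pair i k + 1) m * x' k) *
            starRingEnd ℂ (c (Nat.pair i l + 1) m * x' l) := by
        intro k hk l _
        rw [hf _ _ B' (hB' k (Finset.mem_range.1 hk)), Finset.sum_mul, Finset.sum_mul]
        refine Finset.sum_congr rfl fun m _ => ?_
        rw [map_mul]; ring
      rw [Finset.sum_congr rfl fun k hk => Finset.sum_congr rfl (h4 k hk)]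
      rw [Finset.sum_congr rfl fun k _ => Finset.sum_comm, Finset.sum_comm]
      refine Finset.sum_congr rfl fun m _ => ?_
      rw [← hN (fun k z => c (Nat.pair i k + 1) m * z) (by simp)]
      push_cast
      rw [← Complex.mul_conj', map_sum, Finset.sum_mul_sum]
    rw [h3, ← Complex.ofReal_sum, Complex.ofReal_re]
    exact Finset.sum_le_sum_of_subset_of_nonneg (Finset.range_mono hB) fun _ _ _ => by positivity

namespace IsKrausCoeff

variable {c : ℕ → ℕ → ℂ} {w : Matrix ℕ ℕ ℂ} {C : ℝ} (hc : IsKrausCoeff c w C)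

include hc

theorem bound_single (B i r : ℕ) (x : ℕ → ℂ) :
    ∑ m ∈ Finset.range B, ‖∑ k ∈ Finset.range r, c (Nat.pair i k + 1) m * x k‖ ^ 2
      ≤ C * ∑ k ∈ Finset.range r, ‖x k‖ ^ 2 :=
  le_trans (Finset.single_le_sum (f := fun i => ∑ m ∈ Finset.range B,
    ‖∑ k ∈ Finset.range r, c (Nat.pair i k + 1) m * x k‖ ^ 2)
    (fun _ _ => Finset.sum_nonneg fun _ _ => by positivity)
    (Finset.mem_range.2 (by omega : i < i + r + 1)))
    (hc.bound B (i + r + 1) r x (by omega))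

theorem nonneg : 0 ≤ C := by
  have h := hc.bound_single 0 0 1 fun _ => 1
  simpa using h

/-- The bound survives a cut-off of the index pairs at an initial segment of the enumeration:
all rows but one are cut at one of two fixed lengths. -/
theorem bound_cutoff (B N : ℕ) (x : ℕ → ℂ) (S : ℝ) (hS : ∀ r, ∑ k ∈ Finset.range r, ‖x k‖ ^ 2 ≤ S) :
    ∑ i ∈ Finset.range N, ∑ m ∈ Finset.range B,
      ‖∑ k ∈ Finset.range (rowLen N i), c (Nat.pair i k + 1) m * x k‖ ^ 2 ≤ 3 * C * S := by
  set q : ℕ → ℕ → ℝ := fun i r => ∑ m ∈ Finset.range B,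
      ‖∑ k ∈ Finset.range r, c (Nat.pair i k + 1) m * x k‖ ^ 2 with hq
  have hq0 : ∀ i r, 0 ≤ q i r := fun i r => Finset.sum_nonneg fun _ _ => by positivity
  have hC := hc.nonneg
  set s := N.sqrt with hs
  have h1 : ∀ i ∈ Finset.range N, q i (rowLen N i) ≤ q i s + q i (s + 1) +
      if i = s then q s (rowLen N s) else 0 := by
    intro i _
    have a1 := hq0 i s
    have a2 := hq0 i (s + 1)
    have a3 : 0 ≤ if i = s then q s (rowLen N s) else 0 := by split_ifs <;> simp [hq0]
    rcases rowLen_cases N i with h | h | h | h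
    · rw [h]; linarith
    · rw [h]; linarith
    · have : q i 0 = 0 := by simp [hq]
      rw [h, this]; linarith
    · rw [if_pos h, h]
      rw [h] at a1 a2
      linarith
  have h2 : ∀ r ≤ N + 1, ∑ i ∈ Finset.range N, q i r ≤ C * S := fun r hr =>
    (Finset.sum_le_sum_of_subset_of_nonneg (Finset.range_mono (Nat.le_succ N))
      fun i _ _ => hq0 i r).trans
      ((hc.bound B (N + 1) r x hr).trans (mul_le_mul_of_nonneg_left (hS r) hC))
  have h3 : ∑ i ∈ Finset.range N, (if i = s then q s (rowLen N s) else 0) ≤ C * S := by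
    have h4 : q s (rowLen N s) ≤ C * S :=
      (hc.bound_single B s _ x).trans (mul_le_mul_of_nonneg_left (hS _) hC)
    rw [Finset.sum_ite_eq']
    split_ifs
    · exact h4
    · exact (hq0 _ _).trans h4
  have hsN : s ≤ N := Nat.sqrt_le_self N
  calc ∑ i ∈ Finset.range N, q i (rowLen N i) ≤ _ := Finset.sum_le_sum h1
    _ = ∑ i ∈ Finset.range N, q i s + ∑ i ∈ Finset.range N, q i (s + 1) +
        ∑ i ∈ Finset.range N, (if i = s then q s (rowLen N s) else 0) := by
      rw [Finset.sum_add_distrib, Finset.sum_add_distrib]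
    _ ≤ 3 * C * S := by linarith [h2 s (by omega), h2 (s + 1) (by omega)]

end IsKrausCoeff

/-! #### Truncated Stinespring operators -/

theorem sqrt_sum_norm_sq_le {H : Type*} [NormedAddCommGroup H] (u : lp (fun _ : ℕ => H) 2) (n : ℕ) :
    √(∑ m ∈ Finset.range n, ‖u m‖ ^ 2) ≤ ‖u‖ := by
  have := lp.sum_rpow_le_norm_rpow (p := 2) (by norm_num) u (Finset.range n)
  refine Real.sqrt_le_iff.2 ⟨norm_nonneg _, ?_⟩
  simpa using this

theorem norm_sq_sum_single {H : Type*} [NormedAddCommGroup H] (s : Finset ℕ) (f : ℕ → H) :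
    ‖∑ m ∈ s, lp.single (E := fun _ : ℕ => H) 2 m (f m)‖ ^ 2 = ∑ m ∈ s, ‖f m‖ ^ 2 := by
  have := lp.norm_sum_single (E := fun _ : ℕ => H) (p := 2) (by norm_num) f s
  simpa using this

section

variable {H : Type*} [NormedAddCommGroup H] [InnerProductSpace ℂ H]

/-- The Kraus operator `∑_{α < n} c_{αm} L_α`, truncated to the first `n` operators `L_α`. -/
noncomputable def krausOp (c : ℕ → ℕ → ℂ) (e : ℕ → H) (n m : ℕ) : H →L[ℂ] H :=
  ∑ α ∈ Finset.range n, c α m • matUnit e α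

/-- The truncated Kraus operators as one operator `x ↦ (K_m x)_m` into `ℓ²(ℕ; H)`. -/
noncomputable def stinespring (c : ℕ → ℕ → ℂ) (e : ℕ → H) (n : ℕ) :
    H →L[ℂ] lp (fun _ : ℕ => H) 2 :=
  ∑ m ∈ Finset.range n,
    (lp.singleContinuousLinearMap ℂ (fun _ : ℕ => H) 2 m).comp (krausOp c e n m)

namespace IsKrausCoeff

variable {c : ℕ → ℕ → ℂ} {w : Matrix ℕ ℕ ℂ} {C : ℝ} {e : ℕ → H}

theorem krausOp_eq_zero (hc : IsKrausCoeff c w C) {n m : ℕ} (h : n ≤ m) : krausOp c e n m = 0 := by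
  refine Finset.sum_eq_zero fun α hα => ?_
  rw [hc.triangular α m (lt_of_lt_of_le (Finset.mem_range.1 hα) h), zero_smul]

/-- Index `0` does not contribute, so `N + 1` operators `L_α` amount to the first `N` pairs. -/
theorem krausOp_succ_apply (hc : IsKrausCoeff c w C) (N m : ℕ) (x : H) :
    krausOp c e (N + 1) m x = ∑ i ∈ Finset.range N,
      (∑ k ∈ Finset.range (rowLen N i), c (Nat.pair i k + 1) m * inner ℂ (e k) x) • e i := by
  rw [krausOp, Finset.sum_range_succ', hc.zero_left, zero_smul, add_zero,
    sum_apply]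
  have := sum_range_unpair (fun i k => (c (Nat.pair i k + 1) m * inner ℂ (e k) x) • e i) N
  simp only [Finset.sum_smul]
  rw [← this]
  refine Finset.sum_congr rfl fun a _ => ?_
  rw [Nat.pair_unpair, matUnit, smul_apply, rankOne_apply, smul_smul]

theorem stinespring_apply (hc : IsKrausCoeff c w C) (n m : ℕ) (x : H) :
    stinespring c e n x m = krausOp c e n m x := by
  rw [stinespring, sum_apply, lp.coeFn_sum, Finset.sum_apply]
  by_cases h : m < n
  · rw [Finset.sum_eq_single m]
    · simp
    · intro b _ hb
      simp [Pi.single_eq_of_ne hb.symm]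
    · exact fun h' => (h' (Finset.mem_range.2 h)).elim
  · rw [hc.krausOp_eq_zero (not_lt.1 h), zero_apply]
    refine Finset.sum_eq_zero fun b hb => ?_
    have : m ≠ b := by have := Finset.mem_range.1 hb; omega
    simp [Pi.single_eq_of_ne this]

theorem norm_stinespring_sq (n : ℕ) (x : H) :
    ‖stinespring c e n x‖ ^ 2 = ∑ m ∈ Finset.range n, ‖krausOp c e n m x‖ ^ 2 := by
  rw [stinespring, sum_apply]
  exact norm_sq_sum_single _ _

theorem sum_norm_krausOp_sq_le (hc : IsKrausCoeff c w C) (he : IsParsevalSeq e) (n : ℕ) (x : H) :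
    ∑ m ∈ Finset.range n, ‖krausOp c e n m x‖ ^ 2 ≤ 3 * C * ‖x‖ ^ 2 := by
  rcases n with _ | N
  · have := hc.nonneg
    simp only [Finset.range_zero, Finset.sum_empty]
    positivity
  refine le_trans (Finset.sum_le_sum fun m _ => ?_)
    (Finset.sum_comm.trans_le (hc.bound_cutoff (N + 1) N (fun k => inner ℂ (e k) x) _
      fun r => he.sum_norm_sq_le _ x))
  rw [hc.krausOp_succ_apply]
  exact he.norm_sum_smul_sq_le _ _

theorem norm_stinespring_le (hc : IsKrausCoeff c w C) (he : IsParsevalSeq e) (n : ℕ) :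
    ‖stinespring c e n‖ ≤ √(3 * C) := by
  refine ContinuousLinearMap.opNorm_le_bound _ (Real.sqrt_nonneg _) fun x => ?_
  have h1 := hc.sum_norm_krausOp_sq_le he n x
  rw [← norm_stinespring_sq] at h1
  have h2 := Real.sqrt_le_sqrt h1
  rwa [Real.sqrt_sq (norm_nonneg _), Real.sqrt_mul (by linarith [hc.nonneg]),
    Real.sqrt_sq (norm_nonneg _)] at h2

theorem tendsto_rowLen (i : ℕ) : Tendsto (fun N => rowLen N i) atTop atTop := by
  rw [tendsto_atTop_atTop]
  intro b
  refine ⟨Nat.pair i b + 1, fun N hN => ?_⟩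
  exact ((pair_lt_iff_lt_rowLen N i b).1 (by omega)).le

theorem dense_span_single (he : IsParsevalSeq e) :
    Dense (Submodule.span ℂ (Set.range fun p : ℕ × ℕ => lp.single (E := fun _ : ℕ => H) 2 p.1 (e p.2))
      : Set (lp (fun _ : ℕ => H) 2)) := by
  have h1 : ∀ m (y : H), lp.single (E := fun _ : ℕ => H) 2 m y ∈ closure
      (Submodule.span ℂ (Set.range fun p : ℕ × ℕ => lp.single (E := fun _ : ℕ => H) 2 p.1 (e p.2))
        : Set (lp (fun _ : ℕ => H) 2)) := by
    intro m y
    have := (lp.singleContinuousLinearMap ℂ (fun _ : ℕ => H) 2 m).hasSum (he.hasSum y)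
    refine mem_closure_of_tendsto this (Eventually.of_forall fun s => ?_)
    refine Submodule.sum_mem _ fun i _ => ?_
    rw [map_smul]
    exact Submodule.smul_mem _ _ (Submodule.subset_span ⟨(m, i), rfl⟩)
  intro f
  have hf := lp.hasSum_single (E := fun _ : ℕ => H) (p := 2) (by norm_num) f
  rw [← closure_closure]
  refine mem_closure_of_tendsto hf (Eventually.of_forall fun s => ?_)
  rw [← Submodule.topologicalClosure_coe]
  refine Submodule.sum_mem _ fun m _ => ?_
  rw [← SetLike.mem_coe, Submodule.topologicalClosure_coe]
  exact h1 m (f m)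

variable [CompleteSpace H]

/-- The truncated Stinespring operators converge on the basis: `V e_k = ∑_i e_i ⊗ ξ_{ik}` is an
orthogonal series. -/
theorem exists_tendsto_stinespring (hc : IsKrausCoeff c w C) (he : IsParsevalSeq e) (k : ℕ) :
    ∃ a, Tendsto (fun n => stinespring c e n (e k)) atTop (𝓝 a) := by
  -- the factor `⟨e_k, e_k⟩` is `1`, or `0` for the zero vectors in a Parseval sequence
  let v : ℕ → lp (fun _ : ℕ => H) 2 := fun i => (inner ℂ (e k) (e k) : ℂ) •
    ∑ m ∈ Finset.range (Nat.pair i k + 2), lp.single 2 m (c (Nat.pair i k + 1) m • e i)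
  have hv : ∀ i m, v i m = (inner ℂ (e k) (e k) : ℂ) • (c (Nat.pair i k + 1) m • e i) := by
    intro i m
    simp only [v, lp.coeFn_smul, Pi.smul_apply, lp.coeFn_sum, Finset.sum_apply]
    congr 1
    by_cases h : m < Nat.pair i k + 2
    · rw [Finset.sum_eq_single m]
      · simp
      · intro b _ hb
        simp [Pi.single_eq_of_ne hb.symm]
      · exact fun h' => (h' (Finset.mem_range.2 h)).elim
    · rw [hc.triangular _ m (by omega), zero_smul]
      refine Finset.sum_eq_zero fun b hb => ?_
      have : m ≠ b := by have := Finset.mem_range.1 hb; omega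
      simp [Pi.single_eq_of_ne this]
  have hek : ‖(inner ℂ (e k) (e k) : ℂ)‖ ≤ 1 :=
    (norm_inner_le_norm _ _).trans (mul_le_one₀ (he.norm_le_one k) (norm_nonneg _) (he.norm_le_one k))
  have hsum : Summable v := by
    refine summable_of_pairwise_inner_eq_zero ?_ ?_
    · intro i j hij
      rw [lp.inner_eq_tsum]
      refine (tsum_congr fun m => ?_).trans tsum_zero
      rw [hv, hv]
      simp [inner_smul_left, inner_smul_right, he.inner_eq_zero i j hij]
    -- the bound on the Kraus coefficients, tested on the `k`-th basis vector
    · refine summable_of_sum_range_le (c := C) (fun i => by positivity) fun n => ?_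
      have hb := hc.bound (∑ i ∈ Finset.range n, (Nat.pair i k + 2)) (n + k + 1) (k + 1)
        (fun j => if j = k then 1 else 0) (by omega)
      have h1 : ∀ i m, ∑ j ∈ Finset.range (k + 1), c (Nat.pair i j + 1) m *
          (if j = k then 1 else 0 : ℂ) = c (Nat.pair i k + 1) m := by
        intro i m
        simp
      have h2 : ∑ j ∈ Finset.range (k + 1), ‖(if j = k then 1 else 0 : ℂ)‖ ^ 2 = 1 := by
        rw [Finset.sum_eq_single k] <;> simp +contextual
      simp only [h1, h2, mul_one] at hb
      refine le_trans ?_ hb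
      refine le_trans (Finset.sum_le_sum fun i hi => ?_)
        (Finset.sum_le_sum_of_subset_of_nonneg (Finset.range_mono (by omega : n ≤ n + k + 1))
          fun i _ _ => Finset.sum_nonneg fun _ _ => by positivity)
      have h3 : Nat.pair i k + 2 ≤ ∑ i ∈ Finset.range n, (Nat.pair i k + 2) :=
        Finset.single_le_sum (f := fun i => Nat.pair i k + 2) (fun _ _ => Nat.zero_le _) hi
      refine le_trans ?_ (Finset.sum_le_sum_of_subset_of_nonneg (Finset.range_mono h3)
        fun _ _ _ => by positivity)
      have h4 : ‖v i‖ ^ 2 ≤ ‖∑ m ∈ Finset.range (Nat.pair i k + 2),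
          lp.single (E := fun _ : ℕ => H) 2 m (c (Nat.pair i k + 1) m • e i)‖ ^ 2 := by
        simp only [v]
        rw [norm_smul]
        refine pow_le_pow_left₀ (by positivity) ?_ 2
        exact mul_le_of_le_one_left (norm_nonneg _) hek
      refine h4.trans ?_
      rw [norm_sq_sum_single]
      refine Finset.sum_le_sum fun m _ => ?_
      rw [norm_smul]
      refine pow_le_pow_left₀ (by positivity) ?_ 2
      exact mul_le_of_le_one_right (norm_nonneg _) (he.norm_le_one i)
  refine ⟨∑' i, v i, (tendsto_add_atTop_iff_nat 1).1 ?_⟩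
  have hmono : Tendsto (fun N => (Finset.range N).filter fun i => Nat.pair i k < N) atTop atTop := by
    refine tendsto_atTop_finset_of_monotone (fun N N' h i => ?_) fun i => ⟨Nat.pair i k + 1, ?_⟩
    · simp only [Finset.mem_filter, Finset.mem_range]
      omega
    · have := Nat.left_le_pair i k
      simp only [Finset.mem_filter, Finset.mem_range]
      omega
  refine (hsum.hasSum.comp hmono).congr fun N => ?_
  refine lp.ext (funext fun m => ?_)
  rw [hc.stinespring_apply, hc.krausOp_succ_apply, Function.comp_apply, lp.coeFn_sum,
    Finset.sum_apply, Finset.sum_filter]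
  refine Finset.sum_congr rfl fun i _ => ?_
  simp only [pair_lt_iff_lt_rowLen]
  by_cases h : k < rowLen N i
  · rw [if_pos h, hv, Finset.sum_eq_single k, smul_smul, mul_comm]
    · intro j _ hj
      rw [he.inner_eq_zero j k hj, mul_zero]
    · exact fun h' => (h' (Finset.mem_range.2 h)).elim
  · rw [if_neg h, Finset.sum_eq_zero, zero_smul]
    intro j hj
    have : j ≠ k := by have := Finset.mem_range.1 hj; omega
    rw [he.inner_eq_zero j k this, mul_zero]

/-- The adjoints of the truncated Stinespring operators converge on the vectors `e_i ⊗ δ_m`, which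
they map to partial sums of the orthogonal series `∑_k c̄_{ik,m} e_k`. -/
theorem exists_tendsto_adjoint_stinespring (hc : IsKrausCoeff c w C) (he : IsParsevalSeq e)
    (m i : ℕ) : ∃ a, Tendsto (fun n => ContinuousLinearMap.adjoint (stinespring c e n)
      (lp.single (E := fun _ : ℕ => H) 2 m (e i))) atTop (𝓝 a) := by
  let u : ℕ → H := fun k => starRingEnd ℂ (c (Nat.pair i k + 1) m) • e k
  have hsum : Summable u := by
    refine summable_of_pairwise_inner_eq_zero ?_ ?_
    · intro k l hkl
      simp [u, he.inner_eq_zero k l hkl]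
    -- the bound tested on the vector of conjugate coefficients gives `S² ≤ C S` for their square sum
    · refine summable_of_sum_range_le (c := C) (fun i => by positivity) fun r => ?_
      have hb := hc.bound_single (m + 1) i r fun k => starRingEnd ℂ (c (Nat.pair i k + 1) m)
      have h1 := (Finset.single_le_sum (f := fun m' => ‖∑ k ∈ Finset.range r,
        c (Nat.pair i k + 1) m' * starRingEnd ℂ (c (Nat.pair i k + 1) m)‖ ^ 2)
        (fun _ _ => by positivity) (Finset.mem_range.2 (Nat.lt_succ_self m))).trans hb
      set S := ∑ k ∈ Finset.range r, ‖c (Nat.pair i k + 1) m‖ ^ 2 with hS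
      have hS0 : 0 ≤ S := Finset.sum_nonneg fun _ _ => by positivity
      have h2 : ∑ k ∈ Finset.range r,
          c (Nat.pair i k + 1) m * starRingEnd ℂ (c (Nat.pair i k + 1) m) = (S : ℂ) := by
        rw [hS]
        push_cast
        exact Finset.sum_congr rfl fun k _ => Complex.mul_conj' _
      simp only [h2, Complex.norm_real, Real.norm_of_nonneg hS0, RCLike.norm_conj] at h1
      rw [← hS] at h1
      have h3 : S ≤ C := by
        rcases hS0.eq_or_lt with h | h
        · rw [← h]; exact hc.nonneg
        · nlinarith
      refine le_trans (Finset.sum_le_sum fun k _ => ?_) h3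
      simp only [u]
      rw [norm_smul, RCLike.norm_conj]
      refine pow_le_pow_left₀ (by positivity) ?_ 2
      exact mul_le_of_le_one_right (norm_nonneg _) (he.norm_le_one k)
  refine ⟨(inner ℂ (e i) (e i) : ℂ) • ∑' k, u k, (tendsto_add_atTop_iff_nat 1).1 ?_⟩
  have h1 := ((hsum.hasSum.tendsto_sum_nat.comp (tendsto_rowLen i)).const_smul
    (inner ℂ (e i) (e i) : ℂ))
  refine h1.congr' ?_
  filter_upwards [eventually_gt_atTop i] with N hN
  refine ext_inner_right ℂ fun x => ?_
  rw [ContinuousLinearMap.adjoint_inner_left, lp.inner_single_left, hc.stinespring_apply,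
    hc.krausOp_succ_apply, inner_sum, Finset.sum_eq_single i]
  · rw [inner_smul_left, inner_smul_right, Function.comp_apply, sum_inner, inner_conj_symm, mul_comm]
    congr 1
    refine Finset.sum_congr rfl fun k _ => ?_
    simp [u, inner_smul_left]
  · intro j _ hj
    rw [inner_smul_right, he.inner_eq_zero i j hj.symm, mul_zero]
  · exact fun h => (h (Finset.mem_range.2 hN)).elim

/-- Strong convergence of the truncated Stinespring operators and of their adjoints. -/
theorem exists_stinespring_limit (hc : IsKrausCoeff c w C) (he : IsParsevalSeq e) :
    ∃ V : H →L[ℂ] lp (fun _ : ℕ => H) 2, ‖V‖ ≤ √(3 * C) ∧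
      (∀ x, Tendsto (fun n => stinespring c e n x) atTop (𝓝 (V x))) ∧
      ∀ y, Tendsto (fun n => ContinuousLinearMap.adjoint (stinespring c e n) y) atTop
        (𝓝 (ContinuousLinearMap.adjoint V y)) := by
  obtain ⟨V, hV, hVt⟩ := exists_strong_limit (hc.norm_stinespring_le he) he.dense_span
    (by rintro _ ⟨k, rfl⟩; exact hc.exists_tendsto_stinespring he k)
  obtain ⟨V', hV', hVt'⟩ := exists_strong_limit
    (T := fun n => ContinuousLinearMap.adjoint (stinespring c e n)) (C := √(3 * C))
    (fun n => by
      rw [LinearIsometryEquiv.norm_map]; exact hc.norm_stinespring_le he n)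
    (dense_span_single he)
    (by rintro _ ⟨p, rfl⟩; exact hc.exists_tendsto_adjoint_stinespring he p.1 p.2)
  have : V' = ContinuousLinearMap.adjoint V := by
    refine ContinuousLinearMap.ext fun y => ext_inner_right ℂ fun x => ?_
    rw [ContinuousLinearMap.adjoint_inner_left]
    refine tendsto_nhds_unique ((hVt' y).inner tendsto_const_nhds)
      ((tendsto_const_nhds.inner (hVt x)).congr fun n => ?_)
    rw [ContinuousLinearMap.adjoint_inner_left]
  subst this
  exact ⟨V, hV, hVt, hVt'⟩

end IsKrausCoeff

end

/-! #### Convergence of the double sums -/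

section

variable {H : Type*} [NormedAddCommGroup H] [InnerProductSpace ℂ H]

namespace TraceClass

theorem sum_norm_ketbra_le (u v : ℕ → H) (s : Finset ℕ) :
    ∑ m ∈ s, ‖ketbra (u m) (v m)‖ ≤ √(∑ m ∈ s, ‖u m‖ ^ 2) * √(∑ m ∈ s, ‖v m‖ ^ 2) :=
  (Finset.sum_le_sum fun _ _ => norm_ketbra_le _ _).trans
    (Real.sum_mul_le_sqrt_mul_sqrt s _ _)

/-- The partial trace `∑_m |u_m⟩⟨v_m|` of `|u⟩⟨v|` for `u, v ∈ ℓ²(ℕ; H)`. -/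
noncomputable def ptrace (u v : lp (fun _ : ℕ => H) 2) : TraceClass H := ∑' m, ketbra (u m) (v m)

theorem summable_ptrace (u v : lp (fun _ : ℕ => H) 2) :
    Summable fun m => ‖ketbra (u m) (v m)‖ := by
  refine summable_of_sum_range_le (c := ‖u‖ * ‖v‖) (fun _ => norm_nonneg _) fun n => ?_
  refine (sum_norm_ketbra_le _ _ _).trans ?_
  exact mul_le_mul (sqrt_sum_norm_sq_le u n) (sqrt_sum_norm_sq_le v n) (Real.sqrt_nonneg _)
    (norm_nonneg _)

theorem tendsto_ketbra {u v : ℕ → H} {x y : H} (hu : Tendsto u atTop (𝓝 x))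
    (hv : Tendsto v atTop (𝓝 y)) : Tendsto (fun n => ketbra (u n) (v n)) atTop (𝓝 (ketbra x y)) := by
  rw [tendsto_iff_norm_sub_tendsto_zero]
  have h1 : ∀ n, ketbra (u n) (v n) - ketbra x y = ketbra (u n - x) (v n) + ketbra x (v n - y) := by
    intro n
    apply ext'
    simp only [op_sub, op_add, op_ketbra, map_sub, sub_apply]
    abel
  have h2 : Tendsto (fun n => ‖u n - x‖ * ‖v n‖ + ‖x‖ * ‖v n - y‖) atTop (𝓝 0) := by
    have a := (tendsto_iff_norm_sub_tendsto_zero.1 hu).mul hv.norm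
    have b := (tendsto_iff_norm_sub_tendsto_zero.1 hv).const_mul ‖x‖
    simpa using a.add b
  refine squeeze_zero (fun _ => norm_nonneg _) (fun n => ?_) h2
  rw [h1]
  exact (norm_add_le _ _).trans (add_le_add (norm_ketbra_le _ _) (norm_ketbra_le _ _))

theorem norm_ptrace_le (u v : lp (fun _ : ℕ => H) 2) : ‖ptrace u v‖ ≤ ‖u‖ * ‖v‖ := by
  refine (norm_tsum_le_tsum_norm (summable_ptrace u v)).trans ?_
  refine (summable_ptrace u v).tsum_le_of_sum_range_le fun n => ?_
  refine (sum_norm_ketbra_le _ _ _).trans ?_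
  exact mul_le_mul (sqrt_sum_norm_sq_le u n) (sqrt_sum_norm_sq_le v n) (Real.sqrt_nonneg _)
    (norm_nonneg _)

end TraceClass

variable [CompleteSpace H]

namespace TraceClass

theorem tendsto_ptrace {u v : ℕ → lp (fun _ : ℕ => H) 2} {x y : lp (fun _ : ℕ => H) 2}
    (hu : Tendsto u atTop (𝓝 x)) (hv : Tendsto v atTop (𝓝 y)) :
    Tendsto (fun n => ptrace (u n) (v n)) atTop (𝓝 (ptrace x y)) := by
  rw [tendsto_iff_norm_sub_tendsto_zero]
  have h1 : ∀ n, ptrace (u n) (v n) - ptrace x y =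
      ptrace (u n - x) (v n) + ptrace x (v n - y) := by
    intro n
    have hs := fun a b : lp (fun _ : ℕ => H) 2 => (summable_ptrace a b).of_norm
    simp only [ptrace]
    rw [← (hs _ _).tsum_sub (hs _ _), ← (hs _ _).tsum_add (hs _ _)]
    refine tsum_congr fun m => ?_
    apply ext'
    simp only [op_sub, op_add, op_ketbra, lp.coeFn_sub, Pi.sub_apply, map_sub, sub_apply]
    abel
  have h2 : Tendsto (fun n => ‖u n - x‖ * ‖v n‖ + ‖x‖ * ‖v n - y‖) atTop (𝓝 0) := by
    have a := (tendsto_iff_norm_sub_tendsto_zero.1 hu).mul hv.norm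
    have b := (tendsto_iff_norm_sub_tendsto_zero.1 hv).const_mul ‖x‖
    simpa using a.add b
  refine squeeze_zero (fun _ => norm_nonneg _) (fun n => ?_) h2
  rw [h1]
  exact (norm_add_le _ _).trans (add_le_add (norm_ptrace_le _ _) (norm_ptrace_le _ _))

/-- Strong convergence of `M n` and of the adjoints gives `M n σ → M σ` in trace norm, and the same
for `σ (M n)`. -/
theorem tendsto_sandwich_of_strong {M : ℕ → H →L[ℂ] H} {M' : H →L[ℂ] H} {C : ℝ}
    (hC : ∀ n, ‖M n‖ ≤ C) (h : ∀ x, Tendsto (fun n => M n x) atTop (𝓝 (M' x)))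
    (h' : ∀ x, Tendsto (fun n => star (M n) x) atTop (𝓝 (star M' x))) (σ : TraceClass H) :
    Tendsto (fun n => sandwich (M n) σ 1) atTop (𝓝 (sandwich M' σ 1)) ∧
      Tendsto (fun n => sandwich 1 σ (M n)) atTop (𝓝 (sandwich 1 σ M')) := by
  have h1 : ‖(1 : H →L[ℂ] H)‖ ≤ 1 := ContinuousLinearMap.norm_id_le
  have hC0 : 0 ≤ C := (norm_nonneg _).trans (hC 0)
  constructor
  · refine tendsto_of_tendsto_ketbra (T := fun n => sandwichL (M n) 1) (T' := sandwichL M' 1)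
      (C := C) (fun n => ?_) (fun x y => ?_) σ
    · refine (norm_sandwichL_le _ _).trans ?_
      have := hC n
      nlinarith [norm_nonneg (M n), norm_nonneg (1 : H →L[ℂ] H)]
    · simp only [sandwichL_apply, sandwich_ketbra]
      exact tendsto_ketbra (h x) tendsto_const_nhds
  · refine tendsto_of_tendsto_ketbra (T := fun n => sandwichL 1 (M n)) (T' := sandwichL 1 M')
      (C := C) (fun n => ?_) (fun x y => ?_) σ
    · refine (norm_sandwichL_le _ _).trans ?_
      have := hC n
      nlinarith [norm_nonneg (M n), norm_nonneg (1 : H →L[ℂ] H)]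
    · simp only [sandwichL_apply, sandwich_ketbra]
      exact tendsto_ketbra tendsto_const_nhds (h' y)

end TraceClass

open TraceClass

/-- The coefficient matrix `w` defines, with respect to the operators `L`, the jump map
`T σ = ∑ w^{αβ} L_α σ L_β†` and the operator `M = ∑ w^{αβ} L_β† L_α`, in the sense of limits of
partial sums in trace norm. The constant `C` bounds the partial sums. -/
structure HasMatrixSum (L : ℕ → H →L[ℂ] H) (w : Matrix ℕ ℕ ℂ) (C : ℝ)
    (T : TraceClass H →L[ℂ] TraceClass H) (M : H →L[ℂ] H) : Prop where
  bound : ∀ n σ, ‖∑ α ∈ Finset.range n, ∑ β ∈ Finset.range n,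
    w α β • sandwich (L α) σ (star (L β))‖ ≤ C * ‖σ‖
  jump : ∀ σ, HasDoubleSum (fun α β => w α β • sandwich (L α) σ (star (L β))) (T σ)
  anti : ∀ σ, HasDoubleSum (fun α β => w α β • anticomm (star (L β) * L α) σ) (anticomm M σ)
  trace : ∀ σ, (T σ).trace = (sandwich M σ 1).trace

/-- A partial sum with the matrix `w = c c†` in Kraus form, with as many Kraus terms as indices. -/
theorem IsKrausCoeff.sum_smul_eq {c : ℕ → ℕ → ℂ} {w : Matrix ℕ ℕ ℂ} {C : ℝ}
    (hc : IsKrausCoeff c w C) {E : Type*} [AddCommGroup E] [Module ℂ E] (n : ℕ) (f : ℕ → ℕ → E) :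
    ∑ α ∈ Finset.range n, ∑ β ∈ Finset.range n, w α β • f α β =
      ∑ m ∈ Finset.range n, ∑ α ∈ Finset.range n, ∑ β ∈ Finset.range n,
        (c α m * starRingEnd ℂ (c β m)) • f α β := by
  rw [Finset.sum_comm (s := Finset.range n) (t := Finset.range n)
    (f := fun m α => ∑ β ∈ Finset.range n, (c α m * starRingEnd ℂ (c β m)) • f α β)]
  refine Finset.sum_congr rfl fun α hα => ?_
  rw [Finset.sum_comm]
  refine Finset.sum_congr rfl fun β _ => ?_
  rw [hc.factor α β n (Finset.mem_range.1 hα), Finset.sum_smul]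

/-- The double sums of a Choi matrix over the matrix units converge. With the limit `V` of the
truncated Stinespring operators, the jump map sends `|x⟩⟨y|` to the partial trace of `|Vx⟩⟨Vy|`, and
`M = V†V`. -/
theorem IsChoiMatrix.exists_hasMatrixSum {w : Matrix ℕ ℕ ℂ} {C : ℝ} (hw : IsChoiMatrix w C)
    {e : ℕ → H} (he : IsParsevalSeq e) : ∃ T M, HasMatrixSum (matUnit e) w (3 * C) T M := by
  obtain ⟨c, hc⟩ := hw.exists_krausCoeff
  obtain ⟨V, hV, hVt, hVt'⟩ := hc.exists_stinespring_limit he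
  have hC3 : 0 ≤ 3 * C := by linarith [hc.nonneg]
  -- the truncated maps in Kraus form
  have hT : ∀ n, ∑ α ∈ Finset.range n, ∑ β ∈ Finset.range n,
      w α β • sandwichL (matUnit e α) (star (matUnit e β)) =
      ∑ m ∈ Finset.range n, sandwichL (krausOp c e n m) (star (krausOp c e n m)) := by
    intro n
    have h1 : ∀ m, sandwichL (krausOp c e n m) (star (krausOp c e n m)) =
        ∑ α ∈ Finset.range n, ∑ β ∈ Finset.range n, (c α m * starRingEnd ℂ (c β m)) •
          sandwichL (matUnit e α) (star (matUnit e β)) := by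
      intro m
      rw [krausOp, star_sum, sandwichL_sum_left]
      refine Finset.sum_congr rfl fun α _ => ?_
      rw [sandwichL_sum_right]
      refine Finset.sum_congr rfl fun β _ => ?_
      rw [star_smul, sandwichL_smul_left, sandwichL_smul_right, smul_smul]
      rfl
    simp only [h1]
    exact hc.sum_smul_eq n _
  have hM : ∀ n, ∑ α ∈ Finset.range n, ∑ β ∈ Finset.range n,
      w α β • (star (matUnit e β) * matUnit e α) =
      ContinuousLinearMap.adjoint (stinespring c e n) ∘L stinespring c e n := by
    intro n
    have h0 : ContinuousLinearMap.adjoint (stinespring c e n) ∘L stinespring c e n =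
        ∑ m ∈ Finset.range n, star (krausOp c e n m) * krausOp c e n m := by
      refine ContinuousLinearMap.ext fun x => ext_inner_left ℂ fun y => ?_
      rw [ContinuousLinearMap.comp_apply, ContinuousLinearMap.adjoint_inner_right, lp.inner_eq_tsum,
        sum_apply, inner_sum, tsum_eq_sum (s := Finset.range n)]
      · refine Finset.sum_congr rfl fun m _ => ?_
        rw [hc.stinespring_apply, hc.stinespring_apply, ContinuousLinearMap.star_eq_adjoint]
        exact (ContinuousLinearMap.adjoint_inner_right _ _ _).symm
      · intro m hm
        rw [hc.stinespring_apply, hc.krausOp_eq_zero (by simpa using hm)]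
        simp
    rw [h0]
    have h1 : ∀ m, star (krausOp c e n m) * krausOp c e n m =
        ∑ α ∈ Finset.range n, ∑ β ∈ Finset.range n, (c α m * starRingEnd ℂ (c β m)) •
          (star (matUnit e β) * matUnit e α) := by
      intro m
      rw [krausOp, star_sum, Finset.mul_sum]
      refine Finset.sum_congr rfl fun α _ => ?_
      rw [Finset.sum_mul]
      refine Finset.sum_congr rfl fun β _ => ?_
      rw [star_smul, smul_mul_smul_comm, mul_comm (c α m)]
      rfl
    simp only [h1]
    exact hc.sum_smul_eq n _
  have hTk : ∀ n x y, (∑ m ∈ Finset.range n, sandwichL (krausOp c e n m) (star (krausOp c e n m)))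
      (ketbra x y) = ∑ m ∈ Finset.range n, ketbra (krausOp c e n m x) (krausOp c e n m y) := by
    intro n x y
    rw [sum_apply]
    refine Finset.sum_congr rfl fun m _ => ?_
    rw [sandwichL_apply, sandwich_ketbra, star_star]
  have hTbound : ∀ n, ‖∑ m ∈ Finset.range n,
      sandwichL (krausOp c e n m) (star (krausOp c e n m))‖ ≤ 3 * C := by
    intro n
    refine norm_clm_le _ hC3 fun x y => ?_
    rw [hTk]
    refine (norm_sum_le _ _).trans ((sum_norm_ketbra_le _ _ _).trans ?_)
    have h : ∀ x, √(∑ m ∈ Finset.range n, ‖krausOp c e n m x‖ ^ 2) ≤ √(3 * C) * ‖x‖ := by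
      intro x
      rw [← Real.sqrt_sq (norm_nonneg x), ← Real.sqrt_mul hC3]
      exact Real.sqrt_le_sqrt (hc.sum_norm_krausOp_sq_le he n x)
    refine (mul_le_mul (h x) (h y) (Real.sqrt_nonneg _) (by positivity)).trans (le_of_eq ?_)
    calc _ = (√(3 * C) * √(3 * C)) * (‖x‖ * ‖y‖) := by ring
      _ = _ := by rw [Real.mul_self_sqrt hC3]
  obtain ⟨T, -, hTt⟩ := TraceClass.exists_strong_limit hTbound fun x y => by
    refine ⟨ptrace (V x) (V y), (tendsto_ptrace (hVt x) (hVt y)).congr fun n => ?_⟩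
    rw [hTk, ptrace, tsum_eq_sum (s := Finset.range n)]
    · simp only [hc.stinespring_apply]
    · intro m hm
      rw [hc.stinespring_apply, hc.krausOp_eq_zero (by simpa using hm)]
      simp [ketbra_zero_left]
  set M : H →L[ℂ] H := ContinuousLinearMap.adjoint V ∘L V with hMdef
  set Mn : ℕ → H →L[ℂ] H := fun n =>
    ContinuousLinearMap.adjoint (stinespring c e n) ∘L stinespring c e n with hMn
  have hMnb : ∀ n, ‖Mn n‖ ≤ 3 * C := by
    intro n
    refine (ContinuousLinearMap.opNorm_comp_le _ _).trans ?_
    rw [LinearIsometryEquiv.norm_map, ← Real.mul_self_sqrt hC3]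
    exact mul_self_le_mul_self (norm_nonneg _) (hc.norm_stinespring_le he n)
  have hMt : ∀ x, Tendsto (fun n => Mn n x) atTop (𝓝 (M x)) := by
    intro x
    -- `V_n† V_n x - V† V x = V_n† (V_n x - V x) + (V_n† - V†) V x`
    have h1 := hVt' (V x)
    have h2 : Tendsto (fun n => ContinuousLinearMap.adjoint (stinespring c e n)
        (stinespring c e n x - V x)) atTop (𝓝 0) := by
      refine squeeze_zero_norm (a := fun n => √(3 * C) * ‖stinespring c e n x - V x‖) (fun n => ?_) ?_
      · refine ContinuousLinearMap.le_of_opNorm_le _ ?_ _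
        rw [LinearIsometryEquiv.norm_map]
        exact hc.norm_stinespring_le he n
      · simpa using (tendsto_iff_norm_sub_tendsto_zero.1 (hVt x)).const_mul √(3 * C)
    have h3 := h2.add h1
    rw [zero_add] at h3
    refine h3.congr fun n => ?_
    rw [← map_add, sub_add_cancel]
    rfl
  have hself : ∀ A : H →L[ℂ] lp (fun _ : ℕ => H) 2,
      star (ContinuousLinearMap.adjoint A ∘L A) = ContinuousLinearMap.adjoint A ∘L A := by
    intro A
    rw [ContinuousLinearMap.star_eq_adjoint, ContinuousLinearMap.adjoint_comp,
      ContinuousLinearMap.adjoint_adjoint]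
  have hMs := tendsto_sandwich_of_strong hMnb hMt (by simpa only [hMn, hMdef, hself] using hMt)
  refine ⟨T, M, ?_, ?_, ?_, ?_⟩
  · intro n σ
    have h1 := (∑ m ∈ Finset.range n, sandwichL (krausOp c e n m)
      (star (krausOp c e n m))).le_of_opNorm_le (hTbound n) σ
    rw [← hT] at h1
    simpa [sum_apply, smul_apply, sandwichL_apply] using h1
  · intro σ
    refine (hTt σ).congr fun n => ?_
    rw [← hT]
    simp [sum_apply, smul_apply, sandwichL_apply]
  · intro σ
    refine ((hMs σ).1.add (hMs σ).2).congr fun n => ?_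
    change anticommL (Mn n) σ = _
    simp only [hMn]
    rw [← hM, anticommL_sum]
    simp only [anticommL_sum, anticommL_smul, sum_apply, smul_apply, anticommL_apply]
  -- the trace identity holds for the partial sums, by cyclicity
  · intro σ
    have h1 := ((traceL H).continuous.tendsto _).comp (hTt σ)
    have h2 := ((traceL H).continuous.tendsto _).comp (hMs σ).1
    refine tendsto_nhds_unique (h1.congr fun n => ?_) h2
    simp only [Function.comp_apply]
    have h3 : sandwich (Mn n) σ 1 = sandwichL (Mn n) 1 σ := rfl
    rw [← hT, h3]
    simp only [hMn]
    rw [← hM]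
    simp only [sandwichL_sum_left, sandwichL_smul_left, sum_apply, smul_apply, map_sum, map_smul,
      sandwichL_apply, traceL_apply]
    refine Finset.sum_congr rfl fun α _ => Finset.sum_congr rfl fun β _ => ?_
    rw [trace_sandwich]

/-- The matrix elements of the jump map of a Choi matrix are its entries; the factors `⟨eᵢ, eᵢ⟩`
account for the zero vectors in a Parseval sequence. -/
theorem HasMatrixSum.inner_ketbra {w : Matrix ℕ ℕ ℂ} {C C' : ℝ} {T M} {e : ℕ → H}
    (he : IsParsevalSeq e) (hw : IsChoiMatrix w C) (h : HasMatrixSum (matUnit e) w C' T M)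
    (i k j l : ℕ) : (inner ℂ (e i) ((T (ketbra (e k) (e l))).op (e j)) : ℂ) =
      w (Nat.pair i k + 1) (Nat.pair j l + 1) * (inner ℂ (e i) (e i) * inner ℂ (e k) (e k) *
        (inner ℂ (e l) (e l) * inner ℂ (e j) (e j))) := by
  have hcol : ∀ α, w α 0 = 0 := fun α => by
    rw [← hw.posSemidef.1.apply, hw.zero_left, star_zero]
  have h1 := ((elemL (e i) (e j)).continuous.tendsto _).comp (h.jump (ketbra (e k) (e l)))
  refine tendsto_nhds_unique h1 (tendsto_const_nhds.congr' ?_)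
  filter_upwards [eventually_gt_atTop (Nat.pair i k + 1 + (Nat.pair j l + 1))] with n hn
  have h2 : ∀ α β, elemL (e i) (e j) (w α β • sandwich (matUnit e α) (ketbra (e k) (e l))
      (star (matUnit e β))) = if α = Nat.pair i k + 1 then (if β = Nat.pair j l + 1 then
      w (Nat.pair i k + 1) (Nat.pair j l + 1) * (inner ℂ (e i) (e i) * inner ℂ (e k) (e k) *
        (inner ℂ (e l) (e l) * inner ℂ (e j) (e j))) else 0) else 0 := by
    intro α β
    rw [map_smul, elemL_apply, sandwich_ketbra, star_star, op_ketbra_apply, inner_smul_right,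
      smul_eq_mul]
    rcases α with _ | a
    · rw [hw.zero_left, zero_mul, if_neg (by omega)]
    rcases β with _ | b
    · rw [hcol, zero_mul, if_neg (by omega : ¬ 0 = _ + 1)]; simp
    have h3 : ∀ a i k, (inner ℂ (e i) (matUnit e (a + 1) (e k)) : ℂ) =
        if a + 1 = Nat.pair i k + 1 then inner ℂ (e i) (e i) * inner ℂ (e k) (e k) else 0 := by
      intro a i k
      rw [matUnit, rankOne_apply, inner_smul_right]
      split_ifs with h
      · rw [Nat.succ_injective h, Nat.unpair_pair, mul_comm]
      · by_cases h4 : i = a.unpair.1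
        · have h5 : a.unpair.2 ≠ k := by
            rintro rfl
            exact h (by rw [h4, Nat.pair_unpair])
          rw [he.inner_eq_zero _ _ h5, zero_mul]
        · rw [he.inner_eq_zero _ _ h4, mul_zero]
    rw [h3 a i k, ← inner_conj_symm, h3 b j l]
    by_cases ha : a + 1 = Nat.pair i k + 1
    · by_cases hb : b + 1 = Nat.pair j l + 1
      · rw [if_pos ha, if_pos hb, if_pos ha, if_pos hb, ha, hb, map_mul, inner_conj_symm,
          inner_conj_symm]
        ring
      · rw [if_neg hb, if_pos ha, if_pos ha, if_neg hb, map_zero, zero_mul, mul_zero]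
    · rw [if_neg ha, if_neg ha, mul_zero, mul_zero]
  simp only [Function.comp_apply, map_sum, h2]
  rw [Finset.sum_eq_single (Nat.pair i k + 1), Finset.sum_eq_single (Nat.pair j l + 1)]
  · simp
  · intro β _ hβ
    simp [hβ]
  · intro hh
    exact (hh (Finset.mem_range.2 (by omega))).elim
  · intro α _ hα
    simp [hα]
  · intro hh
    exact (hh (Finset.mem_range.2 (by omega))).elim

end

/-! ### Disintegration of bimeasures -/

section Bimeasure

open ProbabilityTheory

variable {Z : Type*} [MeasurableSpace Z]

/-- A bimeasure: for measurable `A ⊆ Y`, a measure `β A` on `Z`, countably additive in `A`. -/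
structure IsBimeasure {Y : Type*} [MeasurableSpace Y] (β : Set Y → Measure Z) : Prop where
  empty : β ∅ = 0
  iUnion : ∀ f : ℕ → Set Y, (∀ n, MeasurableSet (f n)) → Pairwise (Function.onFun Disjoint f) →
    ∀ B, MeasurableSet B → β (⋃ n, f n) B = ∑' n, β (f n) B

namespace IsBimeasure

variable {Y : Type*} [MeasurableSpace Y] {β : Set Y → Measure Z} (hβ : IsBimeasure β)

/-- The measure `A ↦ β A B`. -/
noncomputable def section₁ {B : Set Z} (hB : MeasurableSet B) : Measure Y :=
  Measure.ofMeasurable (fun A _ => β A B) (by rw [hβ.empty]; rfl)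
    fun f hf hd => hβ.iUnion f hf hd B hB

theorem section₁_apply {B : Set Z} (hB : MeasurableSet B) {A : Set Y} (hA : MeasurableSet A) :
    hβ.section₁ hB A = β A B := Measure.ofMeasurable_apply A hA

include hβ in
theorem mono {A A' : Set Y} (hA : MeasurableSet A) (hA' : MeasurableSet A') (h : A ⊆ A') :
    β A ≤ β A' := by
  refine Measure.le_iff.2 fun B hB => ?_
  rw [← hβ.section₁_apply hB hA, ← hβ.section₁_apply hB hA']
  exact measure_mono h

include hβ in
theorem comp_preimage {Y' : Type*} [MeasurableSpace Y'] {f : Y → Y'} (hf : Measurable f) :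
    IsBimeasure fun A => β (f ⁻¹' A) where
  empty := hβ.empty
  iUnion g hg hd B hB := by
    rw [Set.preimage_iUnion]
    exact hβ.iUnion _ (fun n => hf (hg n)) (fun i j hij => (hd hij).preimage f) B hB

include hβ in
/-- The densities of a bimeasure with respect to its total mass depend continuously on decreasing
sequences of sets. -/
theorem tendsto_rnDeriv_of_antitone [IsFiniteMeasure (β Set.univ)] {E : ℕ → Set Y} {E' : Set Y}
    (hE : ∀ n, MeasurableSet (E n)) (hanti : Antitone E) (hE' : ⋂ n, E n = E')
    (hle : ∀ A, MeasurableSet A → ∀ B, MeasurableSet B →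
      ∫⁻ z in B, (β A).rnDeriv (β Set.univ) z ∂(β Set.univ) = β A B)
    (hmono : ∀ A A', MeasurableSet A → MeasurableSet A' → A ⊆ A' →
      ∀ᵐ z ∂(β Set.univ), (β A).rnDeriv (β Set.univ) z ≤ (β A').rnDeriv (β Set.univ) z) :
    ∀ᵐ z ∂(β Set.univ), Tendsto (fun n => (β (E n)).rnDeriv (β Set.univ) z) atTop
      (𝓝 ((β E').rnDeriv (β Set.univ) z)) := by
  have hEm : MeasurableSet E' := hE' ▸ MeasurableSet.iInter hE
  have h1 : ∀ᵐ z ∂(β Set.univ), ∀ n, (β E').rnDeriv (β Set.univ) z ≤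
      (β (E n)).rnDeriv (β Set.univ) z := by
    rw [ae_all_iff]
    exact fun n => hmono _ _ hEm (hE n) (hE' ▸ Set.iInter_subset E n)
  have h2 : ∀ᵐ z ∂(β Set.univ), Antitone fun n => (β (E n)).rnDeriv (β Set.univ) z := by
    have : ∀ᵐ z ∂(β Set.univ), ∀ n, (β (E (n + 1))).rnDeriv (β Set.univ) z ≤
        (β (E n)).rnDeriv (β Set.univ) z := by
      rw [ae_all_iff]
      exact fun n => hmono _ _ (hE _) (hE _) (hanti n.le_succ)
    filter_upwards [this] with z hz
    exact antitone_nat_of_succ_le hz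
  have huniv : ∀ A, MeasurableSet A →
      ∫⁻ z, (β A).rnDeriv (β Set.univ) z ∂(β Set.univ) = hβ.section₁ MeasurableSet.univ A := by
    intro A hA
    rw [← setLIntegral_univ, hle A hA _ MeasurableSet.univ, hβ.section₁_apply _ hA]
  have hfin : IsFiniteMeasure (hβ.section₁ MeasurableSet.univ) :=
    ⟨by rw [hβ.section₁_apply _ MeasurableSet.univ]; exact measure_lt_top _ _⟩
  have h3 : (β E').rnDeriv (β Set.univ) =ᵐ[β Set.univ]
      fun z => ⨅ n, (β (E n)).rnDeriv (β Set.univ) z := by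
    refine ae_eq_of_ae_le_of_lintegral_le ?_ ?_ ?_ ?_
    · filter_upwards [h1] with z hz
      exact le_iInf hz
    · rw [huniv _ hEm]; exact measure_ne_top _ _
    · exact (Measurable.iInf fun n => Measure.measurable_rnDeriv _ _).aemeasurable
    · have : ∀ n, ∫⁻ z, ⨅ n, (β (E n)).rnDeriv (β Set.univ) z ∂(β Set.univ) ≤
          hβ.section₁ MeasurableSet.univ (E n) := fun n => by
        rw [← huniv _ (hE n)]
        exact lintegral_mono fun z => iInf_le _ n
      rw [huniv _ hEm, ← hE']
      exact ge_of_tendsto' (tendsto_measure_iInter_atTop (fun n => (hE n).nullMeasurableSet) hanti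
        ⟨0, measure_ne_top _ _⟩) this
  filter_upwards [h2, h3] with z hz hz'
  rw [hz']
  exact tendsto_atTop_iInf hz

/-- Disintegration over the real line: the kernel is built from its distribution functions. -/
theorem exists_kernel_real {β : Set ℝ → Measure Z} (hβ : IsBimeasure β)
    [IsFiniteMeasure (β Set.univ)] : ∃ κ : Kernel Z ℝ, IsMarkovKernel κ ∧
      ∀ A, MeasurableSet A → ∀ B, MeasurableSet B → β A B = ∫⁻ z in B, κ z A ∂(β Set.univ) := by
  -- the densities of `A ↦ β A` with respect to the total mass, as functions of `A`
  set m := β Set.univ with hm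
  have hAm : ∀ A, MeasurableSet A → β A ≤ m := fun A hA =>
    hβ.mono hA MeasurableSet.univ (Set.subset_univ A)
  have hint : ∀ A, MeasurableSet A → ∀ B, MeasurableSet B →
      ∫⁻ z in B, (β A).rnDeriv m z ∂m = β A B := by
    intro A hA B hB
    have : IsFiniteMeasure (β A) := isFiniteMeasure_of_le m (hAm A hA)
    rw [← withDensity_apply _ hB, Measure.absolutelyContinuous_iff_withDensity_rnDeriv_eq.mp
      (Measure.absolutelyContinuous_of_le (hAm A hA))]
  have hmono : ∀ A A', MeasurableSet A → MeasurableSet A' → A ⊆ A' →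
      ∀ᵐ z ∂m, (β A).rnDeriv m z ≤ (β A').rnDeriv m z := by
    intro A A' hA hA' h
    refine ae_le_of_forall_setLIntegral_le_of_sigmaFinite (Measure.measurable_rnDeriv _ _)
      fun s hs _ => ?_
    rw [hint A hA s hs, hint A' hA' s hs]
    exact hβ.mono hA hA' h s
  have hone : ∀ᵐ z ∂m, (β Set.univ).rnDeriv m z = 1 := Measure.rnDeriv_self m
  have hle1 : ∀ A, MeasurableSet A → ∀ᵐ z ∂m, (β A).rnDeriv m z ≤ 1 := by
    intro A hA
    filter_upwards [hmono A Set.univ hA MeasurableSet.univ (Set.subset_univ A), hone] with z h1 h2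
    exact h1.trans h2.le
  have hlim := fun (E : ℕ → Set ℝ) (E' : Set ℝ) (hE : ∀ n, MeasurableSet (E n)) (ha : Antitone E)
    (hE' : ⋂ n, E n = E') => hβ.tendsto_rnDeriv_of_antitone hE ha hE' hint hmono
  set f : Z → ℚ → ℝ := fun z q => ((β (Set.Iic (q : ℝ))).rnDeriv m z).toReal with hf
  have hfm : Measurable f := by
    rw [measurable_pi_iff]
    exact fun q => (Measure.measurable_rnDeriv _ _).ennreal_toReal
  have hle1' : ∀ᵐ z ∂m, ∀ q : ℚ, (β (Set.Iic (q : ℝ))).rnDeriv m z ≤ 1 :=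
    ae_all_iff.2 fun q => hle1 _ measurableSet_Iic
  -- almost every point is a Stieltjes point
  have hst : ∀ᵐ z ∂m, IsRatStieltjesPoint f z := by
    have a1 : ∀ᵐ z ∂m, ∀ q r : ℚ, q ≤ r →
        (β (Set.Iic (q : ℝ))).rnDeriv m z ≤ (β (Set.Iic (r : ℝ))).rnDeriv m z := by
      simp_rw [ae_all_iff]
      exact fun q r h => hmono _ _ measurableSet_Iic measurableSet_Iic
        (Set.Iic_subset_Iic.2 (by exact_mod_cast h))
    have a2 := hlim (fun n => Set.Iic (((-(n : ℚ) : ℚ)) : ℝ)) ∅ (fun _ => measurableSet_Iic)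
      (fun n n' h => Set.Iic_subset_Iic.2 (by push_cast; simpa using h)) (by
        refine Set.eq_empty_of_forall_notMem fun x hx => ?_
        obtain ⟨n, hn⟩ := exists_nat_gt (-x)
        have := Set.mem_iInter.1 hx n
        simp only [Set.mem_Iic] at this
        push_cast at this
        linarith)
    have a3 := hlim (fun n => (Set.Iic (((n : ℚ)) : ℝ))ᶜ) ∅ (fun _ => measurableSet_Iic.compl)
      (fun n n' h => Set.compl_subset_compl.2 (Set.Iic_subset_Iic.2 (by push_cast; simpa using h)))
      (by
        refine Set.eq_empty_of_forall_notMem fun x hx => ?_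
        obtain ⟨n, hn⟩ := exists_nat_gt x
        have := Set.mem_iInter.1 hx n
        simp only [Set.mem_compl_iff, Set.mem_Iic] at this
        push_cast at this
        linarith)
    have a3' : ∀ᵐ z ∂m, ∀ n : ℕ, (β (Set.Iic (((n : ℚ)) : ℝ))).rnDeriv m z +
        (β (Set.Iic (((n : ℚ)) : ℝ))ᶜ).rnDeriv m z = 1 := by
      rw [ae_all_iff]
      intro n
      have : (fun z => (β (Set.Iic (((n : ℚ)) : ℝ))).rnDeriv m z +
          (β (Set.Iic (((n : ℚ)) : ℝ))ᶜ).rnDeriv m z) =ᵐ[m] fun _ => 1 := by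
        refine ae_eq_of_forall_setLIntegral_eq_of_sigmaFinite (by fun_prop) measurable_const
          fun s hs _ => ?_
        rw [lintegral_add_left (Measure.measurable_rnDeriv _ _), hint _ measurableSet_Iic s hs,
          hint _ measurableSet_Iic.compl s hs, ← hβ.section₁_apply hs measurableSet_Iic,
          ← hβ.section₁_apply hs measurableSet_Iic.compl, measure_add_measure_compl measurableSet_Iic,
          hβ.section₁_apply hs MeasurableSet.univ]
        simp [hm]
      exact this
    have a4 : ∀ᵐ z ∂m, ∀ t : ℚ, Tendsto
        (fun n : ℕ => (β (Set.Iic (((t + 1 / ((n : ℚ) + 1) : ℚ)) : ℝ))).rnDeriv m z) atTop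
        (𝓝 ((β (Set.Iic (t : ℝ))).rnDeriv m z)) := by
      rw [ae_all_iff]
      intro t
      refine hlim _ _ (fun _ => measurableSet_Iic) (fun n n' h => Set.Iic_subset_Iic.2 ?_) ?_
      · push_cast
        have := Nat.one_div_le_one_div (α := ℝ) h
        linarith
      · ext x
        simp only [Set.mem_iInter, Set.mem_Iic]
        constructor
        · intro h
          have hl : Tendsto (fun n : ℕ => (t : ℝ) + 1 / ((n : ℝ) + 1)) atTop (𝓝 (t + 0)) :=
            tendsto_const_nhds.add tendsto_one_div_add_atTop_nhds_zero_nat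
          rw [add_zero] at hl
          exact ge_of_tendsto' hl fun n => by simpa using h n
        · intro h n
          push_cast
          have : (0 : ℝ) < 1 / ((n : ℝ) + 1) := by positivity
          linarith
    have a5 : ∀ᵐ z ∂m, (β ∅).rnDeriv m z = 0 := by
      rw [hβ.empty]
      exact Measure.rnDeriv_zero m
    filter_upwards [a1, a2, a3, a3', a4, a5, hle1'] with z b1 b2 b3 b3' b4 b5 hle
    have hne : ∀ q : ℚ, (β (Set.Iic (q : ℝ))).rnDeriv m z ≠ ⊤ := fun q =>
      ((hle q).trans_lt ENNReal.one_lt_top).ne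
    have hmonof : Monotone (f z) := fun q r h => ENNReal.toReal_mono (hne r) (b1 q r h)
    rw [b5] at b2 b3
    refine ⟨hmonof, ?_, ?_, ?_⟩
    · refine (tendsto_iff_tendsto_subseq_of_monotone hmonof
        (tendsto_natCast_atTop_atTop (R := ℚ))).2 ?_
      have h1 := (ENNReal.tendsto_toReal ENNReal.zero_ne_top).comp b3
      have h2 := h1.const_sub 1
      rw [ENNReal.toReal_zero, sub_zero] at h2
      refine h2.congr fun n => ?_
      have h3 := b3' n
      have h4 : (β (Set.Iic (((n : ℚ)) : ℝ))ᶜ).rnDeriv m z ≠ ⊤ := by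
        intro h; rw [h] at h3; simp at h3
      have h5 := congrArg ENNReal.toReal h3
      rw [ENNReal.toReal_add (hne _) h4, ENNReal.toReal_one] at h5
      simp only [hf, Function.comp_apply]
      linarith
    · have hanti : Antitone fun q : ℚ => f z (-q) := fun q r h => hmonof (neg_le_neg h)
      have h1 : Tendsto (fun q : ℚ => f z (-q)) atTop (𝓝 0) := by
        refine (tendsto_iff_tendsto_subseq_of_antitone hanti
          (tendsto_natCast_atTop_atTop (R := ℚ))).2 ?_
        have h1 := (ENNReal.tendsto_toReal ENNReal.zero_ne_top).comp b2
        rwa [ENNReal.toReal_zero] at h1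
      have h2 := h1.comp (tendsto_neg_atBot_atTop (G := ℚ))
      simpa [Function.comp_def] using h2
    · intro t
      refine le_antisymm ?_ (le_ciInf fun r => hmonof r.2.le)
      have h1 := (ENNReal.tendsto_toReal (hne t)).comp (b4 t)
      have hbdd : BddBelow (Set.range fun r : Set.Ioi t => f z r) :=
        ⟨0, by rintro _ ⟨r, rfl⟩; exact ENNReal.toReal_nonneg⟩
      refine ge_of_tendsto' h1 fun n => ?_
      have hpos : (0 : ℚ) < 1 / ((n : ℚ) + 1) := by positivity
      exact ciInf_le hbdd ⟨t + 1 / ((n : ℚ) + 1), by simpa using hpos⟩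
  let κ : Kernel Z ℝ := ⟨fun z => (stieltjesOfMeasurableRat f hfm z).measure,
    measurable_measure_stieltjesOfMeasurableRat hfm⟩
  have hκ : IsMarkovKernel κ := ⟨fun z =>
    instIsProbabilityMeasure_stieltjesOfMeasurableRat hfm z⟩
  refine ⟨κ, hκ, fun A hA B hB => ?_⟩
  have hκq : ∀ q : ℚ, ∀ᵐ z ∂m, κ z (Set.Iic (q : ℝ)) = (β (Set.Iic (q : ℝ))).rnDeriv m z := by
    intro q
    filter_upwards [hst, hle1'] with z hz hle
    have h1 : κ z (Set.Iic (q : ℝ)) = ENNReal.ofReal (stieltjesOfMeasurableRat f hfm z q) :=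
      measure_stieltjesOfMeasurableRat_Iic hfm z q
    rw [h1, stieltjesOfMeasurableRat_eq, toRatCDF_of_isRatStieltjesPoint hz]
    exact ENNReal.ofReal_toReal ((hle q).trans_lt ENNReal.one_lt_top).ne
  have hfinB : IsFiniteMeasure (hβ.section₁ hB) :=
    ⟨by rw [hβ.section₁_apply _ MeasurableSet.univ]; exact measure_lt_top m _⟩
  -- for fixed `B` both sides are measures in `A`, which agree on the generating half-lines
  have key : hβ.section₁ hB = (m.restrict B).bind κ := by
    refine ext_of_generate_finite _ (Real.borel_eq_generateFrom_Iic_rat ▸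
      (BorelSpace.measurable_eq (α := ℝ))) Real.isPiSystem_Iic_rat ?_ ?_
    · rintro _ hs
      simp only [Set.mem_iUnion, Set.mem_singleton_iff] at hs
      obtain ⟨q, rfl⟩ := hs
      rw [hβ.section₁_apply hB measurableSet_Iic,
        Measure.bind_apply measurableSet_Iic κ.measurable.aemeasurable,
        ← hint _ measurableSet_Iic B hB]
      refine setLIntegral_congr_fun_ae hB ?_
      filter_upwards [hκq q] with z hz _ using hz.symm
    · rw [hβ.section₁_apply hB MeasurableSet.univ,
        Measure.bind_apply MeasurableSet.univ κ.measurable.aemeasurable]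
      simp [hm]
  rw [← hβ.section₁_apply hB hA, key, Measure.bind_apply hA κ.measurable.aemeasurable]

/-- A bimeasure on `Y × Z` dominated by a finite measure `ν` on `Z` disintegrates into a bounded
kernel. -/
theorem exists_kernel [StandardBorelSpace Y] (ν : Measure Z) [IsFiniteMeasure ν]
    {C : NNReal} (hle : β Set.univ ≤ C • ν) (hβ : IsBimeasure β) : ∃ κ : Kernel Z Y,
      (∀ z, κ z Set.univ ≤ C) ∧
      ∀ A, MeasurableSet A → ∀ B, MeasurableSet B → β A B = ∫⁻ z in B, κ z A ∂ν := by
  have hemb := measurableEmbedding_embeddingReal Y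
  have hfin : IsFiniteMeasure (β Set.univ) := isFiniteMeasure_of_le _ hle
  have hβ' := hβ.comp_preimage hemb.measurable
  have hfin' : IsFiniteMeasure (β (embeddingReal Y ⁻¹' Set.univ)) := by
    rwa [Set.preimage_univ]
  obtain ⟨κ₀, hκ₀, h₀⟩ := exists_kernel_real hβ'
  rw [Set.preimage_univ] at h₀
  have hac : β Set.univ ≪ ν :=
    (Measure.absolutelyContinuous_of_le hle).trans (Measure.smul_absolutelyContinuous)
  -- the density of the total mass, cut off at `C` so as to be bounded everywhere
  set h : Z → ENNReal := fun z => min ((β Set.univ).rnDeriv ν z) C with hh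
  have hhm : Measurable h := (Measure.measurable_rnDeriv _ _).min measurable_const
  have hdens : ν.withDensity h = β Set.univ := by
    have h1 : ν.withDensity ((β Set.univ).rnDeriv ν) = β Set.univ :=
      Measure.absolutelyContinuous_iff_withDensity_rnDeriv_eq.mp hac
    conv_rhs => rw [← h1]
    refine withDensity_congr_ae ?_
    have h2 : ∀ᵐ z ∂ν, (β Set.univ).rnDeriv ν z ≤ C := by
      refine ae_le_of_forall_setLIntegral_le_of_sigmaFinite (Measure.measurable_rnDeriv _ _)
        fun s hs _ => ?_
      rw [← withDensity_apply _ hs, h1, setLIntegral_const]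
      exact hle s
    filter_upwards [h2] with z hz
    exact min_eq_left hz
  set κ₁ := Kernel.comapRight κ₀ hemb with hκ₁
  have hκ₁le : ∀ z A, MeasurableSet A → κ₁ z A ≤ 1 := fun z A hA => by
    rw [hκ₁, Kernel.comapRight_apply' _ _ _ hA]
    exact prob_le_one
  have hκ₁fin : IsFiniteKernel κ₁ := ⟨1, ENNReal.one_lt_top, fun z => hκ₁le z _ MeasurableSet.univ⟩
  have hunc : Measurable (Function.uncurry fun (z : Z) (_ : Y) => h z) := hhm.comp measurable_fst
  have happ : ∀ z A, Kernel.withDensity κ₁ (fun z _ => h z) z A = h z * κ₁ z A := by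
    intro z A
    rw [Kernel.withDensity_apply' _ hunc, setLIntegral_const]
  refine ⟨Kernel.withDensity κ₁ fun z _ => h z, fun z => ?_, fun A hA B hB => ?_⟩
  · rw [happ]
    calc h z * κ₁ z Set.univ ≤ C * 1 :=
          mul_le_mul' (min_le_right _ _) (hκ₁le z _ MeasurableSet.univ)
      _ = C := mul_one _
  · simp only [happ]
    have h2 := setLIntegral_withDensity_eq_setLIntegral_mul ν hhm (κ₁.measurable_coe hA) hB
    rw [hdens] at h2
    refine Eq.trans ?_ h2
    have h1 := h₀ (embeddingReal Y '' A) (hemb.measurableSet_image.2 hA) B hB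
    simp only [hemb.injective.preimage_image] at h1
    rw [h1]
    refine lintegral_congr fun z => ?_
    rw [hκ₁, Kernel.comapRight_apply' _ _ _ hA]

end IsBimeasure

end Bimeasure

/-! ### Blocks of an operator on the hybrid space -/

section Blocks

open TraceClass

variable {Z H : Type*} [MeasurableSpace Z] [NormedAddCommGroup H] [InnerProductSpace ℂ H]
  {μ : Measure Z}

/-- A strictly positive integrable function, which turns the σ-finite measure `μ` into a finite one
with the same null sets. -/
structure Weight (μ : Measure Z) where
  /-- the function -/
  w : Z → NNReal
  measurable : Measurable w
  pos : ∀ z, 0 < w z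
  lintegral_lt_top : ∫⁻ z, w z ∂μ < ⊤

theorem Weight.nonempty (μ : Measure Z) [SigmaFinite μ] : Nonempty (Weight μ) := by
  obtain ⟨w, h1, h2, h3⟩ := exists_pos_lintegral_lt_of_sigmaFinite μ one_ne_zero
  exact ⟨⟨w, h2, h1, h3.trans ENNReal.one_lt_top⟩⟩

namespace Weight

/-- The finite measure `w μ`. -/
noncomputable def measure (ω : Weight μ) : Measure Z := μ.withDensity fun z => ω.w z

instance (ω : Weight μ) : IsFiniteMeasure ω.measure :=
  isFiniteMeasure_withDensity ω.lintegral_lt_top.ne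

theorem ae_measure_iff (ω : Weight μ) {p : Z → Prop} : (∀ᵐ z ∂ω.measure, p z) ↔ ∀ᵐ z ∂μ, p z := by
  rw [measure, ae_withDensity_iff ω.measurable.coe_nnreal_ennreal]
  refine eventually_congr (Eventually.of_forall fun z => ?_)
  have := (ω.pos z).ne'
  simp [this]

theorem integrable_iff (ω : Weight μ) {E : Type*} [NormedAddCommGroup E] [NormedSpace ℝ E]
    {f : Z → E} : Integrable f ω.measure ↔ Integrable (fun z => ω.w z • f z) μ :=
  integrable_withDensity_iff_integrable_smul ω.measurable

theorem setIntegral_eq (ω : Weight μ) {E : Type*} [NormedAddCommGroup E] [NormedSpace ℝ E]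
    (f : Z → E) {A : Set Z} (hA : MeasurableSet A) :
    ∫ z in A, f z ∂ω.measure = ∫ z in A, ω.w z • f z ∂μ :=
  setIntegral_withDensity_eq_setIntegral_smul ω.measurable f hA

theorem integrable_indicator (ω : Weight μ) (B : Set Z) (hB : MeasurableSet B)
    (σ : TraceClass H) : Integrable (B.indicator fun z => ω.w z • σ) μ := by
  refine Integrable.indicator ?_ hB
  exact ω.integrable_iff.1 (integrable_const σ)

theorem integral_norm_indicator (ω : Weight μ) (B : Set Z) (hB : MeasurableSet B)
    (σ : TraceClass H) : ∫ z, ‖B.indicator (fun z => ω.w z • σ) z‖ ∂μ = ω.measure.real B * ‖σ‖ := by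
  have h1 : (fun z => ‖B.indicator (fun z => ω.w z • σ) z‖) = B.indicator fun z => ω.w z • ‖σ‖ := by
    ext z
    by_cases hz : z ∈ B <;> simp [hz, NNReal.smul_def, norm_smul]
  rw [h1, integral_indicator hB, ← ω.setIntegral_eq _ hB, setIntegral_const, smul_eq_mul]

open Classical in
variable (H) in
/-- The embedding `σ ↦ w 1_B ⊗ σ` of the trace class into the hybrid space; it is zero unless `B`
is measurable. -/
noncomputable def tensL (ω : Weight μ) (B : Set Z) : TraceClass H →L[ℂ] HybridSpace H μ :=
  if hB : MeasurableSet B then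
    LinearMap.mkContinuous
      { toFun := fun σ => (ω.integrable_indicator B hB σ).toL1 _
        map_add' := fun σ τ => by
          rw [← Integrable.toL1_add]
          congr 1
          ext1 z
          by_cases hz : z ∈ B <;> simp [hz, NNReal.smul_def]
        map_smul' := fun c σ => by
          rw [RingHom.id_apply, ← Integrable.toL1_smul]
          congr 1
          ext1 z
          by_cases hz : z ∈ B <;> simp [hz, NNReal.smul_def, smul_comm c] } (ω.measure.real B)
      fun σ => by
        rw [← ω.integral_norm_indicator B hB]
        exact (L1.norm_of_fun_eq_integral_norm (ω.integrable_indicator B hB σ)).le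
  else 0

theorem coe_tensL (ω : Weight μ) {B : Set Z} (hB : MeasurableSet B) (σ : TraceClass H) :
    ω.tensL H B σ =ᵐ[μ] B.indicator fun z => ω.w z • σ := by
  rw [tensL, dif_pos hB]
  exact Integrable.coeFn_toL1 (ω.integrable_indicator B hB σ)

theorem norm_tensL_le (ω : Weight μ) (B : Set Z) : ‖ω.tensL H B‖ ≤ ω.measure.real B := by
  rw [tensL]
  split_ifs with hB
  · exact LinearMap.mkContinuous_norm_le _ measureReal_nonneg _
  · simp

theorem tensL_empty (ω : Weight μ) : ω.tensL H ∅ = 0 := by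
  have := ω.norm_tensL_le (H := H) ∅
  simpa using this

theorem tensL_union (ω : Weight μ) {A B : Set Z} (hA : MeasurableSet A) (hB : MeasurableSet B)
    (h : Disjoint A B) : ω.tensL H (A ∪ B) = ω.tensL H A + ω.tensL H B := by
  ext1 σ
  refine Lp.ext ?_
  rw [add_apply]
  filter_upwards [ω.coe_tensL (hA.union hB) σ, ω.coe_tensL hA σ, ω.coe_tensL hB σ,
    Lp.coeFn_add (ω.tensL H A σ) (ω.tensL H B σ)] with z h1 h2 h3 h4
  rw [h1, h4, Pi.add_apply, h2, h3, Set.indicator_union_of_disjoint h]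

end Weight

variable (H μ) in
/-- The integral over a set as a bounded operator on the hybrid space. -/
noncomputable def setIntegralL (A : Set Z) : HybridSpace H μ →L[ℂ] TraceClass H :=
  LinearMap.mkContinuous
    { toFun := fun ψ => ∫ z in A, ψ z ∂μ
      map_add' := fun ψ φ => by
        rw [← integral_add (L1.integrable_coeFn ψ).integrableOn (L1.integrable_coeFn φ).integrableOn]
        exact integral_congr_ae (ae_restrict_of_ae (Lp.coeFn_add ψ φ))
      map_smul' := fun c ψ => by
        rw [RingHom.id_apply, ← integral_smul]
        exact integral_congr_ae (ae_restrict_of_ae (Lp.coeFn_smul c ψ)) } 1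
    fun ψ => by
      rw [one_mul, L1.norm_eq_integral_norm]
      refine (norm_integral_le_integral_norm _).trans ?_
      exact setIntegral_le_integral (L1.integrable_coeFn ψ).norm
        (Eventually.of_forall fun z => norm_nonneg _)

theorem setIntegralL_apply (A : Set Z) (ψ : HybridSpace H μ) :
    setIntegralL H μ A ψ = ∫ z in A, ψ z ∂μ := rfl

theorem norm_setIntegralL_le (A : Set Z) : ‖setIntegralL H μ A‖ ≤ 1 :=
  LinearMap.mkContinuous_norm_le _ zero_le_one _

theorem setIntegralL_empty : setIntegralL H μ ∅ = 0 := by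
  ext1 ψ; simp [setIntegralL_apply]

theorem setIntegralL_union {A B : Set Z} (hB : MeasurableSet B)
    (h : Disjoint A B) : setIntegralL H μ (A ∪ B) = setIntegralL H μ A + setIntegralL H μ B := by
  ext1 ψ
  exact setIntegral_union h hB (L1.integrable_coeFn ψ).integrableOn
    (L1.integrable_coeFn ψ).integrableOn

/-- The block `σ ↦ ∫_A S(w 1_B ⊗ σ) dμ` of an operator `S` on the hybrid space, from the classical
configurations in `B` to those in `A`. -/
noncomputable def block (ω : Weight μ) (S : HybridSpace H μ →L[ℂ] HybridSpace H μ) (A B : Set Z) :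
    TraceClass H →L[ℂ] TraceClass H := setIntegralL H μ A ∘L S ∘L ω.tensL H B

section

variable (ω : Weight μ) (S : HybridSpace H μ →L[ℂ] HybridSpace H μ)

theorem block_apply (A B : Set Z) (σ : TraceClass H) :
    block ω S A B σ = ∫ z in A, S (ω.tensL H B σ) z ∂μ := rfl

theorem norm_block_le (A B : Set Z) : ‖block ω S A B‖ ≤ ‖S‖ * ω.measure.real B := by
  refine (ContinuousLinearMap.opNorm_comp_le _ _).trans ?_
  refine (mul_le_mul (norm_setIntegralL_le A) (ContinuousLinearMap.opNorm_comp_le _ _)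
    (norm_nonneg _) zero_le_one).trans ?_
  rw [one_mul]
  exact mul_le_mul_of_nonneg_left (ω.norm_tensL_le B) (norm_nonneg _)

theorem block_empty_left (B : Set Z) : block ω S ∅ B = 0 := by
  rw [block, setIntegralL_empty, ContinuousLinearMap.zero_comp]

theorem block_empty_right (A : Set Z) : block ω S A ∅ = 0 := by
  rw [block, ω.tensL_empty, ContinuousLinearMap.comp_zero, ContinuousLinearMap.comp_zero]

theorem block_union_left {A A' : Set Z} (hA' : MeasurableSet A') (h : Disjoint A A') (B : Set Z) :
    block ω S (A ∪ A') B = block ω S A B + block ω S A' B := by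
  rw [block, setIntegralL_union hA' h, ContinuousLinearMap.add_comp]; rfl

theorem block_union_right (A : Set Z) {B B' : Set Z} (hB : MeasurableSet B) (hB' : MeasurableSet B')
    (h : Disjoint B B') : block ω S A (B ∪ B') = block ω S A B + block ω S A B' := by
  rw [block, ω.tensL_union hB hB' h, ContinuousLinearMap.comp_add, ContinuousLinearMap.comp_add]; rfl

theorem block_one [CompleteSpace H] {A B : Set Z} (hA : MeasurableSet A) (hB : MeasurableSet B) (σ : TraceClass H) :
    block ω 1 A B σ = (ω.measure.real (A ∩ B) : ℂ) • σ := by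
  rw [block_apply, one_apply_eq_self,
    integral_congr_ae (ae_restrict_of_ae (ω.coe_tensL hB σ)), setIntegral_indicator hB,
    ← ω.setIntegral_eq _ (hA.inter hB), setIntegral_const, Complex.coe_smul]

theorem block_sub (S' : HybridSpace H μ →L[ℂ] HybridSpace H μ) (A B : Set Z) :
    block ω (S - S') A B = block ω S A B - block ω S' A B := by
  ext1 σ
  simp [block]

/-- Continuity of the blocks in the operator. -/
theorem tendsto_block {ι : Type*} {l : Filter ι} {S' : ι → HybridSpace H μ →L[ℂ] HybridSpace H μ}
    (h : Tendsto S' l (𝓝 S)) (A B : Set Z) :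
    Tendsto (fun i => block ω (S' i) A B) l (𝓝 (block ω S A B)) := by
  have h1 : Continuous fun S' : HybridSpace H μ →L[ℂ] HybridSpace H μ =>
      setIntegralL H μ A ∘L S' ∘L ω.tensL H B := by fun_prop
  exact (h1.tendsto S).comp h

end

end Blocks

/-- Finite additivity over finite families. -/
theorem map_biUnion_of_additive {Z E ι : Type*} [MeasurableSpace Z] [AddCommMonoid E]
    {m : Set Z → E} (h0 : m ∅ = 0)
    (hadd : ∀ A B, MeasurableSet A → MeasurableSet B → Disjoint A B → m (A ∪ B) = m A + m B)
    (s : Finset ι) (S : ι → Set Z) (hS : ∀ i, MeasurableSet (S i))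
    (hd : (s : Set ι).PairwiseDisjoint S) : m (⋃ i ∈ s, S i) = ∑ i ∈ s, m (S i) := by
  classical
  induction s using Finset.induction_on with
  | empty => simpa using h0
  | insert a s ha ih =>
    rw [Finset.set_biUnion_insert, Finset.sum_insert ha, hadd _ _ (hS a)
      (Finset.measurableSet_biUnion _ fun i _ => hS i), ih]
    · exact hd.subset (by simp)
    · rw [Set.disjoint_iUnion₂_right]
      intro i hi
      exact hd (by simp) (by simp [hi]) fun h => ha (h ▸ hi)

/-! ### Completely positive and conditionally completely positive maps of the trace class -/

section CompletelyPositive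

open TraceClass

variable {H : Type*} [NormedAddCommGroup H] [InnerProductSpace ℂ H]

/-- The kernel `((x, f), (y, g)) ↦ ⟨x, R(|f⟩⟨g|) y⟩` of a map `R` of the trace class. -/
noncomputable def kernelForm (R : TraceClass H →L[ℂ] TraceClass H) (p q : H × H) : ℂ :=
  elemL p.1 q.1 (R (ketbra p.2 q.2))

/-- Complete positivity of a map of the trace class, as positivity of `kernelForm`. -/
def IsCP (R : TraceClass H →L[ℂ] TraceClass H) : Prop :=
  ∀ (n : ℕ) (p : Fin n → H × H), 0 ≤ ∑ i, ∑ j, kernelForm R (p i) (p j)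

/-- Conditional complete positivity: positivity of `kernelForm` on the families with
`∑ ⟨xᵢ, fᵢ⟩ = 0`. -/
def IsCCP (R : TraceClass H →L[ℂ] TraceClass H) : Prop :=
  ∀ (n : ℕ) (p : Fin n → H × H), ∑ i, inner ℂ (p i).1 (p i).2 = 0 →
    0 ≤ ∑ i, ∑ j, kernelForm R (p i) (p j)

/-- Hermiticity preservation. -/
def IsHermitianMap (R : TraceClass H →L[ℂ] TraceClass H) : Prop :=
  ∀ p q, kernelForm R p q = starRingEnd ℂ (kernelForm R q p)

theorem kernelForm_add (R R' : TraceClass H →L[ℂ] TraceClass H) (p q : H × H) :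
    kernelForm (R + R') p q = kernelForm R p q + kernelForm R' p q := by
  simp [kernelForm]

theorem kernelForm_sub (R R' : TraceClass H →L[ℂ] TraceClass H) (p q : H × H) :
    kernelForm (R - R') p q = kernelForm R p q - kernelForm R' p q := by
  simp [kernelForm]

theorem kernelForm_zero (p q : H × H) :
    kernelForm (0 : TraceClass H →L[ℂ] TraceClass H) p q = 0 := by
  simp [kernelForm]

theorem kernelForm_smul (c : ℂ) (R : TraceClass H →L[ℂ] TraceClass H) (p q : H × H) :
    kernelForm (c • R) p q = c * kernelForm R p q := by
  simp [kernelForm]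

theorem continuous_kernelForm (p q : H × H) :
    Continuous fun R : TraceClass H →L[ℂ] TraceClass H => kernelForm R p q :=
  (elemL p.1 q.1).continuous.comp
    (ContinuousLinearMap.apply ℂ (TraceClass H) (ketbra p.2 q.2)).continuous

theorem IsCP.zero : IsCP (0 : TraceClass H →L[ℂ] TraceClass H) := fun n p => by
  simp [kernelForm_zero]

theorem IsCP.add {R R' : TraceClass H →L[ℂ] TraceClass H} (h : IsCP R) (h' : IsCP R') :
    IsCP (R + R') := fun n p => by
  simp only [kernelForm_add, Finset.sum_add_distrib]
  exact add_nonneg (h n p) (h' n p)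

theorem IsCP.sum {ι : Type*} (s : Finset ι) {R : ι → TraceClass H →L[ℂ] TraceClass H}
    (h : ∀ i ∈ s, IsCP (R i)) : IsCP (∑ i ∈ s, R i) :=
  Finset.sum_induction _ IsCP (fun _ _ => IsCP.add) IsCP.zero h

theorem IsCCP.zero : IsCCP (0 : TraceClass H →L[ℂ] TraceClass H) := fun n p _ => by
  simp [kernelForm_zero]

theorem IsCCP.add {R R' : TraceClass H →L[ℂ] TraceClass H} (h : IsCCP R) (h' : IsCCP R') :
    IsCCP (R + R') := fun n p hp => by
  simp only [kernelForm_add, Finset.sum_add_distrib]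
  exact add_nonneg (h n p hp) (h' n p hp)

theorem IsHermitianMap.zero : IsHermitianMap (0 : TraceClass H →L[ℂ] TraceClass H) := fun p q => by
  simp [kernelForm_zero]

theorem IsHermitianMap.add {R R' : TraceClass H →L[ℂ] TraceClass H} (h : IsHermitianMap R)
    (h' : IsHermitianMap R') : IsHermitianMap (R + R') := fun p q => by
  rw [kernelForm_add, kernelForm_add, map_add, h p q, h' p q]

theorem kernelForm_smul_fst_left (R : TraceClass H →L[ℂ] TraceClass H) (c : ℂ) (x f : H)
    (q : H × H) : kernelForm R (c • x, f) q = starRingEnd ℂ c * kernelForm R (x, f) q :=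
  inner_smul_left _ _ _

theorem kernelForm_smul_fst_right (R : TraceClass H →L[ℂ] TraceClass H) (c : ℂ) (p : H × H)
    (y g : H) : kernelForm R p (c • y, g) = c * kernelForm R p (y, g) := by
  simp [kernelForm, elemL_apply]

/-- Positivity on pairs forces hermiticity: `z₁ + z₂` and `i (z₁ - z₂)` are real for the two
off-diagonal elements. -/
theorem IsCP.isHermitianMap {R : TraceClass H →L[ℂ] TraceClass H} (h : IsCP R) :
    IsHermitianMap R := by
  rintro p ⟨y, g⟩
  have h1 := fun q => Complex.nonneg_iff.1 (by simpa using h 1 ![q])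
  have h2 := Complex.nonneg_iff.1 (h 2 ![p, (y, g)])
  have h3 := Complex.nonneg_iff.1 (h 2 ![p, (Complex.I • y, g)])
  have h4 := (h1 p).2
  have h5 := (h1 (y, g)).2
  simp [Fin.sum_univ_two, kernelForm_smul_fst_left, kernelForm_smul_fst_right] at h2 h3
  apply Complex.ext
  · simp; linarith [h2.2, h3.2]
  · simp; linarith [h2.2, h3.2]

theorem norm_kernelForm_le (R : TraceClass H →L[ℂ] TraceClass H) (p q : H × H) :
    ‖kernelForm R p q‖ ≤ ‖R‖ * (‖p.1‖ * ‖p.2‖ * (‖q.1‖ * ‖q.2‖)) := by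
  rw [kernelForm, elemL_apply]
  calc _ ≤ ‖p.1‖ * (‖(R (ketbra p.2 q.2)).op‖ * ‖q.1‖) :=
        (norm_inner_le_norm _ _).trans
          (mul_le_mul_of_nonneg_left (ContinuousLinearMap.le_opNorm _ _) (norm_nonneg _))
    _ ≤ ‖p.1‖ * ((‖R‖ * (‖p.2‖ * ‖q.2‖)) * ‖q.1‖) := by
        gcongr
        refine (norm_op_le _).trans ((ContinuousLinearMap.le_opNorm _ _).trans ?_)
        gcongr
        exact norm_ketbra_le _ _
    _ = _ := by ring

/-- The operator `K f = R(|f⟩⟨h|) h - ½ ⟨h, R(|h⟩⟨h|) h⟩ f` splitting off the drift of a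
conditionally completely positive map. -/
noncomputable def drift (R : TraceClass H →L[ℂ] TraceClass H) (h : H) : H →L[ℂ] H :=
  LinearMap.mkContinuous
    { toFun := fun f => (R (ketbra f h)).op h
      map_add' := fun f g => by rw [ketbra_add_left, map_add, op_add, add_apply]
      map_smul' := fun c f => by rw [ketbra_smul_left, map_smul, op_smul, smul_apply]; rfl }
    (‖R‖ * ‖h‖ ^ 2) (fun f => by
      calc ‖(R (ketbra f h)).op h‖ ≤ ‖(R (ketbra f h)).op‖ * ‖h‖ :=
            ContinuousLinearMap.le_opNorm _ _
        _ ≤ (‖R‖ * (‖f‖ * ‖h‖)) * ‖h‖ := by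
            gcongr
            refine (norm_op_le _).trans ((R.le_opNorm _).trans ?_)
            gcongr
            exact norm_ketbra_le _ _
        _ = _ := by ring)
  - (1 / 2 * kernelForm R (h, h) (h, h)) • 1

theorem inner_drift (R : TraceClass H →L[ℂ] TraceClass H) (h x f : H) :
    inner ℂ x (drift R h f) = kernelForm R (x, f) (h, h)
      - 1 / 2 * kernelForm R (h, h) (h, h) * inner ℂ x f := by
  rw [drift, sub_apply, inner_sub_right, smul_apply, inner_smul_right]
  rfl

theorem norm_drift_le (R : TraceClass H →L[ℂ] TraceClass H) {h : H} (hh : ‖h‖ = 1) :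
    ‖drift R h‖ ≤ 2 * ‖R‖ := by
  refine ContinuousLinearMap.opNorm_le_bound _ (by positivity) fun f => ?_
  have h1 : ‖(R (ketbra f h)).op h‖ ≤ ‖R‖ * ‖f‖ := by
    refine (ContinuousLinearMap.le_opNorm _ _).trans ?_
    rw [hh, mul_one]
    refine (norm_op_le _).trans ((R.le_opNorm _).trans ?_)
    gcongr
    simpa [hh] using norm_ketbra_le f h
  have h2 : ‖(1 / 2 * kernelForm R (h, h) (h, h)) • f‖ ≤ ‖R‖ * ‖f‖ := by
    rw [norm_smul, norm_mul]
    have h3 := norm_kernelForm_le R (h, h) (h, h)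
    have h4 : ‖(1 / 2 : ℂ)‖ ≤ 1 := by norm_num
    simp only [hh, mul_one] at h3
    calc _ ≤ (1 * ‖R‖) * ‖f‖ := by gcongr
      _ = _ := by ring
  refine (norm_sub_le ((R (ketbra f h)).op h) _).trans ?_
  calc _ ≤ ‖R‖ * ‖f‖ + ‖R‖ * ‖f‖ := add_le_add h1 h2
    _ = _ := by ring

variable [CompleteSpace H]

theorem kernelForm_sandwichL (B C : H →L[ℂ] H) (p q : H × H) :
    kernelForm (sandwichL B C) p q =
      inner ℂ p.1 (B p.2) * inner ℂ q.2 (C q.1) := by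
  rw [kernelForm, sandwichL_apply, sandwich_ketbra, elemL_apply, op_ketbra_apply, inner_smul_right,
    ContinuousLinearMap.star_eq_adjoint, ContinuousLinearMap.adjoint_inner_left, mul_comm]

theorem kernelForm_sandwichL_star (K : H →L[ℂ] H) (p q : H × H) :
    kernelForm (sandwichL 1 (star K)) p q =
      inner ℂ p.1 p.2 * starRingEnd ℂ (inner ℂ q.1 (K q.2)) := by
  rw [kernelForm_sandwichL, ContinuousLinearMap.star_eq_adjoint,
    ContinuousLinearMap.adjoint_inner_right, inner_conj_symm]
  rfl

/-- A hermitian conditionally completely positive map becomes completely positive after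
subtraction of `σ ↦ Kσ + σK†` with its drift `K`: complete a family by `(-s̄ h, h)`, where
`s = ∑ ⟨xᵢ, fᵢ⟩`. -/
theorem IsCCP.isCP_sub_drift {R : TraceClass H →L[ℂ] TraceClass H} (hR : IsCCP R)
    (hherm : IsHermitianMap R) {h : H} (hh : ‖h‖ = 1) :
    IsCP (R - sandwichL (drift R h) 1 - sandwichL 1 (star (drift R h))) := by
  intro n p
  set s : ℂ := ∑ i, inner ℂ (p i).1 (p i).2 with hs
  set u : ℂ := ∑ i, kernelForm R (p i) (h, h) with hu
  set a : ℂ := kernelForm R (h, h) (h, h) with ha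
  have hareal : starRingEnd ℂ a = a := (hherm (h, h) (h, h)).symm
  have hhh : (inner ℂ h h : ℂ) = 1 := by
    rw [inner_self_eq_norm_sq_to_K, hh]; simp
  have key := hR (n + 1) (Fin.cons (-starRingEnd ℂ s • h, h) p) (by
    rw [Fin.sum_univ_succ]
    simp only [Fin.cons_zero, Fin.cons_succ, inner_smul_left, hhh, ← hs]
    simp)
  have e1 : ∑ i, ∑ j, kernelForm R ((Fin.cons (-starRingEnd ℂ s • h, h) p : Fin (n + 1) → H × H) i)
      ((Fin.cons (-starRingEnd ℂ s • h, h) p : Fin (n + 1) → H × H) j) =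
      s * starRingEnd ℂ s * a - s * starRingEnd ℂ u - starRingEnd ℂ s * u +
        ∑ i, ∑ j, kernelForm R (p i) (p j) := by
    have h1 : ∀ j, kernelForm R (h, h) (p j) = starRingEnd ℂ (kernelForm R (p j) (h, h)) :=
      fun j => hherm _ _
    simp only [Fin.sum_univ_succ, Fin.cons_zero, Fin.cons_succ, kernelForm_smul_fst_left,
      kernelForm_smul_fst_right, ← ha, Finset.sum_add_distrib, ← Finset.mul_sum, h1, ← map_sum,
      ← hu]
    simp
    ring
  have e2 : ∑ i, ∑ j, kernelForm (R - sandwichL (drift R h) 1 - sandwichL 1 (star (drift R h)))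
      (p i) (p j) = s * starRingEnd ℂ s * a - s * starRingEnd ℂ u - starRingEnd ℂ s * u +
        ∑ i, ∑ j, kernelForm R (p i) (p j) := by
    have h2 : ∑ i, inner ℂ (p i).1 (drift R h (p i).2) = u - 1 / 2 * a * s := by
      simp only [inner_drift, Finset.sum_sub_distrib, ← Finset.mul_sum]
      rfl
    have h3 : ∑ j, (inner ℂ (p j).2 (p j).1 : ℂ) = starRingEnd ℂ s := by
      rw [hs, map_sum]
      exact Finset.sum_congr rfl fun j _ => (inner_conj_symm _ _).symm
    simp only [kernelForm_sub, Finset.sum_sub_distrib, kernelForm_sandwichL_star]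
    simp only [kernelForm_sandwichL, ← Finset.sum_mul, ← Finset.mul_sum, ← map_sum, h2, ← hs,
      ContinuousLinearMap.one_def, ContinuousLinearMap.id_apply, h3]
    simp [hareal, Complex.conj_ofNat]
    ring
  rw [e2, ← e1]
  exact key

/-- Bounded nets of operators converge weakly along ultrafilters. -/
theorem exists_weak_limit {ι : Type*} (U : Ultrafilter ι) {T : ι → H →L[ℂ] H} {C : ℝ}
    (hT : ∀ i, ‖T i‖ ≤ C) : ∃ T' : H →L[ℂ] H,
      ∀ x y, Tendsto (fun i => (inner ℂ x (T i y) : ℂ)) U (𝓝 (inner ℂ x (T' y))) := by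
  have hb : ∀ x y i, ‖(inner ℂ x (T i y) : ℂ)‖ ≤ C * ‖y‖ * ‖x‖ := fun x y i => by
    rw [mul_comm]
    exact (norm_inner_le_norm _ _).trans
      (mul_le_mul_of_nonneg_left ((T i).le_of_opNorm_le (hT i) y) (norm_nonneg _))
  have hlim : ∀ x y, ∃ a ∈ Metric.closedBall (0 : ℂ) (C * ‖y‖ * ‖x‖),
      Tendsto (fun i => (inner ℂ x (T i y) : ℂ)) U (𝓝 a) := fun x y => by
    have h1 := (isCompact_closedBall (0 : ℂ) (C * ‖y‖ * ‖x‖)).ultrafilter_le_nhds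
      (U.map fun i => (inner ℂ x (T i y) : ℂ))
      (le_principal_iff.2 (mem_map.2 (Eventually.of_forall fun i => by simpa using hb x y i)))
    obtain ⟨a, ha, hle⟩ := h1
    exact ⟨a, ha, hle⟩
  choose b hb1 hb2 using hlim
  let Bf : H →L⋆[ℂ] H →L[ℂ] ℂ := LinearMap.mkContinuous₂
    (LinearMap.mk₂'ₛₗ (starRingEnd ℂ) (RingHom.id ℂ) (fun y x => starRingEnd ℂ (b x y))
      (fun y y' x => by
        rw [← map_add]
        congr 1
        refine tendsto_nhds_unique (hb2 _ _) ?_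
        simpa [inner_add_right] using (hb2 x y).add (hb2 x y'))
      (fun c y x => by
        rw [smul_eq_mul, ← map_mul]
        congr 1
        refine tendsto_nhds_unique (hb2 _ _) ?_
        simpa [inner_smul_right] using (hb2 x y).const_mul c)
      (fun y x x' => by
        rw [← map_add]
        congr 1
        refine tendsto_nhds_unique (hb2 _ _) ?_
        simpa [inner_add_left] using (hb2 x y).add (hb2 x' y))
      (fun c y x => by
        have h1 : b (c • x) y = starRingEnd ℂ c * b x y := by
          refine tendsto_nhds_unique (hb2 _ _) ?_
          simpa [inner_smul_left, mul_comm] using (hb2 x y).const_mul (starRingEnd ℂ c)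
        rw [h1]; simp)) C
    (fun y x => by simpa using hb1 x y)
  refine ⟨InnerProductSpace.continuousLinearMapOfBilin Bf, fun x y => ?_⟩
  have h1 : (inner ℂ (InnerProductSpace.continuousLinearMapOfBilin Bf y) x : ℂ)
      = starRingEnd ℂ (b x y) := InnerProductSpace.continuousLinearMapOfBilin_apply Bf y x
  have h2 : (inner ℂ x (InnerProductSpace.continuousLinearMapOfBilin Bf y) : ℂ) = b x y := by
    rw [← inner_conj_symm, h1, Complex.conj_conj]
  rw [h2]
  exact hb2 x y

end CompletelyPositive

/-! ### Splitting off the drift -/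

section Cells

variable {Z : Type*} [MeasurableSpace Z]

/-- The points contained in exactly those sets of the family `F` that belong to `S`. For
`S ⊆ F` these are the cells of the partition generated by `F`. -/
def cell (F : Finset {A : Set Z // MeasurableSet A}) (S : Finset {A : Set Z // MeasurableSet A}) :
    Set Z := {z | ∀ A ∈ F, z ∈ A.1 ↔ A ∈ S}

variable {F S S' : Finset {A : Set Z // MeasurableSet A}}

theorem measurableSet_cell : MeasurableSet (cell F S) := by
  have h : cell F S = ⋂ A ∈ F, {z | z ∈ A.1 ↔ A ∈ S} := by ext z; simp [cell]
  rw [h]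
  refine Finset.measurableSet_biInter _ fun A _ => ?_
  by_cases hA : A ∈ S
  · simp only [hA, iff_true]; exact A.2
  · simp only [hA, iff_false]; exact A.2.compl

theorem disjoint_cell (hS : S ∈ F.powerset) (hS' : S' ∈ F.powerset) (h : S ≠ S') :
    Disjoint (cell F S) (cell F S') := by
  rw [Set.disjoint_left]
  intro z hz hz'
  refine h (Finset.ext fun A => ⟨fun hA => ?_, fun hA => ?_⟩)
  · have hF := Finset.mem_powerset.1 hS hA
    exact (hz' A hF).1 ((hz A hF).2 hA)
  · have hF := Finset.mem_powerset.1 hS' hA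
    exact (hz A hF).1 ((hz' A hF).2 hA)

theorem biUnion_cell : ⋃ S ∈ F.powerset, cell F S = Set.univ := by
  classical
  refine Set.eq_univ_of_forall fun z => ?_
  simp only [Set.mem_iUnion]
  refine ⟨F.filter fun A => z ∈ A.1, Finset.mem_powerset.2 (Finset.filter_subset _ _), fun A hA => ?_⟩
  simp [hA]

theorem inter_cell_of_mem {A : {A : Set Z // MeasurableSet A}} (hA : A ∈ F) (hAS : A ∈ S) :
    A.1 ∩ cell F S = cell F S :=
  Set.inter_eq_right.2 fun _ hz => (hz A hA).2 hAS

theorem inter_cell_of_notMem {A : {A : Set Z // MeasurableSet A}} (hA : A ∈ F) (hAS : A ∉ S) :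
    A.1 ∩ cell F S = ∅ :=
  Set.eq_empty_of_forall_notMem fun _ hz => hAS ((hz.2 A hA).1 hz.1)

theorem sum_inter_cell {E : Type*} [AddCommMonoid E] {m : Set Z → E} (h0 : m ∅ = 0)
    (hadd : ∀ A B, MeasurableSet A → MeasurableSet B → Disjoint A B → m (A ∪ B) = m A + m B)
    {A : Set Z} (hA : MeasurableSet A) (F : Finset {A : Set Z // MeasurableSet A}) :
    m A = ∑ S ∈ F.powerset, m (A ∩ cell F S) := by
  rw [← map_biUnion_of_additive h0 hadd F.powerset (fun S => A ∩ cell F S)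
    (fun S => hA.inter measurableSet_cell)
    (fun S hS S' hS' h => (disjoint_cell hS hS' h).mono Set.inter_subset_right Set.inter_subset_right),
    ← Set.inter_iUnion₂, biUnion_cell, Set.inter_univ]

end Cells

section Drift

open TraceClass

variable {Z H : Type*} [MeasurableSpace Z] [NormedAddCommGroup H] [InnerProductSpace ℂ H]
  {μ : Measure Z}

theorem ContinuousLinearMap.opNorm_le_of_re_inner {T : H →L[ℂ] H} {C : ℝ} (hC : 0 ≤ C)
    (h : ∀ x y, (inner ℂ x (T y) : ℂ).re ≤ C * ‖x‖ * ‖y‖) : ‖T‖ ≤ C := by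
  refine T.opNorm_le_bound hC fun y => ?_
  have h1 := h (T y) y
  have h2 : (inner ℂ (T y) (T y) : ℂ).re = ‖T y‖ ^ 2 := inner_self_eq_norm_sq (𝕜 := ℂ) _
  rw [h2] at h1
  rcases (norm_nonneg (T y)).eq_or_lt with h0 | h0
  · rw [← h0]; positivity
  · refine le_of_mul_le_mul_left ?_ h0
    linarith

theorem drift_add (R R' : TraceClass H →L[ℂ] TraceClass H) (h : H) :
    drift (R + R') h = drift R h + drift R' h := by
  refine ContinuousLinearMap.ext fun f => ext_inner_left ℂ fun x => ?_
  rw [add_apply, inner_add_right, inner_drift, inner_drift, inner_drift, kernelForm_add,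
    kernelForm_add]
  ring

variable (ω : Weight μ) (S : HybridSpace H μ →L[ℂ] HybridSpace H μ)

/-- The sum of the blocks of `S` over the diagonal cells of a partition, restricted to `A`. -/
noncomputable def diagBlock (F : Finset {A : Set Z // MeasurableSet A}) (A : Set Z) :
    TraceClass H →L[ℂ] TraceClass H := ∑ T ∈ F.powerset, block ω S (A ∩ cell F T) (cell F T)

theorem norm_diagBlock_le_univ (F : Finset {A : Set Z // MeasurableSet A}) (A : Set Z) :
    ‖diagBlock ω S F A‖ ≤ ‖S‖ * ω.measure.real Set.univ := by
  have h1 := sum_inter_cell (m := fun A => ω.measure.real A) (by simp)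
    (fun A B _ hB h => measureReal_union h hB) MeasurableSet.univ F
  rw [h1, Finset.mul_sum]
  refine (norm_sum_le _ _).trans (Finset.sum_le_sum fun T _ => ?_)
  rw [Set.univ_inter]
  exact norm_block_le ω S _ _

theorem norm_diagBlock_le {F : Finset {A : Set Z // MeasurableSet A}}
    {A : {A : Set Z // MeasurableSet A}} (hA : A ∈ F) :
    ‖diagBlock ω S F A.1‖ ≤ ‖S‖ * ω.measure.real A.1 := by
  have h1 := sum_inter_cell (m := fun A => ω.measure.real A) (by simp)
    (fun A B _ hB h => measureReal_union h hB) A.2 F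
  rw [h1, Finset.mul_sum]
  refine (norm_sum_le _ _).trans (Finset.sum_le_sum fun T _ => ?_)
  by_cases hAT : A ∈ T
  · rw [inter_cell_of_mem hA hAT]
    exact norm_block_le ω S _ _
  · rw [inter_cell_of_notMem hA hAT, block_empty_left]
    simp

theorem diagBlock_union (F : Finset {A : Set Z // MeasurableSet A}) {A B : Set Z}
    (hB : MeasurableSet B) (h : Disjoint A B) :
    diagBlock ω S F (A ∪ B) = diagBlock ω S F A + diagBlock ω S F B := by
  rw [diagBlock, diagBlock, diagBlock, ← Finset.sum_add_distrib]
  refine Finset.sum_congr rfl fun T _ => ?_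
  rw [Set.union_inter_distrib_right, block_union_left ω S (hB.inter measurableSet_cell)]
  exact h.mono Set.inter_subset_left Set.inter_subset_left

/-- The part of a block off the diagonal cells is completely positive. -/
theorem isCP_block_sub_diagBlock
    (hcp : ∀ A B, MeasurableSet A → MeasurableSet B → Disjoint A B → IsCP (block ω S A B))
    {F : Finset {A : Set Z // MeasurableSet A}} {A B : {A : Set Z // MeasurableSet A}}
    (hB : B ∈ F) : IsCP (block ω S A B - diagBlock ω S F (A ∩ B)) := by
  classical
  have h1 : block ω S A B = ∑ T ∈ F.powerset, ∑ T' ∈ F.powerset,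
      block ω S (A ∩ cell F T) (B ∩ cell F T') := by
    rw [sum_inter_cell (m := fun A' => block ω S A' B) (block_empty_left ω S _)
      (fun A B' _ hB' h => block_union_left ω S hB' h _) A.2 F]
    refine Finset.sum_congr rfl fun T _ => ?_
    exact sum_inter_cell (m := fun B' => block ω S (A ∩ cell F T) B') (block_empty_right ω S _)
      (fun A' B' hA' hB' h => block_union_right ω S _ hA' hB' h) B.2 F
  have h2 : diagBlock ω S F (A ∩ B) = ∑ T ∈ F.powerset, ∑ T' ∈ F.powerset,
      if T = T' then block ω S (A ∩ cell F T) (B ∩ cell F T') else 0 := by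
    rw [diagBlock]
    refine Finset.sum_congr rfl fun T hT => ?_
    rw [Finset.sum_ite_eq F.powerset T, if_pos hT]
    by_cases hBT : B ∈ T
    · rw [inter_cell_of_mem hB hBT, Set.inter_assoc, inter_cell_of_mem hB hBT]
    · rw [inter_cell_of_notMem hB hBT, Set.inter_assoc, inter_cell_of_notMem hB hBT,
        Set.inter_empty, block_empty_left, block_empty_right]
  rw [h1, h2, ← Finset.sum_sub_distrib]
  refine IsCP.sum _ fun T hT => ?_
  rw [← Finset.sum_sub_distrib]
  refine IsCP.sum _ fun T' hT' => ?_
  split_ifs with h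
  · rw [sub_self]; exact IsCP.zero
  · rw [sub_zero]
    exact hcp _ _ (A.2.inter measurableSet_cell) (B.2.inter measurableSet_cell)
      ((disjoint_cell hT hT' h).mono Set.inter_subset_right Set.inter_subset_right)

variable [CompleteSpace H]

theorem IsCP.of_tendsto_weak {ι : Type*} {l : Filter ι} [l.NeBot]
    {R : TraceClass H →L[ℂ] TraceClass H} {K : ι → H →L[ℂ] H} {K' : H →L[ℂ] H}
    (hK : ∀ x y, Tendsto (fun i => (inner ℂ x (K i y) : ℂ)) l (𝓝 (inner ℂ x (K' y))))
    (h : ∀ᶠ i in l, IsCP (R - sandwichL (K i) 1 - sandwichL 1 (star (K i)))) :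
    IsCP (R - sandwichL K' 1 - sandwichL 1 (star K')) := by
  intro n p
  have ht : ∀ i j, Tendsto (fun k => kernelForm
      (R - sandwichL (K k) 1 - sandwichL 1 (star (K k))) (p i) (p j)) l
      (𝓝 (kernelForm (R - sandwichL K' 1 - sandwichL 1 (star K')) (p i) (p j))) := fun i j => by
    simp only [kernelForm_sub, kernelForm_sandwichL_star]
    simp only [kernelForm_sandwichL]
    have hconj := (Complex.continuous_conj.tendsto _).comp (hK (p j).1 (p j).2)
    exact (tendsto_const_nhds.sub ((hK _ _).mul_const _)).sub (hconj.const_mul _)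
  exact ge_of_tendsto (tendsto_finsetSum _ fun i _ => tendsto_finsetSum _ fun j _ => ht i j)
    (h.mono fun i hi => hi n p)

/-- An operator whose blocks are hermitian, conditionally completely positive, and completely
positive off the diagonal becomes completely positive after subtraction of a drift
`ψ ↦ κψ + ψκ†`, where `κ` is a finitely additive operator-valued set function. It is the limit,
along an ultrafilter of finite partitions, of the drifts of the diagonal cells. -/
theorem exists_drift_measure
    (hcp : ∀ A B, MeasurableSet A → MeasurableSet B → Disjoint A B → IsCP (block ω S A B))
    (hccp : ∀ A B, MeasurableSet A → MeasurableSet B → IsCCP (block ω S A B))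
    (hherm : ∀ A B, MeasurableSet A → MeasurableSet B → IsHermitianMap (block ω S A B)) :
    ∃ κ : Set Z → H →L[ℂ] H,
      (∀ A, MeasurableSet A → ‖κ A‖ ≤ 2 * ‖S‖ * ω.measure.real A) ∧
      (∀ A B, MeasurableSet A → MeasurableSet B → Disjoint A B → κ (A ∪ B) = κ A + κ B) ∧
      ∀ A B, MeasurableSet A → MeasurableSet B →
        IsCP (block ω S A B - sandwichL (κ (A ∩ B)) 1 - sandwichL 1 (star (κ (A ∩ B)))) := by
  classical
  -- without a unit vector to define the drifts, `H` is trivial and so are all kernels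
  rcases subsingleton_or_nontrivial H with hH | hH
  · refine ⟨0, fun A _ => ?_, fun A B _ _ _ => by simp, fun A B _ _ n p => ?_⟩
    · rw [Pi.zero_apply, norm_zero]; positivity
    · refine le_of_eq (Eq.symm (Finset.sum_eq_zero fun i _ => Finset.sum_eq_zero fun j _ => ?_))
      rw [kernelForm, elemL_apply, Subsingleton.elim (p i).1 0, inner_zero_left]
  obtain ⟨h, hh⟩ := exists_norm_eq H zero_le_one
  let U : Ultrafilter (Finset {A : Set Z // MeasurableSet A}) := Ultrafilter.of atTop
  -- along `U`, every measurable set is eventually a union of cells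
  have hU : ∀ A : {A : Set Z // MeasurableSet A},
      ∀ᶠ F in (U : Filter (Finset {A : Set Z // MeasurableSet A})), A ∈ F := fun A => by
    have h1 : ∀ᶠ F in (atTop : Filter (Finset {A : Set Z // MeasurableSet A})), A ∈ F := by
      filter_upwards [eventually_ge_atTop {A}] with F hF
      exact hF (Finset.mem_singleton_self A)
    exact Ultrafilter.of_le atTop h1
  have hlim := fun A => exists_weak_limit U (T := fun F => drift (diagBlock ω S F A) h)
    (C := 2 * (‖S‖ * ω.measure.real Set.univ)) (fun F => (norm_drift_le _ hh).trans
      (mul_le_mul_of_nonneg_left (norm_diagBlock_le_univ ω S F A) zero_le_two))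
  choose κ hκ using hlim
  refine ⟨κ, fun A hA => ?_, fun A B hA hB hd => ?_, fun A B hA hB => ?_⟩
  · refine ContinuousLinearMap.opNorm_le_of_re_inner (by positivity) fun x y => ?_
    refine le_of_tendsto ((Complex.continuous_re.tendsto _).comp (hκ A x y)) ?_
    filter_upwards [hU ⟨A, hA⟩] with F hF
    have h1 : ‖diagBlock ω S F A‖ ≤ ‖S‖ * ω.measure.real A :=
      norm_diagBlock_le ω S (A := ⟨A, hA⟩) hF
    have h2 : ‖drift (diagBlock ω S F A) h‖ ≤ 2 * (‖S‖ * ω.measure.real A) :=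
      (norm_drift_le _ hh).trans (mul_le_mul_of_nonneg_left h1 zero_le_two)
    calc _ ≤ ‖x‖ * (2 * (‖S‖ * ω.measure.real A) * ‖y‖) :=
          (Complex.re_le_norm _).trans <| (norm_inner_le_norm _ _).trans (mul_le_mul_of_nonneg_left
            (ContinuousLinearMap.le_of_opNorm_le _ h2 _) (norm_nonneg _))
      _ = _ := by ring
  · refine ContinuousLinearMap.ext fun y => ext_inner_left ℂ fun x => ?_
    refine tendsto_nhds_unique (hκ _ x y) ?_
    rw [add_apply, inner_add_right]
    refine ((hκ A x y).add (hκ B x y)).congr fun F => ?_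
    rw [diagBlock_union ω S F hB hd, drift_add, add_apply, inner_add_right]
  · refine IsCP.of_tendsto_weak (hκ (A ∩ B)) ?_
    filter_upwards [hU ⟨B, hB⟩] with F hFB
    have hccp' : IsCCP (diagBlock ω S F (A ∩ B)) :=
      Finset.sum_induction _ IsCCP (fun _ _ => IsCCP.add) IsCCP.zero fun T _ =>
        hccp _ _ ((hA.inter hB).inter measurableSet_cell) measurableSet_cell
    have hherm' : IsHermitianMap (diagBlock ω S F (A ∩ B)) :=
      Finset.sum_induction _ IsHermitianMap (fun _ _ => IsHermitianMap.add) IsHermitianMap.zero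
        fun T _ => hherm _ _ ((hA.inter hB).inter measurableSet_cell) measurableSet_cell
    -- the off-diagonal part and the diagonal part without its drift are both completely positive
    have h0 : IsCP (block ω S A B - diagBlock ω S F (A ∩ B)) :=
      isCP_block_sub_diagBlock (A := ⟨A, hA⟩) (B := ⟨B, hB⟩) ω S hcp hFB
    have h1 := h0.add (hccp'.isCP_sub_drift hherm' hh)
    rw [add_sub, add_sub] at h1
    rwa [sub_add_cancel] at h1

end Drift

/-! ### The blocks of the generator -/

section GeneratorBlocks

open TraceClass

variable {Z H : Type*} [MeasurableSpace Z] [NormedAddCommGroup H] [InnerProductSpace ℂ H]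
  [CompleteSpace H] {μ : Measure Z} (ω : Weight μ)

theorem kernelForm_block (S : HybridSpace H μ →L[ℂ] HybridSpace H μ) (A B : Set Z) (p q : H × H) :
    kernelForm (block ω S A B) p q =
      ∫ z in A, inner ℂ p.1 ((S (ω.tensL H B (ketbra p.2 q.2)) z).op q.1) ∂μ := by
  rw [kernelForm, block_apply]
  exact ((elemL p.1 q.1).integral_comp_comm (L1.integrable_coeFn _).integrableOn).symm

/-- Complete positivity on the hybrid space is applied to the positive matrix with the entries
`w 1_B ⊗ |fᵢ⟩⟨fⱼ|`. -/
theorem IsCompletelyPositive.isCP_block {T : HybridSpace H μ →L[ℂ] HybridSpace H μ}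
    (hT : IsCompletelyPositive T) (A : Set Z) {B : Set Z} (hB : MeasurableSet B) :
    IsCP (block ω T A B) := by
  intro n p
  have hpos : IsPositiveMatrix fun i j => ω.tensL H B (ketbra (p i).2 (p j).2) := by
    have h1 : ∀ᵐ z ∂μ, ∀ i j, ω.tensL H B (ketbra (p i).2 (p j).2) z =
        B.indicator (fun z => ω.w z • ketbra (p i).2 (p j).2) z :=
      ae_all_iff.2 fun i => ae_all_iff.2 fun j => ω.coe_tensL hB _
    filter_upwards [h1] with z hz x
    simp only [hz]
    by_cases hzB : z ∈ B
    · have h2 : ∀ i j, (inner ℂ (x i) ((B.indicator (fun z => ω.w z • ketbra (p i).2 (p j).2) z).op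
          (x j)) : ℂ) = (ω.w z : ℂ) * (inner ℂ (x i) (p i).2 *
            starRingEnd ℂ (inner ℂ (x j) (p j).2)) := fun i j => by
        rw [Set.indicator_of_mem hzB, NNReal.smul_def, ← Complex.coe_smul, op_smul, smul_apply,
          op_ketbra_apply, inner_smul_right, inner_smul_right, inner_conj_symm]
        change ((ω.w z : ℝ) : ℂ) * _ = _
        ring
      simp only [h2, ← Finset.mul_sum, ← Finset.sum_mul, ← map_sum]
      refine mul_nonneg ?_ ?_
      · exact Complex.zero_le_real.2 (ω.w z).2
      · rw [Complex.mul_conj]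
        exact Complex.zero_le_real.2 (Complex.normSq_nonneg _)
    · simp [hzB, op_zero]
  have h3 := hT n _ hpos
  have hint : ∀ i j, Integrable (fun z => (inner ℂ (p i).1
      ((T (ω.tensL H B (ketbra (p i).2 (p j).2)) z).op (p j).1) : ℂ)) (μ.restrict A) := fun i j =>
    (elemL (p i).1 (p j).1).integrable_comp (L1.integrable_coeFn _).integrableOn
  simp only [kernelForm_block]
  have h4 : ∀ i, ∑ j, ∫ z in A, (inner ℂ (p i).1
      ((T (ω.tensL H B (ketbra (p i).2 (p j).2)) z).op (p j).1) : ℂ) ∂μ = ∫ z in A, ∑ j,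
        inner ℂ (p i).1 ((T (ω.tensL H B (ketbra (p i).2 (p j).2)) z).op (p j).1) ∂μ :=
    fun i => (integral_finsetSum _ fun j _ => hint i j).symm
  simp only [h4]
  rw [← integral_finsetSum _ fun i _ => integrable_finsetSum _ fun j _ => hint i j]
  refine integral_nonneg_of_ae (ae_restrict_of_ae ?_)
  filter_upwards [h3] with z hz using hz fun i => (p i).1

theorem kernelForm_block_one {A B : Set Z} (hA : MeasurableSet A) (hB : MeasurableSet B)
    (p q : H × H) : kernelForm (block ω 1 A B) p q =
      ω.measure.real (A ∩ B) * (inner ℂ p.1 p.2 * starRingEnd ℂ (inner ℂ q.1 q.2)) := by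
  rw [kernelForm, block_one ω hA hB, map_smul, elemL_apply, op_ketbra_apply, inner_smul_right,
    inner_conj_symm, smul_eq_mul]
  ring

variable {Λ : ℝ → HybridSpace H μ →L[ℂ] HybridSpace H μ} (h0 : Λ 0 = 1)
  (hpos : ∀ t, 0 ≤ t → IsCompletelyPositive (Λ t)) {S : HybridSpace H μ →L[ℂ] HybridSpace H μ}
  (hS : HasDerivWithinAt Λ S (Set.Ici 0) 0)

include h0 hS in
/-- The block of the generator is the limit of the difference quotients of the blocks of `Λ`. -/
theorem tendsto_kernelForm_slope {A B : Set Z} (hA : MeasurableSet A)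
    (hB : MeasurableSet B) (p q : H × H) :
    Tendsto (fun t : ℝ => ((t⁻¹ : ℝ) : ℂ) * (kernelForm (block ω (Λ t) A B) p q -
      ω.measure.real (A ∩ B) * (inner ℂ p.1 p.2 * starRingEnd ℂ (inner ℂ q.1 q.2)))) (𝓝[>] 0)
      (𝓝 (kernelForm (block ω S A B) p q)) := by
  have h1 : Tendsto (slope Λ 0) (𝓝[>] 0) (𝓝 S) := by
    exact (hasDerivWithinAt_iff_tendsto_slope' Set.self_notMem_Ioi).1 (hS.mono Set.Ioi_subset_Ici_self)
  have h2 := ((continuous_kernelForm p q).tendsto _).comp (tendsto_block ω S h1 A B)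
  refine h2.congr fun t => ?_
  have h3 : slope Λ 0 t = ((t⁻¹ : ℝ) : ℂ) • (Λ t - 1) := by
    rw [slope_def_module, sub_zero, h0]
    exact (algebraMap_smul ℂ t⁻¹ (Λ t - 1)).symm
  have h4 : block ω (slope Λ 0 t) A B = ((t⁻¹ : ℝ) : ℂ) • (block ω (Λ t) A B - block ω 1 A B) := by
    rw [h3, ← block_sub]
    ext1 σ
    simp [block]
  rw [Function.comp_apply, h4, kernelForm_smul, kernelForm_sub, kernelForm_block_one ω hA hB]

include h0 hS hpos in
/-- The blocks of the generator are nonnegative where the identity, which is subtracted in the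
difference quotients, does not contribute: off the diagonal, or on families with zero sum. -/
theorem sum_kernelForm_generator_nonneg {A B : Set Z} (hA : MeasurableSet A)
    (hB : MeasurableSet B) {n : ℕ} (p : Fin n → H × H)
    (h : ω.measure.real (A ∩ B) = 0 ∨ ∑ i, inner ℂ (p i).1 (p i).2 = 0) :
    0 ≤ ∑ i, ∑ j, kernelForm (block ω S A B) (p i) (p j) := by
  refine ge_of_tendsto (tendsto_finsetSum _ fun i _ => tendsto_finsetSum _ fun j _ =>
    tendsto_kernelForm_slope ω h0 hS hA hB (p i) (p j)) ?_
  filter_upwards [self_mem_nhdsWithin] with t ht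
  simp only [← Finset.mul_sum, Finset.sum_sub_distrib, ← Finset.sum_mul, ← map_sum]
  have h1 : (ω.measure.real (A ∩ B) : ℂ) * ((∑ i, inner ℂ (p i).1 (p i).2) *
      starRingEnd ℂ (∑ i, inner ℂ (p i).1 (p i).2)) = 0 := by
    rcases h with h | h <;> simp [h]
  rw [h1, sub_zero]
  have ht' : (0 : ℝ) < t := ht
  exact mul_nonneg (Complex.zero_le_real.2 (by positivity))
    ((hpos t ht'.le).isCP_block ω A hB n p)

include h0 hS hpos in
theorem isHermitianMap_generator {A B : Set Z} (hA : MeasurableSet A)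
    (hB : MeasurableSet B) : IsHermitianMap (block ω S A B) := by
  intro p q
  refine tendsto_nhds_unique (tendsto_kernelForm_slope ω h0 hS hA hB p q) ?_
  refine ((Complex.continuous_conj.tendsto _).comp
    (tendsto_kernelForm_slope ω h0 hS hA hB q p)).congr' ?_
  filter_upwards [self_mem_nhdsWithin] with t ht
  have ht' : (0 : ℝ) < t := ht
  have h1 := ((hpos t ht'.le).isCP_block ω A hB).isHermitianMap p q
  simp only [Function.comp_apply, map_mul, map_sub, Complex.conj_ofReal, Complex.conj_conj, h1]
  ring

include h0 hS hpos in
/-- The generator of a completely positive semigroup becomes completely positive after subtraction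
of a drift. -/
theorem exists_drift_measure_generator :
    ∃ κ : Set Z → H →L[ℂ] H,
      (∀ A, MeasurableSet A → ‖κ A‖ ≤ 2 * ‖S‖ * ω.measure.real A) ∧
      (∀ A B, MeasurableSet A → MeasurableSet B → Disjoint A B → κ (A ∪ B) = κ A + κ B) ∧
      ∀ A B, MeasurableSet A → MeasurableSet B →
        IsCP (block ω S A B - sandwichL (κ (A ∩ B)) 1 - sandwichL 1 (star (κ (A ∩ B)))) :=
  exists_drift_measure ω S
    (fun A B hA hB hd _ p => sum_kernelForm_generator_nonneg ω h0 hpos hS hA hB p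
      (Or.inl (by rw [hd.inter_eq, measureReal_empty])))
    (fun A B hA hB _ p hp => sum_kernelForm_generator_nonneg ω h0 hpos hS hA hB p (Or.inr hp))
    (fun A B hA hB => isHermitianMap_generator ω h0 hpos hS hA hB)

end GeneratorBlocks

/-! ### Densities of dominated set functions -/

section Density

variable {Z : Type*} [MeasurableSpace Z]

theorem map_iUnion_sdiff_of_additive {E : Type*} [AddCommGroup E] {m : Set Z → E} (h0 : m ∅ = 0)
    (hadd : ∀ A B, MeasurableSet A → MeasurableSet B → Disjoint A B → m (A ∪ B) = m A + m B)
    {f : ℕ → Set Z} (hf : ∀ n, MeasurableSet (f n)) (hd : Pairwise (Function.onFun Disjoint f))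
    (n : ℕ) : m ((⋃ i, f i) \ ⋃ i ∈ Finset.range n, f i) =
      m (⋃ i, f i) - ∑ i ∈ Finset.range n, m (f i) := by
  have hU : MeasurableSet (⋃ i ∈ Finset.range n, f i) :=
    Finset.measurableSet_biUnion _ fun i _ => hf i
  rw [← map_biUnion_of_additive h0 hadd (Finset.range n) f hf fun i _ j _ hij => hd hij,
    eq_sub_iff_add_eq, ← hadd _ _ ((MeasurableSet.iUnion hf).diff hU) hU
      Set.disjoint_sdiff_left, Set.sdiff_union_of_subset]
  exact Set.iUnion₂_subset fun i _ => Set.subset_iUnion f i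

/-- An additive set function dominated by a finite measure is countably additive. -/
theorem hasSum_iUnion_of_additive {E : Type*} [NormedAddCommGroup E] [CompleteSpace E]
    {ν : Measure Z} [IsFiniteMeasure ν] {m : Set Z → E} {C : ℝ}
    (hb : ∀ A, MeasurableSet A → ‖m A‖ ≤ C * ν.real A)
    (hadd : ∀ A B, MeasurableSet A → MeasurableSet B → Disjoint A B → m (A ∪ B) = m A + m B)
    {f : ℕ → Set Z} (hf : ∀ n, MeasurableSet (f n)) (hd : Pairwise (Function.onFun Disjoint f)) :
    HasSum (fun n => m (f n)) (m (⋃ n, f n)) := by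
  have h0 : m ∅ = 0 := by simpa using hb ∅ MeasurableSet.empty
  have hν := summable_measure_toReal (μ := ν) hf hd
  rw [hasSum_iff_tendsto_nat_of_summable_norm
    (Summable.of_nonneg_of_le (fun _ => norm_nonneg _) (fun n => hb _ (hf n)) (hν.mul_left C)),
    tendsto_iff_norm_sub_tendsto_zero]
  have hνt : Tendsto (fun n => C * (ν.real (⋃ i, f i) - ∑ i ∈ Finset.range n, ν.real (f i))) atTop
      (𝓝 0) := by
    have h1 : HasSum (fun i => ν.real (f i)) (ν.real (⋃ i, f i)) := by
      have h2 : ν.real (⋃ i, f i) = ∑' i, ν.real (f i) := by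
        rw [measureReal_def, measure_iUnion hd hf, ENNReal.tsum_toReal_eq fun i => measure_ne_top _ _]
        rfl
      rw [h2]
      exact hν.hasSum
    have h3 := (tendsto_const_nhds (x := ν.real (⋃ i, f i))).sub h1.tendsto_sum_nat
    rw [sub_self] at h3
    simpa using h3.const_mul C
  refine squeeze_zero (fun _ => norm_nonneg _) (fun n => ?_) hνt
  have hνd : ν.real ((⋃ i, f i) \ ⋃ i ∈ Finset.range n, f i) =
      ν.real (⋃ i, f i) - ∑ i ∈ Finset.range n, ν.real (f i) :=
    map_iUnion_sdiff_of_additive (m := fun A => ν.real A) (by simp)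
      (fun A B _ hB h => measureReal_union h hB) hf hd n
  rw [norm_sub_rev, ← map_iUnion_sdiff_of_additive h0 hadd hf hd, ← hνd]
  exact hb _ ((MeasurableSet.iUnion hf).diff (Finset.measurableSet_biUnion _ fun i _ => hf i))

open Classical in
/-- A real additive set function dominated by a finite measure has a density. -/
theorem exists_real_density {ν : Measure Z} [IsFiniteMeasure ν] {m : Set Z → ℝ} {C : ℝ}
    (hb : ∀ A, MeasurableSet A → ‖m A‖ ≤ C * ν.real A)
    (hadd : ∀ A B, MeasurableSet A → MeasurableSet B → Disjoint A B → m (A ∪ B) = m A + m B) :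
    ∃ g : Z → ℝ, Measurable g ∧ Integrable g ν ∧
      ∀ A, MeasurableSet A → m A = ∫ z in A, g z ∂ν := by
  let s : SignedMeasure Z :=
    { measureOf' := fun A => if MeasurableSet A then m A else 0
      empty' := by simpa using hb ∅ MeasurableSet.empty
      not_measurable' := fun A hA => if_neg hA
      m_iUnion' := fun f hf hd => by
        simp only [hf, if_true, MeasurableSet.iUnion hf]
        exact hasSum_iUnion_of_additive hb hadd hf hd }
  have hs : ∀ A, MeasurableSet A → s A = m A := fun A hA => if_pos hA
  have hac : s ≪ᵥ ν.toENNRealVectorMeasure := by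
    refine VectorMeasure.AbsolutelyContinuous.mk fun A hA h => ?_
    rw [Measure.toENNRealVectorMeasure_apply_measurable hA] at h
    rw [hs A hA]
    have := hb A hA
    rw [measureReal_def, h] at this
    simpa using this
  refine ⟨s.rnDeriv ν, s.measurable_rnDeriv ν, s.integrable_rnDeriv ν, fun A hA => ?_⟩
  rw [← hs A hA, ← withDensityᵥ_apply (s.integrable_rnDeriv ν) hA,
    SignedMeasure.withDensityᵥ_rnDeriv_eq s ν hac]

theorem exists_complex_density {ν : Measure Z} [IsFiniteMeasure ν] {m : Set Z → ℂ} {C : ℝ}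
    (hb : ∀ A, MeasurableSet A → ‖m A‖ ≤ C * ν.real A)
    (hadd : ∀ A B, MeasurableSet A → MeasurableSet B → Disjoint A B → m (A ∪ B) = m A + m B) :
    ∃ g : Z → ℂ, Measurable g ∧ Integrable g ν ∧
      ∀ A, MeasurableSet A → m A = ∫ z in A, g z ∂ν := by
  obtain ⟨g, hg, hgi, h⟩ := exists_real_density (m := fun A => (m A).re) (ν := ν) (C := C)
    (fun A hA => (Complex.abs_re_le_norm _).trans (hb A hA))
    (fun A B hA hB hd => by rw [hadd A B hA hB hd, Complex.add_re])
  obtain ⟨g', hg', hgi', h'⟩ := exists_real_density (m := fun A => (m A).im) (ν := ν) (C := C)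
    (fun A hA => (Complex.abs_im_le_norm _).trans (hb A hA))
    (fun A B hA hB hd => by rw [hadd A B hA hB hd, Complex.add_im])
  refine ⟨fun z => g z + g' z * Complex.I, by fun_prop,
    hgi.ofReal.add (hgi'.ofReal.mul_const _), fun A hA => ?_⟩
  have e1 : ∫ z in A, (g z : ℂ) ∂ν = ((m A).re : ℂ) := by
    rw [h A hA]; exact integral_ofReal
  have e2 : ∫ z in A, (g' z : ℂ) ∂ν = ((m A).im : ℂ) := by
    rw [h' A hA]; exact integral_ofReal
  change m A = ∫ z in A, ((g z : ℂ) + g' z * Complex.I) ∂ν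
  have i1 : Integrable (fun z => (g z : ℂ)) (ν.restrict A) := hgi.ofReal.restrict
  have i2 : Integrable (fun z => (g' z : ℂ)) (ν.restrict A) := hgi'.ofReal.restrict
  rw [integral_add i1 (i2.mul_const _),
    integral_mul_const, e1, e2, Complex.re_add_im]

/-- Interchange of an almost sure statement with a separable family of closed conditions. -/
theorem ae_forall_of_isClosed {X : Type*} [TopologicalSpace X] [TopologicalSpace.SeparableSpace X]
    {ν : Measure Z} {p : Z → X → Prop} (hc : ∀ z, IsClosed {x | p z x})
    (h : ∀ x, ∀ᵐ z ∂ν, p z x) : ∀ᵐ z ∂ν, ∀ x, p z x := by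
  obtain ⟨s, hs, hd⟩ := TopologicalSpace.exists_countable_dense X
  have h1 : ∀ᵐ z ∂ν, ∀ x ∈ s, p z x := (ae_ball_iff hs).2 fun x _ => h x
  filter_upwards [h1] with z hz x
  have h2 : closure s ⊆ {x | p z x} := closure_minimal hz (hc z)
  exact h2 (hd x)

variable {H : Type*} [NormedAddCommGroup H] [InnerProductSpace ℂ H]

/-- The partial expansion `∑_{i<n} ⟨eᵢ, x⟩ eᵢ`. -/
noncomputable def partialSum (e : ℕ → H) (n : ℕ) (x : H) : H :=
  ∑ i ∈ Finset.range n, (inner ℂ (e i) x : ℂ) • e i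

theorem IsParsevalSeq.norm_partialSum_le {e : ℕ → H} (he : IsParsevalSeq e) (n : ℕ) (x : H) :
    ‖partialSum e n x‖ ≤ ‖x‖ := by
  have h1 := (he.norm_sum_smul_sq_le (Finset.range n) fun i => inner ℂ (e i) x).trans
    (he.sum_norm_sq_le (Finset.range n) x)
  exact le_of_sq_le_sq h1 (norm_nonneg _)

theorem IsParsevalSeq.tendsto_partialSum {e : ℕ → H} (he : IsParsevalSeq e) (x : H) :
    Tendsto (fun n => partialSum e n x) atTop (𝓝 x) := (he.hasSum x).tendsto_sum_nat

theorem inner_partialSum (e : ℕ → H) (n : ℕ) (x y : H) (T : H →L[ℂ] H) :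
    (inner ℂ (partialSum e n x) (T (partialSum e n y)) : ℂ) =
      ∑ i ∈ Finset.range n, ∑ j ∈ Finset.range n,
        inner ℂ x (e i) * inner ℂ (e i) (T (e j)) * inner ℂ (e j) y := by
  rw [partialSum, partialSum, sum_inner]
  refine Finset.sum_congr rfl fun i _ => ?_
  rw [inner_smul_left, inner_conj_symm, map_sum, inner_sum, Finset.mul_sum]
  refine Finset.sum_congr rfl fun j _ => ?_
  rw [map_smul, inner_smul_right]
  ring

theorem IsParsevalSeq.tendsto_inner_partialSum {e : ℕ → H} (he : IsParsevalSeq e) (x y : H)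
    (T : H →L[ℂ] H) : Tendsto (fun n => ∑ i ∈ Finset.range n, ∑ j ∈ Finset.range n,
      inner ℂ x (e i) * inner ℂ (e i) (T (e j)) * inner ℂ (e j) y) atTop
      (𝓝 (inner ℂ x (T y) : ℂ)) := by
  simp only [← inner_partialSum]
  exact (he.tendsto_partialSum x).inner ((T.continuous.tendsto _).comp (he.tendsto_partialSum y))

variable [CompleteSpace H]

/-- An infinite matrix whose finite sections are bounded by `C` is the matrix of an operator. -/
theorem IsParsevalSeq.exists_operator {e : ℕ → H} (he : IsParsevalSeq e) {k : ℕ → ℕ → ℂ} {C : ℝ}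
    (hC : 0 ≤ C) (hk : ∀ n x y, (∑ i ∈ Finset.range n, ∑ j ∈ Finset.range n,
      inner ℂ x (e i) * k i j * inner ℂ (e j) y : ℂ).re ≤ C * ‖x‖ * ‖y‖) :
    ∃ K : H →L[ℂ] H, ‖K‖ ≤ C ∧ ∀ i j, (inner ℂ (e i) (K (e j)) : ℂ) =
      inner ℂ (e i) (e i) * k i j * inner ℂ (e j) (e j) := by
  let T : ℕ → H →L[ℂ] H := fun n => ∑ i ∈ Finset.range n, ∑ j ∈ Finset.range n,
    k i j • rankOne ℂ (e i) (e j)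
  have hT : ∀ n x y, (inner ℂ x (T n y) : ℂ) = ∑ i ∈ Finset.range n, ∑ j ∈ Finset.range n,
      inner ℂ x (e i) * k i j * inner ℂ (e j) y := fun n x y => by
    simp only [T, sum_apply, smul_apply, rankOne_apply, inner_sum, inner_smul_right]
    refine Finset.sum_congr rfl fun i _ => Finset.sum_congr rfl fun j _ => ?_
    ring
  have hTn : ∀ n, ‖T n‖ ≤ C := fun n =>
    ContinuousLinearMap.opNorm_le_of_re_inner hC fun x y => by rw [hT]; exact hk n x y
  let U : Ultrafilter ℕ := Ultrafilter.of atTop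
  obtain ⟨K, hK⟩ := exists_weak_limit U hTn
  refine ⟨K, ContinuousLinearMap.opNorm_le_of_re_inner hC fun x y => ?_, fun i j => ?_⟩
  · refine le_of_tendsto ((Complex.continuous_re.tendsto _).comp (hK x y))
      (Eventually.of_forall fun n => ?_)
    rw [Function.comp_apply, hT]
    exact hk n x y
  · refine tendsto_nhds_unique (hK (e i) (e j)) (Tendsto.congr' ?_ tendsto_const_nhds)
    refine Ultrafilter.of_le atTop ?_
    filter_upwards [eventually_gt_atTop i, eventually_gt_atTop j] with n hi hj
    rw [hT, Finset.sum_eq_single i, Finset.sum_eq_single j]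
    · intro l _ hl
      rw [he.inner_eq_zero l j hl, mul_zero]
    · exact fun h => (h (Finset.mem_range.2 hj)).elim
    · intro l _ hl
      simp [he.inner_eq_zero i l hl.symm]
    · exact fun h => (h (Finset.mem_range.2 hi)).elim

/-- The Radon-Nikodym property for operator-valued set functions dominated by a finite measure:
the density is a bounded weakly measurable field of operators. -/
theorem exists_operator_density {ν : Measure Z} [IsFiniteMeasure ν]
    [TopologicalSpace.SeparableSpace H] {κ : Set Z → H →L[ℂ] H} {C : ℝ} (hC : 0 ≤ C)
    (hb : ∀ A, MeasurableSet A → ‖κ A‖ ≤ C * ν.real A)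
    (hadd : ∀ A B, MeasurableSet A → MeasurableSet B → Disjoint A B → κ (A ∪ B) = κ A + κ B) :
    ∃ K : Z → H →L[ℂ] H, (∀ z, ‖K z‖ ≤ C) ∧
      (∀ x y, Measurable fun z => (inner ℂ x (K z y) : ℂ)) ∧
      ∀ A, MeasurableSet A → ∀ x y, (inner ℂ x (κ A y) : ℂ) = ∫ z in A, inner ℂ x (K z y) ∂ν := by
  classical
  obtain ⟨e, he⟩ := exists_isParsevalSeq (H := H)
  have hκ : ∀ A, MeasurableSet A → ∀ x y, ‖(inner ℂ x (κ A y) : ℂ)‖ ≤ C * ‖x‖ * ‖y‖ * ν.real A :=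
    fun A hA x y => by
      calc _ ≤ ‖x‖ * (C * ν.real A * ‖y‖) := (norm_inner_le_norm _ _).trans
            (mul_le_mul_of_nonneg_left ((κ A).le_of_opNorm_le (hb A hA) y) (norm_nonneg _))
        _ = _ := by ring
  have hden := fun i j => exists_complex_density (ν := ν) (m := fun A => inner ℂ (e i) (κ A (e j)))
    (fun A hA => hκ A hA (e i) (e j))
    (fun A B hA hB hd => by rw [hadd A B hA hB hd, add_apply, inner_add_right])
  choose k hkm hki hk using hden
  have hsec : ∀ᵐ z ∂ν, ∀ n, ∀ p : H × H, (∑ i ∈ Finset.range n, ∑ j ∈ Finset.range n,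
      inner ℂ p.1 (e i) * k i j z * inner ℂ (e j) p.2 : ℂ).re ≤ C * ‖p.1‖ * ‖p.2‖ := by
    refine ae_all_iff.2 fun n => ae_forall_of_isClosed (fun z => ?_) fun p => ?_
    · refine isClosed_le ?_ (by fun_prop)
      exact Complex.continuous_re.comp (by fun_prop)
    · have hint : Integrable (fun z => ∑ i ∈ Finset.range n, ∑ j ∈ Finset.range n,
          inner ℂ p.1 (e i) * k i j z * inner ℂ (e j) p.2 : Z → ℂ) ν :=
        integrable_finsetSum _ fun i _ => integrable_finsetSum _ fun j _ =>
          ((hki i j).const_mul _).mul_const _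
      have h1 : 0 ≤ᵐ[ν] fun z => C * ‖p.1‖ * ‖p.2‖ - (∑ i ∈ Finset.range n,
          ∑ j ∈ Finset.range n, inner ℂ p.1 (e i) * k i j z * inner ℂ (e j) p.2 : ℂ).re := by
        refine ae_nonneg_of_forall_setIntegral_nonneg
          ((integrable_const _).sub hint.re) fun A hA _ => ?_
        have h2 : ∫ z in A, (∑ i ∈ Finset.range n, ∑ j ∈ Finset.range n,
            inner ℂ p.1 (e i) * k i j z * inner ℂ (e j) p.2 : ℂ).re ∂ν =
            (inner ℂ (partialSum e n p.1) (κ A (partialSum e n p.2)) : ℂ).re := by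
          have h3 : ∫ z in A, (∑ i ∈ Finset.range n, ∑ j ∈ Finset.range n,
              inner ℂ p.1 (e i) * k i j z * inner ℂ (e j) p.2 : ℂ) ∂ν =
              inner ℂ (partialSum e n p.1) (κ A (partialSum e n p.2)) := by
            rw [inner_partialSum, integral_finsetSum _ fun i _ => integrable_finsetSum _ fun j _ =>
              (((hki i j).const_mul _).mul_const _).integrableOn]
            refine Finset.sum_congr rfl fun i _ => ?_
            rw [integral_finsetSum _ fun j _ => (((hki i j).const_mul _).mul_const _).integrableOn]
            refine Finset.sum_congr rfl fun j _ => ?_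
            rw [integral_mul_const, integral_const_mul, ← hk i j A hA]
          rw [← h3]
          exact integral_re hint.integrableOn
        have hre : Integrable (fun z => (∑ i ∈ Finset.range n, ∑ j ∈ Finset.range n,
            inner ℂ p.1 (e i) * k i j z * inner ℂ (e j) p.2 : ℂ).re) ν := hint.re
        rw [integral_sub (integrable_const _) hre.integrableOn, setIntegral_const, smul_eq_mul,
          sub_nonneg]
        refine h2.le.trans ((Complex.re_le_norm _).trans ((hκ A hA _ _).trans ?_))
        rw [mul_comm (ν.real A)]
        gcongr
        · exact he.norm_partialSum_le n p.1
        · exact he.norm_partialSum_le n p.2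
      filter_upwards [h1] with z hz using sub_nonneg.1 hz
  obtain ⟨t, ht, htm, hnull⟩ : ∃ t : Set Z, {z | ¬ ∀ n, ∀ p : H × H,
      (∑ i ∈ Finset.range n, ∑ j ∈ Finset.range n,
        inner ℂ p.1 (e i) * k i j z * inner ℂ (e j) p.2 : ℂ).re ≤ C * ‖p.1‖ * ‖p.2‖} ⊆ t ∧
      MeasurableSet t ∧ ν t = 0 := exists_measurable_superset_of_null (ae_iff.1 hsec)
  have hex : ∀ z, ∃ K : H →L[ℂ] H, ‖K‖ ≤ C ∧ ∀ i j, (inner ℂ (e i) (K (e j)) : ℂ) =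
      inner ℂ (e i) (e i) * (tᶜ.indicator (k i j) z) * inner ℂ (e j) (e j) := fun z => by
    by_cases hz : z ∈ t
    · exact ⟨0, by simpa using hC, fun i j => by simp [hz]⟩
    · have h1 : ∀ n, ∀ p : H × H, (∑ i ∈ Finset.range n, ∑ j ∈ Finset.range n,
        inner ℂ p.1 (e i) * k i j z * inner ℂ (e j) p.2 : ℂ).re ≤ C * ‖p.1‖ * ‖p.2‖ := by
        by_contra hcon
        exact hz (ht hcon)
      obtain ⟨K, hK1, hK2⟩ := he.exists_operator (k := fun i j => k i j z) hC
        fun n x y => h1 n (x, y)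
      exact ⟨K, hK1, fun i j => by rw [hK2, Set.indicator_of_mem hz]⟩
  choose K hKC hKe using hex
  have hKem : ∀ i j, Measurable fun z => (inner ℂ (e i) (K z (e j)) : ℂ) := fun i j => by
    simp only [hKe]
    exact (((hkm i j).indicator htm.compl).const_mul _).mul_const _
  have hKm : ∀ x y, Measurable fun z => (inner ℂ x (K z y) : ℂ) := fun x y => by
    refine measurable_of_tendsto_metrizable (f := fun n z => ∑ i ∈ Finset.range n,
      ∑ j ∈ Finset.range n, inner ℂ x (e i) * inner ℂ (e i) (K z (e j)) * inner ℂ (e j) y)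
      (fun n => ?_) (tendsto_pi_nhds.2 fun z => he.tendsto_inner_partialSum x y (K z))
    exact Finset.measurable_fun_sum _ fun i _ => Finset.measurable_fun_sum _ fun j _ =>
      ((hKem i j).const_mul _).mul_const _
  have hKi : ∀ x y, Integrable (fun z => (inner ℂ x (K z y) : ℂ)) ν := fun x y => by
    refine Integrable.of_bound (hKm x y).aestronglyMeasurable (‖x‖ * (C * ‖y‖))
      (Eventually.of_forall fun z => ?_)
    exact (norm_inner_le_norm _ _).trans
      (mul_le_mul_of_nonneg_left ((K z).le_of_opNorm_le (hKC z) y) (norm_nonneg _))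
  refine ⟨K, hKC, hKm, fun A hA x y => ?_⟩
  have hentry : ∀ i j, (inner ℂ (e i) (κ A (e j)) : ℂ) = ∫ z in A, inner ℂ (e i) (K z (e j)) ∂ν := by
    intro i j
    have h1 : (fun z => (inner ℂ (e i) (K z (e j)) : ℂ)) =ᵐ[ν.restrict A] fun z =>
        inner ℂ (e i) (e i) * k i j z * inner ℂ (e j) (e j) := by
      refine ae_restrict_of_ae ?_
      filter_upwards [measure_eq_zero_iff_ae_notMem.1 hnull] with z hz
      rw [hKe, Set.indicator_of_mem hz]
    have h2 : κ A (e j) = (inner ℂ (e j) (e j) : ℂ) • κ A (e j) := by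
      rw [← map_smul, he.inner_self_smul]
    rw [integral_congr_ae h1, integral_mul_const, integral_const_mul, ← hk i j A hA,
      he.inner_mul_inner, mul_comm, ← inner_smul_right, ← h2]
  refine tendsto_nhds_unique (he.tendsto_inner_partialSum x y (κ A)) ?_
  have hpart : ∀ n, ∫ z in A, (inner ℂ (partialSum e n x) (K z (partialSum e n y)) : ℂ) ∂ν =
      ∑ i ∈ Finset.range n, ∑ j ∈ Finset.range n,
        inner ℂ x (e i) * inner ℂ (e i) (κ A (e j)) * inner ℂ (e j) y := fun n => by
    simp only [inner_partialSum]
    rw [integral_finsetSum _ fun i _ => integrable_finsetSum _ fun j _ =>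
      (((hKi _ _).const_mul _).mul_const _).integrableOn]
    refine Finset.sum_congr rfl fun i _ => ?_
    rw [integral_finsetSum _ fun j _ => (((hKi _ _).const_mul _).mul_const _).integrableOn]
    refine Finset.sum_congr rfl fun j _ => ?_
    rw [integral_mul_const, integral_const_mul, hentry]
  simp only [← hpart]
  refine tendsto_integral_of_dominated_convergence (fun _ => ‖x‖ * (C * ‖y‖))
    (fun n => (hKm _ _).aestronglyMeasurable) (integrable_const _)
    (fun n => Eventually.of_forall fun z => ?_) (Eventually.of_forall fun z => ?_)
  · refine (norm_inner_le_norm _ _).trans (mul_le_mul (he.norm_partialSum_le n x) ?_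
      (norm_nonneg _) (norm_nonneg _))
    refine ((K z).le_of_opNorm_le (hKC z) _).trans ?_
    gcongr
    exact he.norm_partialSum_le n y
  · exact (he.tendsto_partialSum x).inner
      (((K z).continuous.tendsto _).comp (he.tendsto_partialSum y))

end Density

/-! ### Multiplication by measurable fields of operators -/

section Fields

variable {Z : Type*} [MeasurableSpace Z]

theorem stronglyMeasurable_field_apply {E F : Type*} [NormedAddCommGroup E] [NormedSpace ℂ E]
    [NormedAddCommGroup F] [NormedSpace ℂ F] {T : Z → E →L[ℂ] F}
    (hT : ∀ x, StronglyMeasurable fun z => T z x) {f : Z → E} (hf : StronglyMeasurable f) :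
    StronglyMeasurable fun z => T z (f z) := by
  classical
  refine stronglyMeasurable_of_tendsto atTop (f := fun n z => T z (hf.approx n z)) (fun n => ?_)
    (tendsto_pi_nhds.2 fun z => ((T z).continuous.tendsto _).comp (hf.tendsto_approx z))
  have h1 : (fun z => T z (hf.approx n z)) = fun z => ∑ x ∈ (hf.approx n).range,
      ((hf.approx n) ⁻¹' {x}).indicator (fun z => T z x) z := by
    ext z
    rw [Finset.sum_eq_single (hf.approx n z)]
    · rw [Set.indicator_of_mem]; exact rfl
    · intro x _ hx
      exact Set.indicator_of_notMem (fun h => hx (Eq.symm h)) _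
    · exact fun h => (h (SimpleFunc.mem_range_self _ z)).elim
  rw [h1]
  exact Finset.stronglyMeasurable_fun_sum _ fun x _ =>
    (hT x).indicator ((hf.approx n).measurableSet_fiber x)

theorem aestronglyMeasurable_field_apply {E F : Type*} [NormedAddCommGroup E] [NormedSpace ℂ E]
    [NormedAddCommGroup F] [NormedSpace ℂ F] {T : Z → E →L[ℂ] F} {μ : Measure Z}
    (hT : ∀ x, StronglyMeasurable fun z => T z x) {f : Z → E} (hf : AEStronglyMeasurable f μ) :
    AEStronglyMeasurable (fun z => T z (f z)) μ :=
  ⟨fun z => T z (hf.mk f z), stronglyMeasurable_field_apply hT hf.stronglyMeasurable_mk,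
    hf.ae_eq_mk.mono fun z hz => by simp only [hz]⟩

open TraceClass

variable {H : Type*} [NormedAddCommGroup H] [InnerProductSpace ℂ H] {μ : Measure Z}

/-- A bounded strongly measurable field of operators on the trace class. -/
structure IsBoundedField (T : Z → TraceClass H →L[ℂ] TraceClass H) (C : ℝ) : Prop where
  stronglyMeasurable : ∀ σ, StronglyMeasurable fun z => T z σ
  bound : ∀ z, ‖T z‖ ≤ C

theorem IsBoundedField.integrable {T : Z → TraceClass H →L[ℂ] TraceClass H} {C : ℝ}
    (hT : IsBoundedField T C) {f : Z → TraceClass H} (hf : Integrable f μ) :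
    Integrable (fun z => T z (f z)) μ := by
  refine Integrable.mono' (hf.norm.const_mul C)
    (aestronglyMeasurable_field_apply hT.stronglyMeasurable hf.aestronglyMeasurable)
    (Eventually.of_forall fun z => (T z).le_of_opNorm_le (hT.bound z) _)

variable (μ) in
/-- Multiplication by a bounded field of operators. -/
noncomputable def fieldL {T : Z → TraceClass H →L[ℂ] TraceClass H} {C : ℝ}
    (hT : IsBoundedField T C) : HybridSpace H μ →L[ℂ] HybridSpace H μ :=
  LinearMap.mkContinuous
    { toFun := fun ψ => (hT.integrable (L1.integrable_coeFn ψ)).toL1 _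
      map_add' := fun ψ φ => by
        rw [← Integrable.toL1_add]
        refine (Integrable.toL1_eq_toL1_iff _ _ _ _).2 ?_
        filter_upwards [Lp.coeFn_add ψ φ] with z hz
        rw [hz, Pi.add_apply, map_add, Pi.add_apply]
      map_smul' := fun c ψ => by
        rw [RingHom.id_apply, ← Integrable.toL1_smul]
        refine (Integrable.toL1_eq_toL1_iff _ _ _ _).2 ?_
        filter_upwards [Lp.coeFn_smul c ψ] with z hz
        rw [hz, Pi.smul_apply, map_smul] } C
    fun ψ => by
      refine (L1.norm_of_fun_eq_integral_norm (hT.integrable (L1.integrable_coeFn ψ))).trans_le ?_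
      rw [L1.norm_eq_integral_norm, ← integral_const_mul]
      exact integral_mono (hT.integrable (L1.integrable_coeFn ψ)).norm
        ((L1.integrable_coeFn ψ).norm.const_mul C) fun z => (T z).le_of_opNorm_le (hT.bound z) _

theorem coe_fieldL {T : Z → TraceClass H →L[ℂ] TraceClass H} {C : ℝ}
    (hT : IsBoundedField T C) (ψ : HybridSpace H μ) : fieldL μ hT ψ =ᵐ[μ] fun z => T z (ψ z) :=
  Integrable.coeFn_toL1 (hT.integrable (L1.integrable_coeFn ψ))

theorem block_fieldL (ω : Weight μ) {T : Z → TraceClass H →L[ℂ] TraceClass H} {C : ℝ}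
    (hT : IsBoundedField T C) {A B : Set Z} (hA : MeasurableSet A) (hB : MeasurableSet B)
    (σ : TraceClass H) : block ω (fieldL μ hT) A B σ = ∫ z in A ∩ B, T z σ ∂ω.measure := by
  rw [block_apply, ω.setIntegral_eq _ (hA.inter hB), ← setIntegral_indicator hB]
  refine integral_congr_ae (ae_restrict_of_ae ?_)
  filter_upwards [coe_fieldL hT (ω.tensL H B σ), ω.coe_tensL hB σ] with z h1 h2
  rw [h1, h2]
  by_cases hz : z ∈ B
  · rw [Set.indicator_of_mem hz, Set.indicator_of_mem hz, NNReal.smul_def, NNReal.smul_def,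
      ← Complex.coe_smul, ← Complex.coe_smul, map_smul]
  · rw [Set.indicator_of_notMem hz, Set.indicator_of_notMem hz, map_zero]

theorem ext_elemL {σ τ : TraceClass H} (h : ∀ x y, elemL x y σ = elemL x y τ) : σ = τ :=
  ext' (ContinuousLinearMap.ext fun y => ext_inner_left ℂ fun x => h x y)

variable [CompleteSpace H]

/-- The map `σ ↦ Kσ + σK†`. -/
noncomputable def driftL (K : H →L[ℂ] H) : TraceClass H →L[ℂ] TraceClass H :=
  sandwichL K 1 + sandwichL 1 (star K)

theorem driftL_apply (K : H →L[ℂ] H) (σ : TraceClass H) :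
    driftL K σ = sandwich K σ 1 + sandwich 1 σ (star K) := rfl

theorem driftL_ketbra (K : H →L[ℂ] H) (x y : H) :
    driftL K (ketbra x y) = ketbra (K x) y + ketbra x (K y) := by
  rw [driftL_apply, sandwich_ketbra, sandwich_ketbra]
  simp

theorem norm_driftL_le (K : H →L[ℂ] H) : ‖driftL K‖ ≤ 2 * ‖K‖ := by
  have h1 : ‖(1 : H →L[ℂ] H)‖ ≤ 1 := ContinuousLinearMap.norm_id_le
  have h2 : ‖sandwichL K (1 : H →L[ℂ] H)‖ ≤ ‖K‖ * 1 :=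
    (norm_sandwichL_le K 1).trans (by gcongr)
  have h3 : ‖sandwichL (1 : H →L[ℂ] H) (star K)‖ ≤ 1 * ‖K‖ := by
    refine (norm_sandwichL_le 1 (star K)).trans ?_
    rw [norm_star]
    gcongr
  refine (norm_add_le _ _).trans ?_
  linarith

theorem stronglyMeasurable_driftL [TopologicalSpace.SeparableSpace H] {K : Z → H →L[ℂ] H}
    (hK : ∀ x y, Measurable fun z => (inner ℂ x (K z y) : ℂ)) (σ : TraceClass H) :
    StronglyMeasurable fun z => driftL (K z) σ := by
  obtain ⟨e, he⟩ := exists_isParsevalSeq (H := H)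
  have h1 : ∀ x y, StronglyMeasurable fun z => ketbra (K z x) y := fun x y => by
    refine stronglyMeasurable_of_tendsto atTop (f := fun n z => ∑ i ∈ Finset.range n,
      (inner ℂ (e i) (K z x) : ℂ) • ketbra (e i) y) (fun n => ?_) (tendsto_pi_nhds.2 fun z => ?_)
    · exact Finset.stronglyMeasurable_fun_sum _ fun i _ =>
        (hK _ _).stronglyMeasurable.smul_const _
    · have h2 := tendsto_ketbra (he.tendsto_partialSum (K z x)) (tendsto_const_nhds (x := y))
      refine h2.congr fun n => ?_
      refine ext' ?_
      simp [partialSum, op_ketbra, op_fsum, op_smul]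
  have h1' : ∀ x y, StronglyMeasurable fun z => ketbra x (K z y) := fun x y => by
    refine stronglyMeasurable_of_tendsto atTop (f := fun n z => ∑ i ∈ Finset.range n,
      starRingEnd ℂ (inner ℂ (e i) (K z y) : ℂ) • ketbra x (e i)) (fun n => ?_)
      (tendsto_pi_nhds.2 fun z => ?_)
    · exact Finset.stronglyMeasurable_fun_sum _ fun i _ =>
        (Complex.continuous_conj.measurable.comp (hK _ _)).stronglyMeasurable.smul_const _
    · have h2 := tendsto_ketbra (tendsto_const_nhds (x := x)) (he.tendsto_partialSum (K z y))
      refine h2.congr fun n => ?_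
      refine ext' ?_
      simp [partialSum, op_ketbra, op_fsum, op_smul]
  obtain ⟨x, y, hr⟩ := σ.rep
  refine stronglyMeasurable_of_tendsto atTop (f := fun n z => ∑ i ∈ Finset.range n,
    (ketbra (K z (x i)) (y i) + ketbra (x i) (K z (y i)))) (fun n => ?_)
    (tendsto_pi_nhds.2 fun z => ?_)
  · exact Finset.stronglyMeasurable_fun_sum _ fun i _ => (h1 _ _).add (h1' _ _)
  · have h3 := ((driftL (K z)).hasSum (hasSum_ketbra hr)).tendsto_sum_nat
    simpa only [driftL_ketbra] using h3

theorem isBoundedField_driftL [TopologicalSpace.SeparableSpace H] {K : Z → H →L[ℂ] H} {C : ℝ}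
    (hK : ∀ x y, Measurable fun z => (inner ℂ x (K z y) : ℂ)) (hC : ∀ z, ‖K z‖ ≤ C) :
    IsBoundedField (fun z => driftL (K z)) (2 * C) :=
  ⟨stronglyMeasurable_driftL hK, fun z => (norm_driftL_le _).trans
    (mul_le_mul_of_nonneg_left (hC z) zero_le_two)⟩

/-- The generator of a completely positive semigroup is the sum of a map `Φ` with completely
positive blocks and of a drift `ψ ↦ Kψ + ψK†` with a bounded field `K` of operators. -/
theorem exists_drift_field [TopologicalSpace.SeparableSpace H] (ω : Weight μ)
    {Λ : ℝ → HybridSpace H μ →L[ℂ] HybridSpace H μ} (h0 : Λ 0 = 1)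
    (hpos : ∀ t, 0 ≤ t → IsCompletelyPositive (Λ t)) {S : HybridSpace H μ →L[ℂ] HybridSpace H μ}
    (hS : HasDerivWithinAt Λ S (Set.Ici 0) 0) :
    ∃ (K : Z → H →L[ℂ] H) (C : ℝ) (hK : IsBoundedField (fun z => driftL (K z)) (2 * C)),
      (∀ x y, Measurable fun z => (inner ℂ x (K z y) : ℂ)) ∧ (∀ z, ‖K z‖ ≤ C) ∧
      ∀ A B, MeasurableSet A → MeasurableSet B → IsCP (block ω (S - fieldL μ hK) A B) := by
  obtain ⟨κ, hκ1, hκ2, hκ3⟩ := exists_drift_measure_generator ω h0 hpos hS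
  obtain ⟨K, hKC, hKm, hKi⟩ := exists_operator_density (by positivity) hκ1 hκ2
  have hK := isBoundedField_driftL hKm hKC
  refine ⟨K, _, hK, hKm, hKC, fun A B hA hB => ?_⟩
  have hKint : ∀ x y, Integrable (fun z => (inner ℂ x (K z y) : ℂ)) ω.measure := fun x y => by
    refine Integrable.of_bound (hKm x y).aestronglyMeasurable (‖x‖ * ((2 * ‖S‖) * ‖y‖))
      (Eventually.of_forall fun z => ?_)
    exact (norm_inner_le_norm _ _).trans
      (mul_le_mul_of_nonneg_left ((K z).le_of_opNorm_le (hKC z) y) (norm_nonneg _))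
  have h1 : block ω (fieldL μ hK) A B = driftL (κ (A ∩ B)) := by
    refine clm_ext fun f g => ext_elemL fun x y => ?_
    have h2 : ∀ z, elemL x y (driftL (K z) (ketbra f g)) =
        inner ℂ x (K z f) * inner ℂ g y + inner ℂ x f * starRingEnd ℂ (inner ℂ y (K z g)) := by
      intro z
      rw [driftL_ketbra, map_add, elemL_apply, elemL_apply, op_ketbra_apply, op_ketbra_apply,
        inner_smul_right, inner_smul_right, inner_conj_symm]
      ring
    have h3 : elemL x y (driftL (κ (A ∩ B)) (ketbra f g)) =
        inner ℂ x (κ (A ∩ B) f) * inner ℂ g y +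
          inner ℂ x f * starRingEnd ℂ (inner ℂ y (κ (A ∩ B) g)) := by
      rw [driftL_ketbra, map_add, elemL_apply, elemL_apply, op_ketbra_apply, op_ketbra_apply,
        inner_smul_right, inner_smul_right, inner_conj_symm]
      ring
    rw [block_fieldL ω hK hA hB, h3, hKi _ (hA.inter hB), hKi _ (hA.inter hB), ← integral_conj,
      ← ContinuousLinearMap.integral_comp_comm _ (hK.integrable (integrable_const _)).integrableOn]
    simp only [h2]
    have hconj : Integrable (fun z => starRingEnd ℂ (inner ℂ y (K z g))) ω.measure :=
      (LinearIsometryEquiv.integrable_comp_iff Complex.conjLIE).2 (hKint y g)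
    rw [integral_add ((hKint _ _).mul_const _).integrableOn (hconj.const_mul _).integrableOn,
      integral_mul_const, integral_const_mul]
  rw [block_sub, h1, driftL, ← sub_sub]
  exact hκ3 A B hA hB

end Fields

/-! ### Kernels of completely positive blocks -/

section FamilyKernel

open TraceClass ProbabilityTheory

variable {Z H : Type*} [MeasurableSpace Z] [NormedAddCommGroup H] [InnerProductSpace ℂ H]
  {μ : Measure Z}

theorem IsCP.sum_nonneg {ι : Type*} {R : TraceClass H →L[ℂ] TraceClass H} (h : IsCP R)
    (s : Finset ι) (p : ι → H × H) : 0 ≤ ∑ i ∈ s, ∑ j ∈ s, kernelForm R (p i) (p j) := by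
  have h1 := h s.card fun k => p (s.equivFin.symm k)
  have h2 : ∀ f : ι → ℂ, ∑ k : Fin s.card, f (s.equivFin.symm k) = ∑ i ∈ s, f i := fun f => by
    rw [Equiv.sum_comp s.equivFin.symm fun i : s => f i, Finset.sum_coe_sort s f]
  have h3 : ∀ x, ∑ k : Fin s.card, kernelForm R x (p (s.equivFin.symm k)) =
      ∑ j ∈ s, kernelForm R x (p j) := fun x => h2 fun j => kernelForm R x (p j)
  rw [← h2 fun i => ∑ j ∈ s, kernelForm R (p i) (p j)]
  simpa only [h3] using h1

theorem hasSum_kernelForm_block_left (ω : Weight μ) (Φ : HybridSpace H μ →L[ℂ] HybridSpace H μ)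
    {f : ℕ → Set Z} (hf : ∀ n, MeasurableSet (f n)) (hd : Pairwise (Function.onFun Disjoint f))
    (B : Set Z) (p q : H × H) : HasSum (fun n => kernelForm (block ω Φ (f n) B) p q)
      (kernelForm (block ω Φ (⋃ n, f n) B) p q) :=
  (elemL p.1 q.1).hasSum (hasSum_integral_iUnion hf hd (L1.integrable_coeFn _).integrableOn)

theorem hasSum_kernelForm_block_right (ω : Weight μ) (Φ : HybridSpace H μ →L[ℂ] HybridSpace H μ)
    {f : ℕ → Set Z} (hf : ∀ n, MeasurableSet (f n)) (hd : Pairwise (Function.onFun Disjoint f))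
    (A : Set Z) (p q : H × H) : HasSum (fun n => kernelForm (block ω Φ A (f n)) p q)
      (kernelForm (block ω Φ A (⋃ n, f n)) p q) := by
  refine hasSum_iUnion_of_additive (m := fun B => kernelForm (block ω Φ A B) p q) (ν := ω.measure)
    (C := ‖Φ‖ * (‖p.1‖ * ‖p.2‖ * (‖q.1‖ * ‖q.2‖))) (fun B _ => ?_)
    (fun B B' hB hB' h => by rw [block_union_right ω Φ A hB hB' h, kernelForm_add]) hf hd
  refine (norm_kernelForm_le _ _ _).trans ?_
  calc _ ≤ ‖Φ‖ * ω.measure.real B * (‖p.1‖ * ‖p.2‖ * (‖q.1‖ * ‖q.2‖)) := by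
        gcongr
        exact norm_block_le ω Φ _ _
    _ = _ := by ring

open Classical in
/-- For each finite family of vectors, the quadratic form in the blocks of a completely positive map
is a bimeasure, dominated by a multiple of `ω.measure`, and hence disintegrates into a kernel. -/
theorem exists_family_kernel [StandardBorelSpace Z] (ω : Weight μ)
    {Φ : HybridSpace H μ →L[ℂ] HybridSpace H μ}
    (hΦ : ∀ A B, MeasurableSet A → MeasurableSet B → IsCP (block ω Φ A B))
    (s : Finset ℕ) (p : ℕ → H × H) : ∃ κ : Kernel Z Z, IsFiniteKernel κ ∧
      ∀ A B, MeasurableSet A → MeasurableSet B →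
        ∑ i ∈ s, ∑ j ∈ s, kernelForm (block ω Φ A B) (p i) (p j) =
          ∫ z in B, ((κ z).real A : ℂ) ∂ω.measure := by
  set q : Set Z → Set Z → ℂ := fun A B => ∑ i ∈ s, ∑ j ∈ s, kernelForm (block ω Φ A B) (p i) (p j)
    with hq
  have hq0 : ∀ A B, MeasurableSet A → MeasurableSet B → 0 ≤ q A B := fun A B hA hB =>
    (hΦ A B hA hB).sum_nonneg s p
  have hre : ∀ A B, MeasurableSet A → MeasurableSet B → 0 ≤ (q A B).re := fun A B hA hB =>
    (Complex.nonneg_iff.1 (hq0 A B hA hB)).1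
  have hqre : ∀ A B, MeasurableSet A → MeasurableSet B → q A B = ((q A B).re : ℂ) := fun A B hA hB =>
    Complex.ext (by simp) (by simpa using (Complex.nonneg_iff.1 (hq0 A B hA hB)).2.symm)
  have hsumB : ∀ A {f : ℕ → Set Z}, (∀ n, MeasurableSet (f n)) →
      Pairwise (Function.onFun Disjoint f) →
      HasSum (fun n => (q A (f n)).re) (q A (⋃ n, f n)).re := fun A f hf hd =>
    Complex.hasSum_re (hasSum_sum fun i _ => hasSum_sum fun j _ =>
      hasSum_kernelForm_block_right ω Φ hf hd A _ _)
  have hsumA : ∀ B {f : ℕ → Set Z}, (∀ n, MeasurableSet (f n)) →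
      Pairwise (Function.onFun Disjoint f) →
      HasSum (fun n => (q (f n) B).re) (q (⋃ n, f n) B).re := fun B f hf hd =>
    Complex.hasSum_re (hasSum_sum fun i _ => hasSum_sum fun j _ =>
      hasSum_kernelForm_block_left ω Φ hf hd B _ _)
  -- the bimeasure `β A B = q A B`
  let β : Set Z → Measure Z := fun A => if hA : MeasurableSet A then
    Measure.ofMeasurable (fun B _ => ENNReal.ofReal (q A B).re)
      (by simp [hq, block_empty_right, kernelForm_zero])
      (fun f hf hd => by
        rw [← (hsumB A hf hd).tsum_eq]
        exact ENNReal.ofReal_tsum_of_nonneg (fun n => hre _ _ hA (hf n)) (hsumB A hf hd).summable)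
    else 0
  have hβ : ∀ A B, MeasurableSet A → MeasurableSet B → β A B = ENNReal.ofReal (q A B).re :=
    fun A B hA hB => by
      simp only [β, dif_pos hA]
      exact Measure.ofMeasurable_apply B hB
  have hbi : IsBimeasure β :=
    { empty := by
        refine Measure.ext fun B hB => ?_
        rw [hβ _ _ MeasurableSet.empty hB]
        simp [hq, block_empty_left, kernelForm_zero]
      iUnion := fun f hf hd B hB => by
        rw [hβ _ _ (MeasurableSet.iUnion hf) hB, ← (hsumA B hf hd).tsum_eq,
          ENNReal.ofReal_tsum_of_nonneg (fun n => hre _ _ (hf n) hB) (hsumA B hf hd).summable]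
        exact tsum_congr fun n => (hβ _ _ (hf n) hB).symm }
  set D : ℝ := ∑ i ∈ s, ∑ j ∈ s, ‖Φ‖ * (‖(p i).1‖ * ‖(p i).2‖ * (‖(p j).1‖ * ‖(p j).2‖)) with hD
  have hD0 : 0 ≤ D := Finset.sum_nonneg fun i _ => Finset.sum_nonneg fun j _ => by positivity
  have hle : β Set.univ ≤ D.toNNReal • ω.measure := by
    refine Measure.le_iff.2 fun B hB => ?_
    have h1 : (q Set.univ B).re ≤ D * ω.measure.real B := by
      refine (Complex.re_le_norm _).trans ((norm_sum_le _ _).trans ?_)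
      rw [hD, Finset.sum_mul]
      refine Finset.sum_le_sum fun i _ => (norm_sum_le _ _).trans ?_
      rw [Finset.sum_mul]
      refine Finset.sum_le_sum fun j _ => (norm_kernelForm_le _ _ _).trans ?_
      calc _ ≤ ‖Φ‖ * ω.measure.real B * (‖(p i).1‖ * ‖(p i).2‖ * (‖(p j).1‖ * ‖(p j).2‖)) := by
            gcongr
            exact norm_block_le ω Φ _ _
        _ = _ := by ring
    rw [hβ _ _ MeasurableSet.univ hB]
    refine (ENNReal.ofReal_le_ofReal h1).trans (le_of_eq ?_)
    rw [ENNReal.ofReal_mul hD0, measureReal_def, ENNReal.ofReal_toReal (measure_ne_top _ _)]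
    rfl
  obtain ⟨κ, hκ1, hκ2⟩ := IsBimeasure.exists_kernel ω.measure hle hbi
  have hfin : IsFiniteKernel κ := ⟨D.toNNReal, ENNReal.coe_lt_top, hκ1⟩
  refine ⟨κ, hfin, fun A B hA hB => ?_⟩
  change q A B = _
  have h2 := hκ2 A hA B hB
  rw [hβ A B hA hB] at h2
  have h3 : ∫ z in B, (κ z).real A ∂ω.measure = (q A B).re := by
    rw [← ENNReal.toReal_ofReal (hre A B hA hB), h2]
    exact integral_toReal (κ.measurable_coe hA).aemeasurable
      (Eventually.of_forall fun z => measure_lt_top _ _)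
  rw [hqre A B hA hB, ← h3]
  exact integral_ofReal.symm

/-- A finite measure as a complex vector measure. -/
noncomputable def complexMeasure {Y : Type*} [MeasurableSpace Y] (m : Measure Y)
    [IsFiniteMeasure m] : VectorMeasure Y ℂ :=
  m.toSignedMeasure.mapRange Complex.ofRealHom.toAddMonoidHom Complex.continuous_ofReal

theorem complexMeasure_apply {Y : Type*} [MeasurableSpace Y] (m : Measure Y)
    [IsFiniteMeasure m] {A : Set Y} (hA : MeasurableSet A) : complexMeasure m A = m.real A := by
  rw [complexMeasure, VectorMeasure.mapRange_apply, Measure.toSignedMeasure_apply_measurable hA]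
  rfl

/-- Almost sure vanishing on each set implies almost sure vanishing as measures, since the
σ-algebra is generated by a countable π-system. -/
theorem ae_vectorMeasure_eq_zero {Y : Type*} [MeasurableSpace Y] [StandardBorelSpace Y]
    {ν : Measure Z} {F : Z → VectorMeasure Y ℂ}
    (h : ∀ A, MeasurableSet A → ∀ᵐ z ∂ν, F z A = 0) : ∀ᵐ z ∂ν, ∀ A, F z A = 0 := by
  have hemb := measurableEmbedding_embeddingReal Y
  have h1 : ∀ᵐ z ∂ν, ∀ q : ℚ, F z (embeddingReal Y ⁻¹' Set.Iic (q : ℝ)) = 0 :=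
    ae_all_iff.2 fun q => h _ (hemb.measurable measurableSet_Iic)
  filter_upwards [h1, h _ MeasurableSet.univ] with z hz hu A
  by_cases hA : MeasurableSet A
  swap
  · exact (F z).not_measurable hA
  have hB : ∀ B : Set ℝ, MeasurableSet B → F z (embeddingReal Y ⁻¹' B) = 0 := by
    intro B hB
    refine MeasurableSpace.induction_on_inter
      (C := fun B _ => F z (embeddingReal Y ⁻¹' B) = 0)
      ((BorelSpace.measurable_eq (α := ℝ)).trans Real.borel_eq_generateFrom_Iic_rat)
      Real.isPiSystem_Iic_rat ?_ ?_ ?_ ?_ B hB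
    · simp
    · rintro _ hs
      simp only [Set.mem_iUnion, Set.mem_singleton_iff] at hs
      obtain ⟨q, rfl⟩ := hs
      exact hz q
    · intro t ht htz
      rw [Set.preimage_compl, VectorMeasure.of_compl (hemb.measurable ht), hu, htz, sub_zero]
    · intro f hd hf hfz
      rw [Set.preimage_iUnion]
      have h3 := (F z).m_iUnion (fun n => hemb.measurable (hf n))
        fun i j hij => (hd hij).preimage (embeddingReal Y)
      simp only [hfz] at h3
      exact h3.unique hasSum_zero
  have h4 := hB (embeddingReal Y '' A) (hemb.measurableSet_image.2 hA)
  rwa [hemb.injective.preimage_image] at h4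

end FamilyKernel

/-! ### The Choi kernel of a completely positive map -/

section ChoiKernel

open TraceClass ProbabilityTheory

theorem Matrix.PosSemidef.of_sum_nonneg {ι : Type*} {M : Matrix ι ι ℂ}
    (h : ∀ (s : Finset ι) (v : ι → ℂ),
      0 ≤ ∑ i ∈ s, ∑ j ∈ s, starRingEnd ℂ (v i) * v j * M i j) : M.PosSemidef := by
  classical
  have hdiag : ∀ i, (M i i).im = 0 := fun i => by
    have := (Complex.nonneg_iff.1 (h {i} 1)).2
    simpa using this.symm
  refine ⟨Matrix.IsHermitian.ext fun i j => ?_, fun x => ?_⟩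
  · rcases eq_or_ne i j with rfl | hij
    · exact Complex.ext rfl (by simp [hdiag])
    have h1 := (Complex.nonneg_iff.1 (h {i, j} 1)).2
    have h2 := (Complex.nonneg_iff.1 (h {i, j} fun k => if k = j then Complex.I else 1)).2
    simp [Finset.sum_pair hij, hij, hdiag] at h1 h2
    apply Complex.ext
    · simp; linarith
    · simp; linarith
  · refine (h x.support x).trans_eq ?_
    refine Finset.sum_congr rfl fun i _ => Finset.sum_congr rfl fun j _ => ?_
    change _ = starRingEnd ℂ (x i) * M i j * x j
    ring

theorem Matrix.PosSemidef.sum_nonneg {ι : Type*} {M : Matrix ι ι ℂ} (h : M.PosSemidef)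
    (n : ℕ) (a : ℕ → ι) (v : ℕ → ℂ) :
    0 ≤ ∑ i ∈ Finset.range n, ∑ j ∈ Finset.range n,
      starRingEnd ℂ (v i) * v j * M (a i) (a j) := by
  have h1 := (h.submatrix fun i : Fin n => a i).dotProduct_mulVec_nonneg fun i => v i
  rw [Finset.sum_range]
  simp only [Finset.sum_range, dotProduct, Matrix.mulVec, Finset.mul_sum, Matrix.submatrix_apply] at h1 ⊢
  refine h1.trans_eq (Finset.sum_congr rfl fun i _ => Finset.sum_congr rfl fun j _ => ?_)
  simp only [Pi.star_apply, RCLike.star_def]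
  ring

/-- The matrix with an additional zero row and column in front. -/
def bordered {X : Type*} [Zero X] (m : ℕ → ℕ → X) : ℕ → ℕ → X
  | a + 1, b + 1 => m a b
  | _, _ => 0

theorem bordered_zero_right {X : Type*} [Zero X] (m : ℕ → ℕ → X) (a : ℕ) : bordered m a 0 = 0 := by
  cases a <;> rfl

theorem posSemidef_bordered {m : ℕ → ℕ → ℂ}
    (h : ∀ (s : Finset ℕ) (v : ℕ → ℂ), 0 ≤ ∑ i ∈ s, ∑ j ∈ s, starRingEnd ℂ (v i) * v j * m i j) :
    Matrix.PosSemidef (Matrix.of (bordered m)) := by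
  have h1 : Matrix.PosSemidef (Matrix.of m) := Matrix.PosSemidef.of_sum_nonneg h
  refine Matrix.PosSemidef.of_sum_nonneg fun s v => ?_
  have hn : ∃ n, s ⊆ Finset.range (n + 1) :=
    ⟨s.sup id, fun i hi => Finset.mem_range.2 (Nat.lt_succ_of_le (Finset.le_sup (f := id) hi))⟩
  obtain ⟨n, hn⟩ := hn
  classical
  -- extend `v` by zero from `s` to `{0, …, n}`
  set v' : ℕ → ℂ := fun i => if i ∈ s then v i else 0 with hv'
  have h2 := h1.sum_nonneg n id fun i => v' (i + 1)
  have h3 : ∑ i ∈ s, ∑ j ∈ s, starRingEnd ℂ (v i) * v j * Matrix.of (bordered m) i j =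
      ∑ i ∈ Finset.range (n + 1), ∑ j ∈ Finset.range (n + 1),
        starRingEnd ℂ (v' i) * v' j * bordered m i j := by
    rw [← Finset.sum_subset hn]
    · refine Finset.sum_congr rfl fun i hi => ?_
      rw [← Finset.sum_subset hn]
      · refine Finset.sum_congr rfl fun j hj => ?_
        simp only [hv', if_pos hi, if_pos hj]
        rfl
      · intro j _ hj
        simp [hv', hj]
    · intro i _ hi
      simp [hv', hi]
  rw [h3, Finset.sum_range_succ']
  simp only [Finset.sum_range_succ', bordered_zero_right]
  simpa [bordered] using h2

/-- A vector measure with matrix values from its entries. -/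
noncomputable def matrixMeasure {Y : Type*} [MeasurableSpace Y] (m : ℕ → ℕ → VectorMeasure Y ℂ) :
    VectorMeasure Y (Matrix ℕ ℕ ℂ) where
  measureOf' A := Matrix.of fun α β => m α β A
  empty' := by ext α β; simp
  not_measurable' A hA := by
    ext α β
    exact (m α β).not_measurable hA
  m_iUnion' f hf hd := by
    refine Pi.hasSum.2 fun α => Pi.hasSum.2 fun β => ?_
    exact (m α β).m_iUnion hf hd

variable {Z H : Type*} [MeasurableSpace Z] [NormedAddCommGroup H] [InnerProductSpace ℂ H]
  {μ : Measure Z}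

/-- The vectors `(eᵢ, eₖ)` with `matUnit e (a + 1) = |eᵢ⟩⟨eₖ|`, where `a` is the pair `(i, k)`. -/
def unitVectors (e : ℕ → H) (a : ℕ) : H × H := (e a.unpair.1, e a.unpair.2)

/-- The kernel `W` of matrices represents the blocks of `Φ` in the basis `matUnit e`. -/
structure IsChoiKernel (ω : Weight μ) (Φ : HybridSpace H μ →L[ℂ] HybridSpace H μ) (e : ℕ → H)
    (C : ℝ) (W : Z → VectorMeasure Z (Matrix ℕ ℕ ℂ)) : Prop where
  isChoiMatrix : ∀ z A, MeasurableSet A → IsChoiMatrix (W z A) C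
  measurable : ∀ A α β, MeasurableSet A → Measurable fun z => W z A α β
  measurable_diag : ∀ α β, Measurable fun z => W z {z} α β
  integral : ∀ A B, MeasurableSet A → MeasurableSet B → ∀ a b,
    kernelForm (block ω Φ A B) (unitVectors e a) (unitVectors e b) =
      ∫ z in B, W z A (a + 1) (b + 1) ∂ω.measure

theorem measurable_real_kernel (κ : Kernel Z Z) {A : Set Z} (hA : MeasurableSet A) :
    Measurable fun z => ((κ z).real A : ℂ) :=
  Complex.measurable_ofReal.comp (κ.measurable_coe hA).ennreal_toReal

theorem measurable_real_kernel_diag [StandardBorelSpace Z] (κ : Kernel Z Z) [IsFiniteKernel κ] :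
    Measurable fun z => ((κ z).real {z} : ℂ) := by
  have h1 := Kernel.measurable_kernel_prodMk_left (κ := κ) (measurableSet_diagonal (α := Z))
  have h2 : ∀ z : Z, Prod.mk z ⁻¹' Set.diagonal Z = {z} := fun z => by
    ext y; simp [eq_comm]
  simp only [h2] at h1
  exact Complex.measurable_ofReal.comp h1.ennreal_toReal

theorem integrable_real_kernel (κ : Kernel Z Z) [IsFiniteKernel κ] {ν : Measure Z}
    [IsFiniteMeasure ν] {A : Set Z} (hA : MeasurableSet A) :
    Integrable (fun z => ((κ z).real A : ℂ)) ν := by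
  refine Integrable.of_bound (measurable_real_kernel κ hA).aestronglyMeasurable κ.bound.toReal
    (Eventually.of_forall fun z => ?_)
  rw [Complex.norm_real, Real.norm_of_nonneg measureReal_nonneg]
  exact ENNReal.toReal_mono κ.bound_ne_top (κ.measure_le_bound z A)

/-- Polarization over the fourth roots of unity. -/
theorem kernelForm_polarization (R : TraceClass H →L[ℂ] TraceClass H) (p q : H × H)
    (Q : ℂ → ℂ) (hQ : ∀ c, Q c = ∑ i ∈ Finset.range 2, ∑ j ∈ Finset.range 2,
      kernelForm R (if i = 0 then p else (c • q.1, q.2)) (if j = 0 then p else (c • q.1, q.2))) :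
    kernelForm R p q = 1 / 4 * (Q 1 - Q (-1) - Complex.I * Q Complex.I
      + Complex.I * Q (-Complex.I)) := by
  have h1 : ∀ c, Q c = kernelForm R p p + c * kernelForm R p q
      + starRingEnd ℂ c * kernelForm R q p + starRingEnd ℂ c * c * kernelForm R q q := fun c => by
    rw [hQ]
    simp only [Finset.sum_range_succ, Finset.sum_range_zero, zero_add, if_true, one_ne_zero,
      if_false, kernelForm_smul_fst_left, kernelForm_smul_fst_right]
    ring
  simp only [h1, map_one, map_neg, Complex.conj_I]
  ring_nf
  simp only [Complex.I_sq]
  ring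

/-- The partial sums of the trace are bounded by the trace norm. -/
theorem norm_sum_inner_le {e : ℕ → H} (he : IsParsevalSeq e) [CompleteSpace H] (N : ℕ)
    (σ : TraceClass H) :
    ‖∑ i ∈ Finset.range N, elemL (e i) (e i) σ‖ ≤ ‖σ‖ := by
  have h1 : ‖∑ i ∈ Finset.range N, elemL (e i) (e i)‖ ≤ 1 := by
    refine norm_clm_le _ zero_le_one fun x y => ?_
    rw [sum_apply, one_mul]
    have h2 : ∀ i, ‖elemL (e i) (e i) (ketbra x y)‖ =
        ‖(inner ℂ (e i) x : ℂ)‖ * ‖(inner ℂ (e i) y : ℂ)‖ := fun i => by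
      rw [elemL_apply, op_ketbra_apply, inner_smul_right, norm_mul, mul_comm, norm_inner_symm y]
    refine (norm_sum_le _ _).trans ?_
    simp only [h2]
    refine abs_le_of_sq_le_sq' ?_ (by positivity) |>.2
    refine (Finset.sum_mul_sq_le_sq_mul_sq _ _ _).trans ?_
    rw [mul_pow]
    exact mul_le_mul (he.sum_norm_sq_le _ x) (he.sum_norm_sq_le _ y) (by positivity) (by positivity)
  rw [← sum_apply]
  exact (ContinuousLinearMap.le_of_opNorm_le _ h1 σ).trans_eq (one_mul _)

variable [StandardBorelSpace Z] [CompleteSpace H]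

/-- A map with completely positive blocks has a Choi kernel: its entries are obtained by polarization
from the kernels of the families of two vectors. -/
theorem exists_choiKernel (ω : Weight μ) {Φ : HybridSpace H μ →L[ℂ] HybridSpace H μ}
    (hΦ : ∀ A B, MeasurableSet A → MeasurableSet B → IsCP (block ω Φ A B))
    {e : ℕ → H} (he : IsParsevalSeq e) : ∃ W, IsChoiKernel ω Φ e ‖Φ‖ W := by
  classical
  choose κ hfin hint using fun s p => exists_family_kernel ω hΦ s p
  set E := unitVectors e with hE
  -- the kernels `G` of the two-vector families, and their polarization `m`
  let P : ℕ → ℕ → ℂ → ℕ → H × H := fun a b c i => if i = 0 then E a else (c • (E b).1, (E b).2)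
  let G : ℕ → ℕ → ℂ → Z → VectorMeasure Z ℂ := fun a b c z =>
    complexMeasure (κ (Finset.range 2) (P a b c) z)
  let m : ℕ → ℕ → Z → VectorMeasure Z ℂ := fun a b z =>
    (1 / 4 : ℂ) • (G a b 1 z - G a b (-1) z - Complex.I • G a b Complex.I z
      + Complex.I • G a b (-Complex.I) z)
  have hm : ∀ a b z A, m a b z A = 1 / 4 * (G a b 1 z A - G a b (-1) z A -
      Complex.I * G a b Complex.I z A + Complex.I * G a b (-Complex.I) z A) := fun a b z A => by
    simp [m]
    ring
  have hG : ∀ a b c z A, MeasurableSet A →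
      G a b c z A = ((κ (Finset.range 2) (P a b c) z).real A : ℂ) := fun a b c z A hA =>
    complexMeasure_apply _ hA
  have hmeas : ∀ a b A, MeasurableSet A → Measurable fun z => m a b z A := fun a b A hA => by
    simp only [hm, hG _ _ _ _ _ hA]
    have := fun c => measurable_real_kernel (κ (Finset.range 2) (P a b c)) hA
    fun_prop
  have hmeasd : ∀ a b, Measurable fun z => m a b z {z} := fun a b => by
    simp only [hm, hG _ _ _ _ _ (measurableSet_singleton _)]
    have := fun c => measurable_real_kernel_diag (κ (Finset.range 2) (P a b c))
    fun_prop
  have hGi : ∀ a b c A, MeasurableSet A → Integrable (fun z => G a b c z A) ω.measure :=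
    fun a b c A hA => by
      simp only [hG _ _ _ _ _ hA]
      exact integrable_real_kernel _ hA
  have hmi : ∀ a b A, MeasurableSet A → Integrable (fun z => m a b z A) ω.measure :=
    fun a b A hA => by
      simp only [hm]
      exact ((((hGi a b _ A hA).sub (hGi a b _ A hA)).sub ((hGi a b _ A hA).const_mul _)).add
        ((hGi a b _ A hA).const_mul _)).const_mul _
  have hint_m : ∀ A B, MeasurableSet A → MeasurableSet B → ∀ a b,
      kernelForm (block ω Φ A B) (E a) (E b) = ∫ z in B, m a b z A ∂ω.measure := by
    intro A B hA hB a b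
    have hr : ∀ c, Integrable (fun z => G a b c z A) (ω.measure.restrict B) :=
      fun c => (hGi a b c A hA).integrableOn
    rw [kernelForm_polarization _ _ _ (fun c => ∫ z in B, G a b c z A ∂ω.measure) fun c => by
      rw [← integral_congr_ae (Eventually.of_forall fun z => (hG a b c z A hA).symm)]
      exact (hint (Finset.range 2) (P a b c) A B hA hB).symm]
    simp only [hm]
    have i0 : Integrable (fun z => G a b 1 z A - G a b (-1) z A) (ω.measure.restrict B) :=
      (hr 1).sub (hr (-1))
    have i1 : Integrable (fun z => G a b 1 z A - G a b (-1) z A -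
        Complex.I * G a b Complex.I z A) (ω.measure.restrict B) := i0.sub ((hr _).const_mul _)
    rw [integral_const_mul, integral_add i1 ((hr _).const_mul _),
      integral_sub i0 ((hr _).const_mul _), integral_sub (hr 1) (hr (-1)), integral_const_mul,
      integral_const_mul]
  -- positivity, first for a fixed coefficient vector by comparison with its own kernel
  have hpos : ∀ᵐ z ∂ω.measure, ∀ s : Finset ℕ, ∀ v : ℕ → ℂ, ∀ A, MeasurableSet A →
      0 ≤ ∑ i ∈ s, ∑ j ∈ s, starRingEnd ℂ (v i) * v j * m i j z A := by
    refine ae_all_iff.2 fun s => ae_forall_of_isClosed (fun z => ?_) fun v => ?_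
    · simp only [Set.ofPred_forall]
      refine isClosed_iInter fun A => isClosed_iInter fun _ => ?_
      exact isClosed_le continuous_const (by fun_prop)
    · set p : ℕ → H × H := fun a => (v a • (E a).1, (E a).2) with hp
      set F : Z → VectorMeasure Z ℂ := fun z =>
        (∑ i ∈ s, ∑ j ∈ s, (starRingEnd ℂ (v i) * v j) • m i j z) - complexMeasure (κ s p z) with hF
      have hFA : ∀ z A, MeasurableSet A → F z A =
          (∑ i ∈ s, ∑ j ∈ s, starRingEnd ℂ (v i) * v j * m i j z A) - ((κ s p z).real A : ℂ) := by
        intro z A hA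
        have hsum : ∀ f : ℕ → VectorMeasure Z ℂ, (∑ i ∈ s, f i) A = ∑ i ∈ s, f i A := fun f =>
          map_sum (⟨⟨fun v => v A, rfl⟩, fun _ _ => rfl⟩ : VectorMeasure Z ℂ →+ ℂ) f s
        change (∑ i ∈ s, ∑ j ∈ s, (starRingEnd ℂ (v i) * v j) • m i j z) A
          - complexMeasure (κ s p z) A = _
        rw [hsum, complexMeasure_apply _ hA]
        simp only [hsum]
        rfl
      have hF0 : ∀ᵐ z ∂ω.measure, ∀ A, F z A = 0 := by
        refine ae_vectorMeasure_eq_zero fun A hA => ?_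
        have hi1 : Integrable (fun z => ∑ i ∈ s, ∑ j ∈ s,
            starRingEnd ℂ (v i) * v j * m i j z A) ω.measure :=
          integrable_finsetSum _ fun i _ => integrable_finsetSum _ fun j _ =>
            (hmi i j A hA).const_mul _
        have h1 := Integrable.ae_eq_of_forall_setIntegral_eq _ _ hi1
          (integrable_real_kernel (κ s p) (ν := ω.measure) hA) fun B hB _ => by
            rw [← hint s p A B hA hB, integral_finsetSum _ fun i _ => integrable_finsetSum _
              fun j _ => ((hmi i j A hA).const_mul _).integrableOn]
            refine Finset.sum_congr rfl fun i _ => ?_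
            rw [integral_finsetSum _ fun j _ => ((hmi i j A hA).const_mul _).integrableOn]
            refine Finset.sum_congr rfl fun j _ => ?_
            rw [integral_const_mul, ← hint_m A B hA hB, hp, kernelForm_smul_fst_left,
              kernelForm_smul_fst_right, mul_assoc]
        filter_upwards [h1] with z hz
        rw [hFA z A hA, hz, sub_self]
      filter_upwards [hF0] with z hz A hA
      have h2 := hz A
      rw [hFA z A hA, sub_eq_zero] at h2
      rw [h2]
      exact Complex.zero_le_real.2 measureReal_nonneg
  -- the bound for `A = univ` holds since the integrals over `B` are traces of `block ω Φ univ B`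
  have hbound : ∀ᵐ z ∂ω.measure, ∀ N, ∀ x : ℕ → ℂ, ∑ i ∈ Finset.range N,
      (∑ k ∈ Finset.range N, ∑ l ∈ Finset.range N,
        m (Nat.pair i k) (Nat.pair i l) z Set.univ * x k * starRingEnd ℂ (x l)).re ≤
      ‖Φ‖ * ∑ k ∈ Finset.range N, ‖x k‖ ^ 2 := by
    refine ae_all_iff.2 fun N => ae_forall_of_isClosed (fun z => ?_) fun x => ?_
    · refine isClosed_le (continuous_finsetSum _ fun i _ =>
        Complex.continuous_re.comp ?_) (by fun_prop)
      fun_prop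
    · have hi : ∀ i k l, Integrable (fun z => m (Nat.pair i k) (Nat.pair i l) z Set.univ * x k *
          starRingEnd ℂ (x l)) ω.measure := fun i k l =>
        ((hmi _ _ _ MeasurableSet.univ).mul_const _).mul_const _
      have hi2 : ∀ i, Integrable (fun z => ∑ k ∈ Finset.range N, ∑ l ∈ Finset.range N,
          m (Nat.pair i k) (Nat.pair i l) z Set.univ * x k * starRingEnd ℂ (x l)) ω.measure :=
        fun i => integrable_finsetSum _ fun k _ => integrable_finsetSum _ fun l _ => hi i k l
      have hi3 : ∀ i, Integrable (fun z => (∑ k ∈ Finset.range N, ∑ l ∈ Finset.range N,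
          m (Nat.pair i k) (Nat.pair i l) z Set.univ * x k * starRingEnd ℂ (x l)).re) ω.measure :=
        fun i => (hi2 i).re
      have h1 : 0 ≤ᵐ[ω.measure] fun z => ‖Φ‖ * ∑ k ∈ Finset.range N, ‖x k‖ ^ 2 -
          ∑ i ∈ Finset.range N, (∑ k ∈ Finset.range N, ∑ l ∈ Finset.range N,
            m (Nat.pair i k) (Nat.pair i l) z Set.univ * x k * starRingEnd ℂ (x l)).re := by
        refine ae_nonneg_of_forall_setIntegral_nonneg ((integrable_const _).sub
          (integrable_finsetSum _ fun i _ => hi3 i)) fun B hB _ => ?_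
        set f : H := ∑ k ∈ Finset.range N, x k • e k with hf
        have h2 : ∀ i, ∫ z in B, (∑ k ∈ Finset.range N, ∑ l ∈ Finset.range N,
            m (Nat.pair i k) (Nat.pair i l) z Set.univ * x k * starRingEnd ℂ (x l)).re ∂ω.measure =
            (elemL (e i) (e i) (block ω Φ Set.univ B (ketbra f f))).re := by
          intro i
          have h3 : ∫ z in B, (∑ k ∈ Finset.range N, ∑ l ∈ Finset.range N,
              m (Nat.pair i k) (Nat.pair i l) z Set.univ * x k * starRingEnd ℂ (x l)) ∂ω.measure =
              elemL (e i) (e i) (block ω Φ Set.univ B (ketbra f f)) := by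
            have h4 : ketbra f f = ∑ k ∈ Finset.range N, ∑ l ∈ Finset.range N,
                (x k * starRingEnd ℂ (x l)) • ketbra (e k) (e l) := by
              refine ext' ?_
              simp only [op_fsum, op_smul, op_ketbra, hf, map_sum, sum_apply, map_smulₛₗ,
                smul_apply, RingHom.id_apply, Finset.smul_sum, smul_smul]
              rw [Finset.sum_comm]
              refine Finset.sum_congr rfl fun k _ => Finset.sum_congr rfl fun l _ => ?_
              rw [mul_comm]
            rw [h4]
            simp only [map_sum, map_smul, smul_eq_mul]
            rw [integral_finsetSum _ fun k _ => integrable_finsetSum _ fun l _ =>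
              (hi i k l).integrableOn]
            refine Finset.sum_congr rfl fun k _ => ?_
            rw [integral_finsetSum _ fun l _ => (hi i k l).integrableOn]
            refine Finset.sum_congr rfl fun l _ => ?_
            have h5 := hint_m Set.univ B MeasurableSet.univ hB (Nat.pair i k) (Nat.pair i l)
            simp only [hE, unitVectors, Nat.unpair_pair] at h5
            rw [integral_mul_const, integral_mul_const, ← h5, kernelForm]
            ring
          rw [← h3]
          exact integral_re (hi2 i).integrableOn
        rw [integral_sub (integrable_const _)
          (integrable_finsetSum _ fun i _ => hi3 i).integrableOn,
          integral_finsetSum _ fun i _ => (hi3 i).integrableOn, setIntegral_const, smul_eq_mul,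
          sub_nonneg]
        simp only [h2]
        rw [← Complex.re_sum]
        refine (Complex.re_le_norm _).trans ((norm_sum_inner_le he N _).trans ?_)
        refine (ContinuousLinearMap.le_of_opNorm_le _ (norm_block_le ω Φ Set.univ B) _).trans ?_
        have h6 : ‖ketbra f f‖ ≤ ∑ k ∈ Finset.range N, ‖x k‖ ^ 2 := by
          refine (norm_ketbra_le f f).trans ?_
          rw [← sq]
          exact he.norm_sum_smul_sq_le _ _
        calc _ ≤ ‖Φ‖ * ω.measure.real B * ∑ k ∈ Finset.range N, ‖x k‖ ^ 2 := by gcongr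
          _ = _ := by ring
      filter_upwards [h1] with z hz using sub_nonneg.1 hz
  -- on the exceptional null set `t` the kernel is put equal to zero
  obtain ⟨t, ht, htm, hnull⟩ := exists_measurable_superset_of_null (ae_iff.1 (hpos.and hbound))
  have hgood : ∀ z, z ∉ t → _ := fun z hz => not_not.1 fun hcon => hz (ht hcon)
  refine ⟨fun z => if z ∈ t then 0 else matrixMeasure (bordered fun a b => m a b z),
    fun z A hA => ?_, fun A α β hA => ?_, fun α β => ?_, fun A B hA hB a b => ?_⟩
  · by_cases hz : z ∈ t
    · simp only [if_pos hz]
      refine ⟨Matrix.PosSemidef.zero, fun α => rfl, fun N x => ?_⟩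
      simp
      positivity
    · simp only [if_neg hz]
      obtain ⟨h1, h2⟩ := hgood z hz
      have hbA : ∀ A α β, (matrixMeasure (bordered fun a b => m a b z) A) α β =
          bordered (fun a b => m a b z A) α β := by
        rintro A (_ | α) (_ | β) <;> rfl
      have hps : ∀ A, MeasurableSet A →
          Matrix.PosSemidef (matrixMeasure (bordered fun a b => m a b z) A) := fun A hA => by
        have h3 : matrixMeasure (bordered fun a b => m a b z) A =
            Matrix.of (bordered fun a b => m a b z A) := by
          ext α β; exact hbA A α β
        rw [h3]
        exact posSemidef_bordered fun s v => h1 s v A hA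
      refine ⟨hps A hA, fun α => hbA A 0 α, fun N x => ?_⟩
      -- the bound passes from `univ` to `A` by positivity on the complement of `A`
      refine le_trans (Finset.sum_le_sum fun i _ => ?_) (h2 N x)
      have h4 := (Complex.nonneg_iff.1 ((hps Aᶜ hA.compl).sum_nonneg N
        (fun k => Nat.pair i k + 1) fun k => starRingEnd ℂ (x k))).1
      simp only [hbA, bordered, VectorMeasure.of_compl hA] at h4 ⊢
      rw [← sub_nonneg, ← Complex.sub_re]
      refine h4.trans_eq ?_
      congr 1
      rw [← Finset.sum_sub_distrib]
      refine Finset.sum_congr rfl fun k _ => ?_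
      rw [← Finset.sum_sub_distrib]
      refine Finset.sum_congr rfl fun l _ => ?_
      rw [Complex.conj_conj]
      ring
  · have h1 : (fun z => (if z ∈ t then 0 else matrixMeasure (bordered fun a b => m a b z) :
        VectorMeasure Z (Matrix ℕ ℕ ℂ)) A α β) =
        fun z => if z ∈ t then 0 else bordered (fun a b => fun z => m a b z A) α β z := by
      ext z
      split_ifs
      · rfl
      · rcases α with _ | α <;> rcases β with _ | β <;> rfl
    rw [h1]
    refine Measurable.ite htm measurable_const ?_
    rcases α with _ | α <;> rcases β with _ | β
    · exact measurable_const
    · exact measurable_const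
    · exact measurable_const
    · exact hmeas α β A hA
  · have h1 : (fun z => (if z ∈ t then 0 else matrixMeasure (bordered fun a b => m a b z) :
        VectorMeasure Z (Matrix ℕ ℕ ℂ)) {z} α β) =
        fun z => if z ∈ t then 0 else bordered (fun a b => fun z => m a b z {z}) α β z := by
      ext z
      split_ifs
      · rfl
      · rcases α with _ | α <;> rcases β with _ | β <;> rfl
    rw [h1]
    refine Measurable.ite htm measurable_const ?_
    rcases α with _ | α <;> rcases β with _ | β
    · exact measurable_const
    · exact measurable_const
    · exact measurable_const
    · exact hmeasd α β
  · rw [hint_m A B hA hB a b]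
    refine integral_congr_ae (ae_restrict_of_ae ?_)
    filter_upwards [measure_eq_zero_iff_ae_notMem.1 hnull] with z hz
    rw [if_neg hz]
    rfl

end ChoiKernel

/-! ### Kernels of matrices acting on hybrid states -/

section MatrixKernel

open TraceClass

variable {Z H : Type*} [MeasurableSpace Z] [NormedAddCommGroup H] [InnerProductSpace ℂ H]
  {μ : Measure Z}

/-- The elements `w 1_B ⊗ σ` are total in the hybrid space. -/
theorem hybrid_clm_ext (ω : Weight μ) {F : Type*} [NormedAddCommGroup F] [NormedSpace ℂ F]
    {R R' : HybridSpace H μ →L[ℂ] F}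
    (h : ∀ B σ, MeasurableSet B → R (ω.tensL H B σ) = R' (ω.tensL H B σ)) : R = R' := by
  let U : Lp (TraceClass H) 1 ω.measure →ₗᵢ[ℝ] Lp (TraceClass H) 1 μ :=
    withDensitySMulLI (E := TraceClass H) μ ω.measurable
  have hU : ∀ φ, U φ =ᵐ[μ] fun z => ω.w z • φ z := fun φ =>
    (memL1_smul_of_L1_withDensity ω.measurable φ).coeFn_toLp
  have h1 : ∀ φ, R (U φ) = R' (U φ) := by
    intro φ
    induction φ using Lp.induction ENNReal.one_ne_top with
    | @indicatorConst c s hs hμs =>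
      have h2 : U (Lp.simpleFunc.indicatorConst 1 hs hμs.ne c) = ω.tensL H s c := by
        refine Lp.ext ?_
        have h3 := ω.ae_measure_iff.1 (indicatorConstLp_coeFn (p := 1) (hs := hs) (hμs := hμs.ne) (c := c))
        filter_upwards [hU (Lp.simpleFunc.indicatorConst 1 hs hμs.ne c), h3, ω.coe_tensL hs c]
          with z h4 h5 h6
        rw [h4, h6, Lp.simpleFunc.coe_indicatorConst, h5]
        by_cases hz : z ∈ s
        · rw [Set.indicator_of_mem hz, Set.indicator_of_mem hz]
        · rw [Set.indicator_of_notMem hz, Set.indicator_of_notMem hz, smul_zero]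
      rw [h2, h _ _ hs]
    | add hf hg _ h2 h3 => rw [map_add, map_add, map_add, h2, h3]
    | isClosed => exact isClosed_eq (R.continuous.comp U.continuous) (R'.continuous.comp U.continuous)
  ext1 ψ
  have hi : Integrable (fun z => (ω.w z)⁻¹ • ψ z) ω.measure := by
    refine ω.integrable_iff.2 ((L1.integrable_coeFn ψ).congr (Eventually.of_forall fun z => ?_))
    simp only [smul_smul, mul_inv_cancel₀ (ω.pos z).ne', one_smul]
  have h2 : U (hi.toL1 _) = ψ := by
    refine Lp.ext ?_
    filter_upwards [hU (hi.toL1 _), ω.ae_measure_iff.1 hi.coeFn_toL1] with z h3 h4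
    rw [h3, h4, smul_smul, mul_inv_cancel₀ (ω.pos z).ne', one_smul]
  rw [← h2, h1]

variable [CompleteSpace H]

theorem ketbra_partialSum (e : ℕ → H) (n : ℕ) (x y : H) :
    ketbra (partialSum e n x) (partialSum e n y) =
      ∑ k ∈ Finset.range n, ∑ l ∈ Finset.range n,
        ((inner ℂ (e k) x : ℂ) * starRingEnd ℂ (inner ℂ (e l) y)) • ketbra (e k) (e l) := by
  refine ext' ?_
  simp only [op_fsum, op_smul, op_ketbra, partialSum, map_sum, sum_apply, map_smulₛₗ,
    smul_apply, RingHom.id_apply, Finset.smul_sum, smul_smul]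
  rw [Finset.sum_comm]
  refine Finset.sum_congr rfl fun k _ => Finset.sum_congr rfl fun l _ => ?_
  rw [mul_comm]

theorem IsParsevalSeq.traceClass_clm_ext {e : ℕ → H} (he : IsParsevalSeq e)
    {R R' : TraceClass H →L[ℂ] TraceClass H} (h : ∀ i k j l,
      elemL (e i) (e j) (R (ketbra (e k) (e l))) = elemL (e i) (e j) (R' (ketbra (e k) (e l)))) :
    R = R' := by
  refine clm_ext fun x y => ?_
  have h1 : ∀ k l, R (ketbra (e k) (e l)) = R' (ketbra (e k) (e l)) := fun k l =>
    ext' (he.ext_op fun i j => h i k j l)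
  have h3 := tendsto_ketbra (he.tendsto_partialSum x) (he.tendsto_partialSum y)
  refine tendsto_nhds_unique ((R.continuous.tendsto _).comp h3) ?_
  refine ((R'.continuous.tendsto _).comp h3).congr fun n => ?_
  simp only [Function.comp_apply, ketbra_partialSum, map_sum, map_smul, h1]

/-- The field of maps with the matrices `w z` is bounded and measurable. -/
theorem isBoundedField_of_hasMatrixSum {L : ℕ → H →L[ℂ] H} {w : Z → Matrix ℕ ℕ ℂ} {C : ℝ}
    (hC : 0 ≤ C) {T : Z → TraceClass H →L[ℂ] TraceClass H} {M : Z → H →L[ℂ] H}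
    (hw : ∀ α β, Measurable fun z => w z α β) (h : ∀ z, HasMatrixSum L (w z) C (T z) (M z)) :
    IsBoundedField T C := by
  refine ⟨fun σ => ?_, fun z => ?_⟩
  · refine stronglyMeasurable_of_tendsto atTop (f := fun n z => ∑ α ∈ Finset.range n,
      ∑ β ∈ Finset.range n, w z α β • sandwich (L α) σ (star (L β))) (fun n => ?_)
      (tendsto_pi_nhds.2 fun z => (h z).jump σ)
    exact Finset.stronglyMeasurable_fun_sum _ fun α _ => Finset.stronglyMeasurable_fun_sum _
      fun β _ => (hw α β).stronglyMeasurable.smul_const _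
  · exact ContinuousLinearMap.opNorm_le_bound _ hC fun σ =>
      le_of_tendsto ((h z).jump σ).norm (Eventually.of_forall fun n => (h z).bound n σ)

/-- The jump map is determined by the matrix, additively. -/
theorem HasMatrixSum.jump_add {L : ℕ → H →L[ℂ] H} {w w' w'' : Matrix ℕ ℕ ℂ} {C C' C'' : ℝ}
    {T T' T'' : TraceClass H →L[ℂ] TraceClass H} {M M' M'' : H →L[ℂ] H}
    (h : HasMatrixSum L w C T M) (h' : HasMatrixSum L w' C' T' M')
    (h'' : HasMatrixSum L w'' C'' T'' M'') (hw : w'' = w + w') : T'' = T + T' := by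
  ext1 σ
  refine tendsto_nhds_unique (h''.jump σ) ?_
  have h1 := Tendsto.add (h.jump σ) (h'.jump σ)
  refine h1.congr fun n => ?_
  simp only [← Finset.sum_add_distrib, hw, Matrix.add_apply, add_smul]

/-- A measurable kernel of positive semidefinite matrices `W z A`, with the jump maps `T z A` and
the operators `M z A = ∑ W z A α β • L_β† L_α` that it defines. -/
structure IsMatrixKernel (L : ℕ → H →L[ℂ] H) (B C : ℝ)
    (W : Z → VectorMeasure Z (Matrix ℕ ℕ ℂ))
    (T : Z → Set Z → TraceClass H →L[ℂ] TraceClass H) (M : Z → Set Z → H →L[ℂ] H) : Prop where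
  posSemidef : ∀ z A, MeasurableSet A → (W z A).PosSemidef
  measurable : ∀ A α β, MeasurableSet A → Measurable fun z => W z A α β
  measurable_diag : ∀ α β, Measurable fun z => W z {z} α β
  norm_le : ∀ z A α β, MeasurableSet A → ‖W z A α β‖ ≤ B
  nonneg : 0 ≤ C
  hasMatrixSum : ∀ z A, MeasurableSet A → HasMatrixSum L (W z A) C (T z A) (M z A)

/-- The map `Φ` on the hybrid space has the jump maps `T`: the part of `ψ` at `z` is moved into the
set `A` by `T z A`. -/
def HasJumpMaps (Φ : HybridSpace H μ →L[ℂ] HybridSpace H μ)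
    (T : Z → Set Z → TraceClass H →L[ℂ] TraceClass H) : Prop :=
  ∀ A, MeasurableSet A → ∀ ψ, ∫ z in A, Φ ψ z ∂μ = ∫ z, T z A (ψ z) ∂μ

namespace IsMatrixKernel

variable {L : ℕ → H →L[ℂ] H} {B C : ℝ} {W : Z → VectorMeasure Z (Matrix ℕ ℕ ℂ)}
    {T : Z → Set Z → TraceClass H →L[ℂ] TraceClass H} {M : Z → Set Z → H →L[ℂ] H}

theorem isBoundedField (h : IsMatrixKernel L B C W T M) {A : Set Z} (hA : MeasurableSet A) :
    IsBoundedField (fun z => T z A) C :=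
  isBoundedField_of_hasMatrixSum h.nonneg (fun α β => h.measurable A α β hA)
    fun z => h.hasMatrixSum z A hA

variable [MeasurableSingletonClass Z]

theorem isBoundedField_diag (h : IsMatrixKernel L B C W T M) :
    IsBoundedField (fun z => T z {z}) C :=
  isBoundedField_of_hasMatrixSum h.nonneg h.measurable_diag
    fun z => h.hasMatrixSum z _ (measurableSet_singleton z)

/-- The jump map splits into its part off the diagonal and its part at the diagonal. -/
theorem jump_eq (h : IsMatrixKernel L B C W T M) (z : Z) {A : Set Z} (hA : MeasurableSet A)
    (σ : TraceClass H) :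
    T z A σ = T z (A ∩ {z}ᶜ) σ + A.indicator (fun z => T z {z} σ) z := by
  have hs := measurableSet_singleton z
  by_cases hz : z ∈ A
  · rw [Set.indicator_of_mem hz, ← add_apply]
    congr 1
    refine (h.hasMatrixSum z _ (hA.inter hs.compl)).jump_add (h.hasMatrixSum z _ hs)
      (h.hasMatrixSum z _ hA) ?_
    rw [← VectorMeasure.of_union _ (hA.inter hs.compl) hs]
    · congr 1
      ext y
      by_cases hy : y = z <;> simp [hy, hz]
    · exact Set.disjoint_left.2 fun y hy hy' => hy.2 hy'
  · rw [Set.indicator_of_notMem hz, add_zero]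
    congr 2
    ext y
    constructor
    · exact fun hy => ⟨hy, fun hy' => hz (hy' ▸ hy)⟩
    · exact fun hy => hy.1

end IsMatrixKernel

end MatrixKernel

/-! ### The master equation from a kernel of matrices -/

section MasterEquation

open TraceClass

variable {Z H : Type*} [MeasurableSpace Z] [NormedAddCommGroup H] [InnerProductSpace ℂ H]
  [CompleteSpace H] {μ : Measure Z}

/-- The map `T` is, up to a drift `G`, the jump map `T'` with a positive semidefinite matrix `w'` that
does not involve the index `0`. -/
structure IsReducedJump (L : ℕ → H →L[ℂ] H) (w' : Matrix ℕ ℕ ℂ) (C : ℝ)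
    (T T' : TraceClass H →L[ℂ] TraceClass H) (M' G : H →L[ℂ] H) : Prop where
  posSemidef : w'.PosSemidef
  zero : ∀ α, w' 0 α = 0 ∧ w' α 0 = 0
  hasMatrixSum : HasMatrixSum L w' C T' M'
  eq : T = T' + driftL G

theorem HasMatrixSum.lindblad {L : ℕ → H →L[ℂ] H} {w : Matrix ℕ ℕ ℂ} {C : ℝ}
    {T : TraceClass H →L[ℂ] TraceClass H} {M : H →L[ℂ] H} (h : HasMatrixSum L w C T M)
    (σ : TraceClass H) :
    HasDoubleSum (fun α β => w α β • (σ.sandwich (L α) (star (L β))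
      - (1 / 2 : ℂ) • σ.anticomm (star (L β) * L α))) (T σ - (1 / 2 : ℂ) • anticomm M σ) := by
  refine ((h.jump σ).sub ((h.anti σ).const_smul (1 / 2 : ℂ))).congr fun n => ?_
  simp only [Finset.smul_sum, ← Finset.sum_sub_distrib, smul_sub, smul_comm (1 / 2 : ℂ)]

theorem HasMatrixSum.half_anti {L : ℕ → H →L[ℂ] H} {w : Matrix ℕ ℕ ℂ} {C : ℝ}
    {T : TraceClass H →L[ℂ] TraceClass H} {M : H →L[ℂ] H} (h : HasMatrixSum L w C T M)
    (σ : TraceClass H) :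
    HasDoubleSum (fun α β => (1 / 2 * w α β : ℂ) • σ.anticomm (star (L β) * L α))
      ((1 / 2 : ℂ) • anticomm M σ) := by
  refine ((h.anti σ).const_smul (1 / 2 : ℂ)).congr fun n => ?_
  simp only [Finset.smul_sum, mul_smul]

theorem trace_driftL (K : H →L[ℂ] H) (σ : TraceClass H) :
    (driftL K σ).trace = (sandwich (K + star K) σ 1).trace := by
  rw [driftL_apply, ← sandwichL_apply (K + star K), sandwichL_add_left]
  change traceL H _ = traceL H (sandwich K σ 1 + sandwich (star K) σ 1)
  rw [map_add, map_add, traceL_apply, traceL_apply, traceL_apply, trace_sandwich 1 (star K),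
    mul_one]

/-- The drift splits into a commutator and an anticommutator; trace preservation identifies the
latter. -/
theorem driftL_eq {K M : H →L[ℂ] H} (h : K + star K = -M) (σ : TraceClass H) :
    driftL K σ = -Complex.I • TraceClass.comm ((Complex.I / 2) • (K - star K)) σ
      - (1 / 2 : ℂ) • anticomm M σ := by
  have hM : M = -(K + star K) := by rw [h, neg_neg]
  refine ext' (ContinuousLinearMap.ext fun x => ?_)
  have hI : Complex.I * (Complex.I / 2) = -(1 / 2) := by
    rw [mul_div_assoc', Complex.I_mul_I]; ring
  simp only [hM, driftL_apply, TraceClass.comm, anticomm, op_add, op_sub, op_smul, op_sandwich,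
    add_apply, sub_apply, smul_apply, neg_apply, ContinuousLinearMap.comp_apply,
    one_apply_eq_self, map_smul, map_sub, map_add, map_neg]
  linear_combination (norm := module) hI • (K (σ.op x) - star K (σ.op x) - σ.op (K x) + σ.op (star K x))

theorem isSelfAdjoint_ham (K : H →L[ℂ] H) : IsSelfAdjoint ((Complex.I / 2) • (K - star K)) := by
  rw [isSelfAdjoint_iff, star_smul, star_sub, star_star, ← neg_sub K, smul_neg, ← neg_smul]
  congr 1
  simp [neg_div]

theorem measurable_inner_star {K : Z → H →L[ℂ] H}
    (h : ∀ x y, Measurable fun z => (inner ℂ x (K z y) : ℂ)) (x y : H) :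
    Measurable fun z => (inner ℂ x (star (K z) y) : ℂ) := by
  have h1 : ∀ z, (inner ℂ x (star (K z) y) : ℂ) = starRingEnd ℂ (inner ℂ y (K z x)) := fun z => by
    rw [ContinuousLinearMap.star_eq_adjoint, ContinuousLinearMap.adjoint_inner_right,
      inner_conj_symm]
  simp only [h1]
  exact Complex.continuous_conj.measurable.comp (h y x)

variable [TopologicalSpace.SeparableSpace H]

/-- A field of maps that annihilates the total trace annihilates the trace at almost every point. -/
theorem ae_trace_eq_zero (ω : Weight μ) {U : Z → TraceClass H →L[ℂ] TraceClass H} {C : ℝ}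
    (hU : IsBoundedField U C) (h : ∀ ψ : HybridSpace H μ, ∫ z, (U z (ψ z)).trace ∂μ = 0) :
    ∀ᵐ z ∂μ, ∀ σ, (U z σ).trace = 0 := by
  obtain ⟨e, he⟩ := exists_isParsevalSeq (H := H)
  have h1 : ∀ σ, ∀ᵐ z ∂ω.measure, (U z σ).trace = 0 := fun σ => by
    have hi : Integrable (fun z => traceL H (U z σ)) ω.measure :=
      (traceL H).integrable_comp (hU.integrable (integrable_const σ))
    refine hi.ae_eq_zero_of_forall_setIntegral_eq_zero fun B hB _ => ?_
    rw [ω.setIntegral_eq _ hB, ← integral_indicator hB, ← h (ω.tensL H B σ)]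
    refine integral_congr_ae ?_
    filter_upwards [ω.coe_tensL hB σ] with z hz
    rw [hz]
    by_cases hz : z ∈ B
    · rw [Set.indicator_of_mem hz, Set.indicator_of_mem hz, NNReal.smul_def, NNReal.smul_def,
        ← Complex.coe_smul, ← Complex.coe_smul, map_smul, ← traceL_apply, map_smul]
    · rw [Set.indicator_of_notMem hz, Set.indicator_of_notMem hz, map_zero, ← traceL_apply,
        map_zero]
  have h2 : ∀ᵐ z ∂μ, ∀ k l, (U z (ketbra (e k) (e l))).trace = 0 :=
    ω.ae_measure_iff.1 (ae_all_iff.2 fun k => ae_all_iff.2 fun l => h1 _)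
  filter_upwards [h2] with z hz
  suffices h3 : (traceL H).comp (U z) = 0 from fun σ => DFunLike.congr_fun h3 σ
  refine clm_ext fun x y => ?_
  have h3 := ((traceL H).comp (U z)).continuous.tendsto _ |>.comp
    (tendsto_ketbra (he.tendsto_partialSum x) (he.tendsto_partialSum y))
  refine tendsto_nhds_unique h3 (tendsto_const_nhds.congr fun n => ?_)
  simp only [Function.comp_apply, ketbra_partialSum, map_sum, map_smul,
    ContinuousLinearMap.comp_apply, traceL_apply, hz, smul_zero, Finset.sum_const_zero, zero_apply]

/-- A trace-annihilating sum of a map `Φ` with jump maps `T` and of a drift `K` has the form of a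
master equation. The mass of the kernel at `z = z'` gives the pure Lindblad term, after reduction to
the indices `α, β ≠ 0` at the expense of an additional drift `G`, and the kernel restricted to
`z ≠ z'` gives the jump rates. -/
theorem exists_isMasterEquation [MeasurableSingletonClass Z] (ω : Weight μ) {L : ℕ → H →L[ℂ] H}
    {S Φ : HybridSpace H μ →L[ℂ] HybridSpace H μ} {K : Z → H →L[ℂ] H} {CK : ℝ}
    (hK : ∀ x y, Measurable fun z => (inner ℂ x (K z y) : ℂ)) (hKC : ∀ z, ‖K z‖ ≤ CK)
    (hS : ∀ ψ, S ψ =ᵐ[μ] fun z => Φ ψ z + driftL (K z) (ψ z))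
    (htr : ∀ ψ, ∫ z, (S ψ z).trace ∂μ = 0)
    {B C C' CG : ℝ} {W : Z → VectorMeasure Z (Matrix ℕ ℕ ℂ)}
    {T : Z → Set Z → TraceClass H →L[ℂ] TraceClass H} {M : Z → Set Z → H →L[ℂ] H}
    (hW : IsMatrixKernel L B C W T M) (hT : HasJumpMaps Φ T)
    {lam : Z → Matrix ℕ ℕ ℂ} (hlam : ∀ α β, Measurable fun z => lam z α β)
    {T' : Z → TraceClass H →L[ℂ] TraceClass H} {M' G : Z → H →L[ℂ] H}
    (hG : ∀ x y, Measurable fun z => (inner ℂ x (G z y) : ℂ)) (hGC : ∀ z, ‖G z‖ ≤ CG)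
    (hred : ∀ z, IsReducedJump L (lam z) C' (T z {z}) (T' z) (M' z) (G z)) :
    ∃ c : CQCoefficients Z H, c.IsMasterEquation L S := by
  have hs : ∀ z : Z, MeasurableSet {z}ᶜ := fun z => (measurableSet_singleton z).compl
  have hKb := isBoundedField_driftL hK hKC
  have hWapp : ∀ z A, MeasurableSet A → (W z).restrict {z}ᶜ A = W z (A ∩ {z}ᶜ) := fun z A hA =>
    VectorMeasure.restrict_apply _ (hs z) hA
  have hsplit : ∀ z A, MeasurableSet A → ∀ α β, W z (A ∩ {z}ᶜ) α β =
      W z A α β - A.indicator (fun z => W z {z} α β) z := fun z A hA α β => by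
    classical
    by_cases hz : z ∈ A
    · have h1 : A ∩ {z}ᶜ = A \ {z} := rfl
      rw [h1, VectorMeasure.of_sdiff (measurableSet_singleton z) hA (by simpa using hz),
        Set.indicator_of_mem hz, Matrix.sub_apply]
    · rw [Set.indicator_of_notMem hz, sub_zero]
      refine congrArg (fun D => W z D α β) (Set.ext fun y => ?_)
      exact ⟨fun h => h.1, fun hy => ⟨hy, fun hy' => hz (hy' ▸ hy)⟩⟩
  have hWmeas : ∀ A α β, MeasurableSet A → Measurable fun z => W z (A ∩ {z}ᶜ) α β :=
    fun A α β hA => by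
      simp only [hsplit _ A hA]
      exact (hW.measurable A α β hA).sub ((hW.measurable_diag α β).indicator hA)
  let c : CQCoefficients Z H :=
    { ham := fun z => (Complex.I / 2) • ((K z + G z) - star (K z + G z))
      lam := lam
      W := fun z => (W z).restrict {z}ᶜ
      ham_selfAdjoint := fun z => isSelfAdjoint_ham _
      ham_bounded := ⟨CK + CG, fun z => by
        have h1 : ‖K z + G z‖ ≤ CK + CG := (norm_add_le _ _).trans (add_le_add (hKC z) (hGC z))
        have h2 := norm_sub_le (K z + G z) (star (K z + G z))
        rw [norm_star] at h2
        rw [norm_smul, norm_div, Complex.norm_I, Complex.norm_two]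
        linarith⟩
      ham_measurable := fun x y => by
        have h1 : ∀ x y, Measurable fun z => (inner ℂ x ((K z + G z) y) : ℂ) := fun x y => by
          simp only [add_apply, inner_add_right]
          exact (hK x y).add (hG x y)
        simp only [smul_apply, sub_apply, inner_smul_right, inner_sub_right]
        exact ((h1 x y).sub (measurable_inner_star h1 x y)).const_mul _
      lam_posSemidef := fun z => (hred z).posSemidef
      lam_measurable := hlam
      lam_zero := fun z => (hred z).zero
      W_posSemidef := fun z A hA => by
        rw [hWapp z A hA]
        exact hW.posSemidef z _ (hA.inter (hs z))
      W_measurable := fun A α β hA => by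
        simp only [hWapp _ A hA]
        exact hWmeas A α β hA
      W_diag := fun z => by
        rw [hWapp z _ (measurableSet_singleton z), Set.inter_compl_self, VectorMeasure.empty] }
  -- tested on all `ψ`, the vanishing of `∫ tr Sψ` becomes a pointwise identity for the traces
  have htr' : ∀ᵐ z ∂μ, ∀ σ, ((T z Set.univ + driftL (K z)) σ).trace = 0 := by
    refine ae_trace_eq_zero ω (C := C + 2 * CK)
      ⟨fun σ => ((hW.isBoundedField MeasurableSet.univ).stronglyMeasurable σ).add
        (hKb.stronglyMeasurable σ), fun z => (norm_add_le _ _).trans (add_le_add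
        ((hW.isBoundedField MeasurableSet.univ).bound z) (hKb.bound z))⟩ fun ψ => ?_
    have hψ := L1.integrable_coeFn ψ
    have i1 := (hW.isBoundedField MeasurableSet.univ).integrable hψ
    have i2 := hKb.integrable hψ
    have h1 : ∫ z, S ψ z ∂μ = ∫ z, (T z Set.univ + driftL (K z)) (ψ z) ∂μ := by
      have h2 := hT Set.univ MeasurableSet.univ ψ
      rw [setIntegral_univ] at h2
      rw [integral_congr_ae (hS ψ), integral_add (L1.integrable_coeFn _) i2, h2,
        ← integral_add i1 i2]
      rfl
    have h3 := (traceL H).integral_comp_comm (L1.integrable_coeFn (S ψ))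
    have h4 := (traceL H).integral_comp_comm (i1.add i2)
    exact h4.trans ((congrArg (traceL H) h1).symm.trans (h3.symm.trans (htr ψ)))
  -- and this determines the hermitian part of the total drift
  have hKM : ∀ᵐ z ∂μ, (K z + G z) + star (K z + G z) =
      -(M' z + M z (Set.univ ∩ {z}ᶜ)) := by
    filter_upwards [htr'] with z hz
    rw [eq_neg_iff_add_eq_zero]
    refine eq_of_trace_sandwich_eq fun σ => ?_
    have h1 := hz σ
    have h2 := (hW.hasMatrixSum z _ (MeasurableSet.univ.inter (hs z))).trace σ
    have h3 := (hred z).hasMatrixSum.trace σ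
    have h4 := trace_driftL (K z + G z) σ
    rw [add_apply, hW.jump_eq z MeasurableSet.univ, Set.indicator_of_mem (Set.mem_univ z),
      (hred z).eq] at h1
    have h5 : driftL (K z + G z) σ = driftL (K z) σ + driftL (G z) σ := by
      rw [driftL, driftL, driftL, star_add, sandwichL_add_left, sandwichL_add_right]
      simp only [add_apply]
      abel
    rw [h5] at h4
    rw [← sandwichL_apply, ← sandwichL_apply, sandwichL_zero_left,
      sandwichL_add_left (K z + G z + star (K z + G z)), sandwichL_add_left (M' z)]
    simp only [← traceL_apply, add_apply, map_add, map_zero, sandwichL_apply, zero_apply]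
      at h1 h2 h3 h4 ⊢
    rw [← h4, ← h3, ← h2, ← h1]
    abel
  -- the jump term is `J z = Φ ψ z - T z {z} (ψ z)`
  refine ⟨c, fun ψ => ⟨Φ ψ - fieldL μ hW.isBoundedField_diag ψ, fun A hA => ?_, ?_⟩⟩
  · have hψ := L1.integrable_coeFn ψ
    have hA' : ∀ z, MeasurableSet (A ∩ {z}ᶜ) := fun z => hA.inter (hs z)
    have hfield : IsBoundedField (fun z => T z (A ∩ {z}ᶜ)) C :=
      isBoundedField_of_hasMatrixSum hW.nonneg (fun α β => hWmeas A α β hA)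
        fun z => hW.hasMatrixSum z _ (hA' z)
    have hcW : ∀ z, c.W z A = W z (A ∩ {z}ᶜ) := fun z => hWapp z A hA
    simp only [hcW]
    have hint : ∀ α β, Integrable
        (fun z => W z (A ∩ {z}ᶜ) α β • (ψ z).sandwich (L α) (star (L β))) μ := fun α β => by
      refine Integrable.bdd_smul (C := B) ((sandwichL (L α) (star (L β))).integrable_comp hψ)
        (hWmeas A α β hA).aestronglyMeasurable (Eventually.of_forall fun z => ?_)
      exact hW.norm_le z _ α β (hA' z)
    refine ⟨hint, ?_⟩
    have hJ : ∫ z in A, (Φ ψ - fieldL μ hW.isBoundedField_diag ψ) z ∂μ =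
        ∫ z, T z (A ∩ {z}ᶜ) (ψ z) ∂μ := by
      have i1 := (hW.isBoundedField_diag).integrable hψ
      rw [integral_congr_ae (ae_restrict_of_ae ((Lp.coeFn_sub (Φ ψ)
        (fieldL μ hW.isBoundedField_diag ψ)).trans
          ((EventuallyEq.refl _ _).sub (coe_fieldL hW.isBoundedField_diag ψ))))]
      rw [Pi.sub_def, integral_sub (L1.integrable_coeFn _).integrableOn i1.integrableOn, hT A hA,
        ← integral_indicator hA, ← integral_sub ((hW.isBoundedField hA).integrable hψ)
          (i1.indicator hA)]
      refine integral_congr_ae (Eventually.of_forall fun z => ?_)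
      simp only
      rw [hW.jump_eq z hA (ψ z), sub_eq_iff_eq_add]
      congr 1
    rw [hJ, HasDoubleSum]
    have hsum : ∀ n, ∑ α ∈ Finset.range n, ∑ β ∈ Finset.range n,
        ∫ z, W z (A ∩ {z}ᶜ) α β • (ψ z).sandwich (L α) (star (L β)) ∂μ =
        ∫ z, ∑ α ∈ Finset.range n, ∑ β ∈ Finset.range n,
          W z (A ∩ {z}ᶜ) α β • (ψ z).sandwich (L α) (star (L β)) ∂μ := fun n => by
      rw [integral_finsetSum _ fun α _ => integrable_finsetSum _ fun β _ => hint α β]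
      exact Finset.sum_congr rfl fun α _ => (integral_finsetSum _ fun β _ => hint α β).symm
    simp only [hsum]
    refine tendsto_integral_of_dominated_convergence (fun z => C * ‖ψ z‖) (fun n => ?_)
      (hψ.norm.const_mul C) (fun n => Eventually.of_forall fun z => ?_)
      (Eventually.of_forall fun z => ?_)
    · exact (integrable_finsetSum _ fun α _ => integrable_finsetSum _ fun β _ =>
        hint α β).aestronglyMeasurable
    · exact (hW.hasMatrixSum z _ (hA' z)).bound n (ψ z)
    · exact (hW.hasMatrixSum z _ (hA' z)).jump (ψ z)
  · filter_upwards [hKM, hS ψ, Lp.coeFn_sub (Φ ψ) (fieldL μ hW.isBoundedField_diag ψ),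
      coe_fieldL hW.isBoundedField_diag ψ] with z h1 h2 h3 h4
    have hfl : c.flux z = W z (Set.univ ∩ {z}ᶜ) := hWapp z _ MeasurableSet.univ
    refine ⟨_, (1 / 2 : ℂ) • anticomm (M z (Set.univ ∩ {z}ᶜ)) (ψ z),
      (hred z).hasMatrixSum.lindblad (ψ z), ?_, ?_⟩
    · rw [hfl]
      exact (hW.hasMatrixSum z _ (MeasurableSet.univ.inter (hs z))).half_anti (ψ z)
    · have h5 := driftL_eq h1 (ψ z)
      have h6 : driftL (K z + G z) (ψ z) = driftL (K z) (ψ z) + driftL (G z) (ψ z) := by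
        rw [driftL, driftL, driftL, star_add, sandwichL_add_left, sandwichL_add_right]
        simp only [add_apply]
        abel
      have h7 : anticomm (M' z + M z (Set.univ ∩ {z}ᶜ)) (ψ z) =
          anticomm (M' z) (ψ z) + anticomm (M z (Set.univ ∩ {z}ᶜ)) (ψ z) := by
        rw [← anticommL_apply, anticommL_add]
        rfl
      rw [h2, h3, Pi.sub_apply, h4, (hred z).eq, add_apply]
      rw [h6, h7, smul_add] at h5
      have h8 : driftL (K z) (ψ z) = -Complex.I • TraceClass.comm (c.ham z) (ψ z)
          - ((1 / 2 : ℂ) • anticomm (M' z) (ψ z)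
            + (1 / 2 : ℂ) • anticomm (M z (Set.univ ∩ {z}ᶜ)) (ψ z)) - driftL (G z) (ψ z) :=
        eq_sub_of_add_eq h5
      rw [h8]
      abel

end MasterEquation

/-! ### The jump maps of a Choi kernel -/

section ChoiJump

open TraceClass

variable {Z H : Type*} [MeasurableSpace Z] [NormedAddCommGroup H] [InnerProductSpace ℂ H]
  {μ : Measure Z}

theorem IsChoiMatrix.zero_right {w : Matrix ℕ ℕ ℂ} {C : ℝ} (h : IsChoiMatrix w C) (α : ℕ) :
    w α 0 = 0 := by
  rw [← h.posSemidef.1.apply, h.zero_left, star_zero]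

theorem Matrix.PosSemidef.norm_apply_le {ι : Type*} {w : Matrix ι ι ℂ} (h : w.PosSemidef) {C : ℝ}
    (hC : ∀ α, (w α α).re ≤ C) (α β : ι) : ‖w α β‖ ≤ C := by
  classical
  have h1 : ∀ i, (w i i).re = ‖w i i‖ ∧ ((w i i).re : ℂ) = w i i := fun i => by
    have h2 := Complex.nonneg_iff.1 (h.diag_nonneg (i := i))
    have h3 : ((w i i).re : ℂ) = w i i := Complex.ext rfl (by simpa using h2.2)
    refine ⟨?_, h3⟩
    rw [← h3, Complex.norm_real, Complex.ofReal_re, Real.norm_of_nonneg h2.1]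
  have hC0 : 0 ≤ C := ((norm_nonneg _).trans_eq (h1 α).1.symm).trans (hC α)
  have h2 := (h.submatrix ![α, β]).det_nonneg
  rw [Matrix.det_fin_two] at h2
  simp only [Matrix.submatrix_apply, Matrix.cons_val_zero, Matrix.cons_val_one] at h2
  rw [← h.1.apply β α, RCLike.star_def, Complex.mul_conj, ← (h1 α).2, ← (h1 β).2,
    ← Complex.ofReal_mul, ← Complex.ofReal_sub, Complex.zero_le_real, Complex.normSq_eq_norm_sq]
    at h2
  have h3 : ‖w α β‖ ^ 2 ≤ C ^ 2 := by
    have h4 := (norm_nonneg _).trans_eq (h1 α).1.symm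
    have h5 := (norm_nonneg _).trans_eq (h1 β).1.symm
    nlinarith [hC α, hC β]
  exact (abs_le_of_sq_le_sq' h3 hC0).2

theorem IsChoiMatrix.norm_le {w : Matrix ℕ ℕ ℂ} {C : ℝ} (h : IsChoiMatrix w C) (hC : 0 ≤ C)
    (α β : ℕ) : ‖w α β‖ ≤ C := by
  refine h.posSemidef.norm_apply_le (fun α => ?_) α β
  rcases α with _ | a
  · rw [h.zero_left]; simpa using hC
  set N := a + 1 with hN
  -- test the bound on the `k`-th basis vector, where `a = ⟨i, k⟩`
  have h1 := h.bound N (Pi.single a.unpair.2 1)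
  have hk : a.unpair.2 ∈ Finset.range N :=
    Finset.mem_range.2 (Nat.lt_succ_of_le (Nat.unpair_right_le a))
  have hi : a.unpair.1 ∈ Finset.range N :=
    Finset.mem_range.2 (Nat.lt_succ_of_le (Nat.unpair_left_le a))
  have h2 : ∀ i, ∑ k ∈ Finset.range N, ∑ l ∈ Finset.range N, w (Nat.pair i k + 1) (Nat.pair i l + 1) *
      Pi.single (M := fun _ => ℂ) a.unpair.2 1 k *
        starRingEnd ℂ (Pi.single (M := fun _ => ℂ) a.unpair.2 1 l) =
      w (Nat.pair i a.unpair.2 + 1) (Nat.pair i a.unpair.2 + 1) := fun i => by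
    rw [Finset.sum_eq_single_of_mem _ hk fun k _ hk' => by simp [Pi.single_eq_of_ne hk'],
      Finset.sum_eq_single_of_mem _ hk fun k _ hk' => by simp [Pi.single_eq_of_ne hk']]
    simp
  have h3 : ∑ k ∈ Finset.range N, ‖Pi.single (M := fun _ => ℂ) a.unpair.2 (1 : ℂ) k‖ ^ 2 = 1 := by
    rw [Finset.sum_eq_single_of_mem _ hk fun k _ hk' => by simp [Pi.single_eq_of_ne hk']]
    simp
  simp only [h2, h3, mul_one] at h1
  refine le_trans ?_ ((Finset.single_le_sum (fun i _ => ?_) hi).trans h1)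
  · rw [Nat.pair_unpair]
  · exact (Complex.nonneg_iff.1 h.posSemidef.diag_nonneg).1

theorem IsParsevalSeq.eq_zero_or_inner_eq_one {e : ℕ → H} (he : IsParsevalSeq e) (i : ℕ) :
    e i = 0 ∨ (inner ℂ (e i) (e i) : ℂ) = 1 := by
  by_cases h : e i = 0
  · exact Or.inl h
  · right
    have h1 := he.inner_self_smul i
    have h2 : ((inner ℂ (e i) (e i) : ℂ) - 1) • e i = 0 := by rw [sub_smul, one_smul, h1, sub_self]
    exact sub_eq_zero.1 ((smul_eq_zero.1 h2).resolve_right h)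

variable [CompleteSpace H]

/-- The double sums of a Choi kernel of `Φ` converge to jump maps of `Φ`: on the elements
`w 1_B ⊗ |e_k⟩⟨e_l|` the map `Φ` and the jump maps have the same matrix elements. -/
theorem IsChoiKernel.exists_isMatrixKernel {ω : Weight μ}
    {Φ : HybridSpace H μ →L[ℂ] HybridSpace H μ} {e : ℕ → H} (he : IsParsevalSeq e) {C : ℝ}
    (hC : 0 ≤ C) {W : Z → VectorMeasure Z (Matrix ℕ ℕ ℂ)} (hW : IsChoiKernel ω Φ e C W) :
    ∃ T M, IsMatrixKernel (matUnit e) C (3 * C) W T M ∧ HasJumpMaps Φ T := by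
  have h1 : ∀ z A, ∃ T M, MeasurableSet A → HasMatrixSum (matUnit e) (W z A) (3 * C) T M :=
    fun z A => by
      by_cases hA : MeasurableSet A
      · obtain ⟨T, M, h⟩ := (hW.isChoiMatrix z A hA).exists_hasMatrixSum he
        exact ⟨T, M, fun _ => h⟩
      · exact ⟨0, 0, fun h => (hA h).elim⟩
  choose T M hTM using h1
  have hK : IsMatrixKernel (matUnit e) C (3 * C) W T M :=
    { posSemidef := fun z A hA => (hW.isChoiMatrix z A hA).posSemidef
      measurable := hW.measurable
      measurable_diag := hW.measurable_diag
      norm_le := fun z A α β hA => (hW.isChoiMatrix z A hA).norm_le hC α β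
      nonneg := by positivity
      hasMatrixSum := hTM }
  refine ⟨T, M, hK, fun A hA => ?_⟩
  have hT := hK.isBoundedField hA
  suffices h2 : setIntegralL H μ A ∘L Φ = setIntegralL H μ Set.univ ∘L fieldL μ hT by
    intro ψ
    refine (DFunLike.congr_fun h2 ψ).trans ?_
    rw [ContinuousLinearMap.comp_apply, setIntegralL_apply, setIntegral_univ]
    exact integral_congr_ae (coe_fieldL hT ψ)
  refine hybrid_clm_ext ω fun B σ hB => ?_
  suffices h3 : block ω Φ A B = block ω (fieldL μ hT) Set.univ B from DFunLike.congr_fun h3 σ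
  refine he.traceClass_clm_ext fun i k j l => ?_
  have h4 := hW.integral A B hA hB (Nat.pair i k) (Nat.pair j l)
  simp only [unitVectors, Nat.unpair_pair, kernelForm] at h4
  rw [block_fieldL ω hT MeasurableSet.univ hB, Set.univ_inter,
    ← ContinuousLinearMap.integral_comp_comm _ (hT.integrable (integrable_const _)).integrableOn]
  have h5 : ∀ z, elemL (e i) (e j) (T z A (ketbra (e k) (e l))) =
      W z A (Nat.pair i k + 1) (Nat.pair j l + 1) * (inner ℂ (e i) (e i) * inner ℂ (e k) (e k) *
        (inner ℂ (e l) (e l) * inner ℂ (e j) (e j))) := fun z =>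
    (hTM z A hA).inner_ketbra he (hW.isChoiMatrix z A hA) i k j l
  simp only [h5]
  rw [integral_mul_const, ← h4]
  rcases he.eq_zero_or_inner_eq_one i with hi | hi
  · simp [hi, elemL_apply]
  rcases he.eq_zero_or_inner_eq_one j with hj | hj
  · simp [hj, elemL_apply]
  rcases he.eq_zero_or_inner_eq_one k with hk | hk
  · simp [hk, ketbra_zero_left]
  rcases he.eq_zero_or_inner_eq_one l with hl | hl
  · simp [hl, ketbra_zero_right]
  rw [hi, hj, hk, hl]
  ring

end ChoiJump

/-! ### Change of the Lindblad operators in finite dimension -/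

section FiniteDim

open TraceClass

variable {H : Type*} [NormedAddCommGroup H] [InnerProductSpace ℂ H]

theorem Matrix.PosSemidef.sum_finset_nonneg {ι : Type*} {M : Matrix ι ι ℂ} (h : M.PosSemidef)
    (s : Finset ι) (v : ι → ℂ) :
    0 ≤ ∑ i ∈ s, ∑ j ∈ s, starRingEnd ℂ (v i) * v j * M i j := by
  have h1 := (h.submatrix ((↑) : s → ι)).dotProduct_mulVec_nonneg fun i => v i
  simp only [dotProduct, Matrix.mulVec, Finset.mul_sum, Matrix.submatrix_apply] at h1
  rw [← Finset.sum_coe_sort s]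
  refine h1.trans_eq (Finset.sum_congr rfl fun i _ => ?_)
  rw [← Finset.sum_coe_sort s]
  refine Finset.sum_congr rfl fun j _ => ?_
  simp only [Pi.star_apply, RCLike.star_def]
  ring

theorem IsParsevalSeq.exists_matUnit_eq_zero [FiniteDimensional ℂ H] {e : ℕ → H}
    (he : IsParsevalSeq e) : ∃ R, ∀ α, R ≤ α → matUnit e α = 0 := by
  have hli : LinearIndependent ℂ fun i : {i // e i ≠ 0} => e i :=
    linearIndependent_of_ne_zero_of_inner_eq_zero (fun i => i.2)
      fun i j hij => he.inner_eq_zero i j fun h => hij (Subtype.ext h)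
  have hfin : {i | e i ≠ 0}.Finite := Set.finite_coe_iff.1 hli.finite
  obtain ⟨N, hN⟩ := hfin.bddAbove
  have h0 : ∀ i, N < i → e i = 0 := fun i hi => by
    by_contra h
    exact absurd (hN h) (not_le.2 hi)
  refine ⟨(N + 1) ^ 2 + 1, fun α hα => ?_⟩
  obtain ⟨a, rfl⟩ : ∃ a, α = a + 1 := ⟨α - 1, by omega⟩
  have h1 := Nat.pair_lt_max_add_one_sq a.unpair.1 a.unpair.2
  rw [Nat.pair_unpair] at h1
  have h2 : N + 1 < max a.unpair.1 a.unpair.2 + 1 :=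
    lt_of_pow_lt_pow_left₀ 2 (Nat.zero_le _) ((Nat.le_of_succ_le_succ hα).trans_lt h1)
  rw [matUnit]
  rcases lt_max_iff.1 (Nat.lt_of_succ_lt_succ h2) with h | h
  · rw [h0 _ h, map_zero, zero_apply]
  · rw [h0 _ h, map_zero]

/-- The matrix of coefficients in terms of operators `L` when `w` refers to the operators
`∑ β, a α β • L β`, `α < R`. -/
noncomputable def changeOfOperators (R : ℕ) (a : ℕ → ℕ → ℂ) : Matrix ℕ ℕ ℂ →+ Matrix ℕ ℕ ℂ where
  toFun w := Matrix.of fun β γ => ∑ α ∈ Finset.range R, ∑ α' ∈ Finset.range R,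
    a α β * starRingEnd ℂ (a α' γ) * w α α'
  map_zero' := by ext; simp
  map_add' w w' := by ext; simp [mul_add, Finset.sum_add_distrib]

theorem changeOfOperators_apply (R : ℕ) (a : ℕ → ℕ → ℂ) (w : Matrix ℕ ℕ ℂ) (β γ : ℕ) :
    changeOfOperators R a w β γ = ∑ α ∈ Finset.range R, ∑ α' ∈ Finset.range R,
      a α β * starRingEnd ℂ (a α' γ) * w α α' := rfl

theorem continuous_changeOfOperators (R : ℕ) (a : ℕ → ℕ → ℂ) :
    Continuous (changeOfOperators R a) := by
  refine continuous_matrix fun β γ => ?_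
  simp only [changeOfOperators_apply]
  fun_prop

theorem Matrix.PosSemidef.changeOfOperators {w : Matrix ℕ ℕ ℂ} (hw : w.PosSemidef) (R : ℕ)
    (a : ℕ → ℕ → ℂ) : (changeOfOperators R a w).PosSemidef := by
  refine Matrix.PosSemidef.of_sum_nonneg fun s v => ?_
  refine (hw.sum_nonneg R id fun α => ∑ γ ∈ s, v γ * starRingEnd ℂ (a α γ)).trans_eq ?_
  simp only [changeOfOperators_apply, Finset.mul_sum, id]
  simp only [Finset.sum_comm (s := s) (t := Finset.range R)]
  refine Finset.sum_congr rfl fun α _ => Finset.sum_congr rfl fun α' _ => ?_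
  simp only [map_sum, Finset.sum_mul]
  rw [Finset.sum_comm]
  refine Finset.sum_congr rfl fun β _ => Finset.sum_congr rfl fun γ _ => ?_
  rw [map_mul, Complex.conj_conj]
  ring

/-- The matrix with the row and the column of the index `0` set to zero. -/
noncomputable def dropZero (w : Matrix ℕ ℕ ℂ) : Matrix ℕ ℕ ℂ :=
  Matrix.of fun β γ => if β = 0 ∨ γ = 0 then 0 else w β γ

theorem dropZero_apply (w : Matrix ℕ ℕ ℂ) (β γ : ℕ) :
    dropZero w β γ = if β = 0 ∨ γ = 0 then 0 else w β γ := rfl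

theorem Matrix.PosSemidef.dropZero {w : Matrix ℕ ℕ ℂ} (hw : w.PosSemidef) :
    (dropZero w).PosSemidef := by
  have h1 : _root_.dropZero w = Matrix.of (bordered fun a b => w (a + 1) (b + 1)) := by
    ext (_ | β) (_ | γ) <;> simp [dropZero_apply, bordered]
  rw [h1]
  refine posSemidef_bordered fun s v => ?_
  exact (hw.submatrix Nat.succ).sum_finset_nonneg s v

variable [CompleteSpace H]

/-- Finitely many Lindblad operators raise no question of convergence. -/
theorem hasMatrixSum_of_finite (L : ℕ → H →L[ℂ] H) {w : Matrix ℕ ℕ ℂ} {n₀ : ℕ} {B : ℝ}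
    (hB : ∀ α β, ‖w α β‖ ≤ B) (h0 : ∀ α β, n₀ ≤ α ∨ n₀ ≤ β → w α β = 0) :
    HasMatrixSum L w (B * (∑ β ∈ Finset.range n₀, ‖L β‖) ^ 2)
      (∑ α ∈ Finset.range n₀, ∑ β ∈ Finset.range n₀, w α β • sandwichL (L α) (star (L β)))
      (∑ α ∈ Finset.range n₀, ∑ β ∈ Finset.range n₀, w α β • (star (L β) * L α)) := by
  have hsum : ∀ {E : Type _} [AddCommGroup E] [Module ℂ E] (f : ℕ → ℕ → E) (n : ℕ), n₀ ≤ n →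
      ∑ α ∈ Finset.range n₀, ∑ β ∈ Finset.range n₀, w α β • f α β =
      ∑ α ∈ Finset.range n, ∑ β ∈ Finset.range n, w α β • f α β := by
    intro E _ _ f n hn
    have hr : Finset.range n₀ ⊆ Finset.range n := Finset.range_subset_range.2 hn
    rw [← Finset.sum_subset hr]
    · refine Finset.sum_congr rfl fun α _ => Finset.sum_subset hr fun β _ hβ => ?_
      rw [h0 α β (Or.inr (by simpa using hβ)), zero_smul]
    · intro α _ hα
      refine Finset.sum_eq_zero fun β _ => ?_
      rw [h0 α β (Or.inl (by simpa using hα)), zero_smul]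
  have hB0 : 0 ≤ B := (norm_nonneg _).trans (hB 0 0)
  refine ⟨fun n σ => ?_, fun σ => ?_, fun σ => ?_, fun σ => ?_⟩
  · set g : ℕ → ℝ := fun β => if β < n₀ then ‖L β‖ else 0 with hg
    have hterm : ∀ α β, ‖w α β • sandwich (L α) σ (star (L β))‖ ≤ B * ‖σ‖ * (g α * g β) := by
      intro α β
      by_cases h : n₀ ≤ α ∨ n₀ ≤ β
      · rw [h0 α β h, zero_smul, norm_zero]
        have : ∀ β, 0 ≤ g β := fun β => by simp only [hg]; split_ifs <;> positivity
        have h1 := this α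
        have h2 := this β
        positivity
      · rw [not_or, not_le, not_le] at h
        rw [norm_smul]
        simp only [hg, if_pos h.1, if_pos h.2]
        have h2 := norm_sandwich_le (L α) σ (star (L β))
        rw [norm_star] at h2
        calc _ ≤ B * (‖L α‖ * ‖L β‖ * ‖σ‖) := mul_le_mul (hB α β) h2 (norm_nonneg _) hB0
          _ = _ := by ring
    have hg1 : ∑ β ∈ Finset.range n, g β ≤ ∑ β ∈ Finset.range n₀, ‖L β‖ := by
      simp only [hg]
      rw [← Finset.sum_filter]
      exact Finset.sum_le_sum_of_subset_of_nonneg (fun β hβ => by simp at hβ ⊢; exact hβ.2)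
        fun _ _ _ => norm_nonneg _
    have hg0 : 0 ≤ ∑ β ∈ Finset.range n, g β :=
      Finset.sum_nonneg fun β _ => by simp only [hg]; split_ifs <;> positivity
    calc _ ≤ ∑ α ∈ Finset.range n, ∑ β ∈ Finset.range n, B * ‖σ‖ * (g α * g β) :=
          (norm_sum_le _ _).trans (Finset.sum_le_sum fun α _ => (norm_sum_le _ _).trans
            (Finset.sum_le_sum fun β _ => hterm α β))
      _ = B * ‖σ‖ * (∑ β ∈ Finset.range n, g β) ^ 2 := by
          rw [sq, Finset.sum_mul_sum]
          simp only [Finset.mul_sum]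
      _ ≤ B * ‖σ‖ * (∑ β ∈ Finset.range n₀, ‖L β‖) ^ 2 := by gcongr
      _ = _ := by ring
  · refine tendsto_const_nhds.congr' ?_
    filter_upwards [eventually_ge_atTop n₀] with n hn
    rw [← hsum _ n hn]
    simp only [sum_apply, smul_apply, sandwichL_apply]
  · refine tendsto_const_nhds.congr' ?_
    filter_upwards [eventually_ge_atTop n₀] with n hn
    rw [← hsum _ n hn, ← anticommL_apply]
    simp only [anticommL_sum, anticommL_smul, sum_apply, smul_apply, anticommL_apply]
  · rw [← sandwichL_apply, ← traceL_apply, ← traceL_apply]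
    simp only [sandwichL_sum_left, sandwichL_smul_left, sum_apply, smul_apply, map_sum, map_smul,
      sandwichL_apply, traceL_apply]
    refine Finset.sum_congr rfl fun α _ => Finset.sum_congr rfl fun β _ => ?_
    rw [trace_sandwich (L α) (star (L β))]

/-- The drift `½ w₀₀ + ∑_{β ≠ 0} w_{β0} L_β` carried by the row and the column of the index `0`. -/
noncomputable def zeroDrift (L : ℕ → H →L[ℂ] H) (m : ℕ) (w : Matrix ℕ ℕ ℂ) : H →L[ℂ] H :=
  (w 0 0 / 2) • 1 + ∑ β ∈ Finset.range m, w (β + 1) 0 • L (β + 1)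

/-- Since `L₀ = 1`, the terms with `α = 0` or `β = 0` add up to a drift. -/
theorem sum_eq_dropZero_add_drift {L : ℕ → H →L[ℂ] H} (hL : L 0 = 1) {w : Matrix ℕ ℕ ℂ}
    (hw : w.IsHermitian) (m : ℕ) :
    ∑ α ∈ Finset.range (m + 1), ∑ β ∈ Finset.range (m + 1),
        w α β • sandwichL (L α) (star (L β)) =
      ∑ α ∈ Finset.range (m + 1), ∑ β ∈ Finset.range (m + 1),
        dropZero w α β • sandwichL (L α) (star (L β)) + driftL (zeroDrift L m w) := by
  have h1 : star (zeroDrift L m w) =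
      (w 0 0 / 2) • 1 + ∑ β ∈ Finset.range m, w 0 (β + 1) • star (L (β + 1)) := by
    rw [zeroDrift, star_add, star_sum, star_smul, star_one]
    simp only [star_smul, hw.apply, star_div₀]
    simp
  simp only [Finset.sum_range_succ', dropZero_apply]
  simp only [hL, star_one, driftL, h1]
  simp only [zeroDrift, sandwichL_add_left, sandwichL_add_right, sandwichL_sum_left,
    sandwichL_sum_right, sandwichL_smul_left, sandwichL_smul_right, Finset.sum_add_distrib]
  simp
  module

variable {Z : Type*} [MeasurableSpace Z]

/-- The kernel in terms of other operators `L`, if finitely many operators are involved. -/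
theorem IsMatrixKernel.changeOfOperators {E L : ℕ → H →L[ℂ] H} {B C : ℝ}
    {W : Z → VectorMeasure Z (Matrix ℕ ℕ ℂ)}
    {T : Z → Set Z → TraceClass H →L[ℂ] TraceClass H} {M : Z → Set Z → H →L[ℂ] H}
    (h : IsMatrixKernel E B C W T M) {R n₀ : ℕ} {a : ℕ → ℕ → ℂ} {A : ℝ}
    (hE0 : ∀ α, R ≤ α → E α = 0)
    (hE : ∀ α, α < R → E α = ∑ β ∈ Finset.range n₀, a α β • L β)
    (ha : ∀ α β, α < R → n₀ ≤ β → a α β = 0) (hA : ∀ α β, α < R → ‖a α β‖ ≤ A) (hB : 0 ≤ B) :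
    ∃ M', IsMatrixKernel L (R * (R * (A * A * B)))
      (R * (R * (A * A * B)) * (∑ β ∈ Finset.range n₀, ‖L β‖) ^ 2)
      (fun z => (W z).mapRange (_root_.changeOfOperators R a) (continuous_changeOfOperators R a))
      T M' ∧ ∀ w : Matrix ℕ ℕ ℂ, ∀ β γ, n₀ ≤ β ∨ n₀ ≤ γ →
        _root_.changeOfOperators R a w β γ = 0 := by
  have hle : ∀ z D β γ, MeasurableSet D →
      ‖_root_.changeOfOperators R a (W z D) β γ‖ ≤ R * (R * (A * A * B)) := by
    intro z D β γ hD
    rw [changeOfOperators_apply]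
    refine (norm_sum_le_of_le (n := fun _ => ∑ α' ∈ Finset.range R, A * A * B) _ fun α hα =>
      norm_sum_le_of_le (n := fun _ => A * A * B) _ fun α' hα' => ?_).trans_eq (by simp)
    · have h1 := hA α β (Finset.mem_range.1 hα)
      have h2 := hA α' γ (Finset.mem_range.1 hα')
      rw [norm_mul, norm_mul, RCLike.norm_conj]
      exact mul_le_mul (mul_le_mul h1 h2 (norm_nonneg _) ((norm_nonneg _).trans h1))
        (h.norm_le z D α α' hD) (norm_nonneg _)
        (mul_nonneg ((norm_nonneg _).trans h1) ((norm_nonneg _).trans h2))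
  have h0 : ∀ w : Matrix ℕ ℕ ℂ, ∀ β γ, n₀ ≤ β ∨ n₀ ≤ γ →
      _root_.changeOfOperators R a w β γ = 0 := by
    intro w β γ hβγ
    rw [changeOfOperators_apply]
    refine Finset.sum_eq_zero fun α hα => Finset.sum_eq_zero fun α' hα' => ?_
    rcases hβγ with h1 | h1
    · rw [ha α β (Finset.mem_range.1 hα) h1, zero_mul, zero_mul]
    · rw [ha α' γ (Finset.mem_range.1 hα') h1, map_zero, mul_zero, zero_mul]
  have hT : ∀ z D, MeasurableSet D → T z D = ∑ β ∈ Finset.range n₀, ∑ γ ∈ Finset.range n₀,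
      _root_.changeOfOperators R a (W z D) β γ • sandwichL (L β) (star (L γ)) := by
    intro z D hD
    have h1 : T z D = ∑ α ∈ Finset.range R, ∑ α' ∈ Finset.range R,
        W z D α α' • sandwichL (E α) (star (E α')) := by
      ext1 σ
      refine tendsto_nhds_unique ((h.hasMatrixSum z D hD).jump σ) (tendsto_const_nhds.congr' ?_)
      filter_upwards [eventually_ge_atTop R] with n hn
      have hr : Finset.range R ⊆ Finset.range n := Finset.range_subset_range.2 hn
      simp only [sum_apply, smul_apply, ← sandwichL_apply]
      rw [← Finset.sum_subset hr]
      · refine Finset.sum_congr rfl fun α _ => Finset.sum_subset hr fun α' _ hα' => ?_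
        rw [hE0 α' (by simpa using hα'), star_zero, sandwichL_zero_right, zero_apply, smul_zero]
      · intro α _ hα
        refine Finset.sum_eq_zero fun α' _ => ?_
        rw [hE0 α (by simpa using hα), sandwichL_zero_left, zero_apply, smul_zero]
    rw [h1]
    simp only [changeOfOperators_apply, Finset.sum_smul]
    simp only [Finset.sum_comm (s := Finset.range n₀) (t := Finset.range R)]
    refine Finset.sum_congr rfl fun α hα => Finset.sum_congr rfl fun α' hα' => ?_
    rw [hE α (Finset.mem_range.1 hα), hE α' (Finset.mem_range.1 hα'), sandwichL_sum_left,
      Finset.smul_sum]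
    refine Finset.sum_congr rfl fun β _ => ?_
    rw [star_sum, sandwichL_sum_right, Finset.smul_sum]
    refine Finset.sum_congr rfl fun γ _ => ?_
    rw [star_smul, sandwichL_smul_left, sandwichL_smul_right, smul_smul, smul_smul,
      RCLike.star_def]
    congr 1
    ring
  have hmeas : ∀ f : Z → Matrix ℕ ℕ ℂ, (∀ α β, Measurable fun z => f z α β) → ∀ β γ,
      Measurable fun z => _root_.changeOfOperators R a (f z) β γ := fun f hf β γ => by
    simp only [changeOfOperators_apply]
    exact Finset.measurable_fun_sum _ fun α _ => Finset.measurable_fun_sum _ fun α' _ =>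
      (hf α α').const_mul _
  have hA2 : (0 : ℝ) ≤ R * (R * (A * A * B)) := by
    have := mul_self_nonneg A
    positivity
  have hms : ∀ z D, MeasurableSet D → HasMatrixSum L (_root_.changeOfOperators R a (W z D)) _ _ _ :=
    fun z D hD => hasMatrixSum_of_finite L (fun β γ => hle z D β γ hD) (h0 (W z D))
  refine ⟨fun z D => ∑ β ∈ Finset.range n₀, ∑ γ ∈ Finset.range n₀,
      _root_.changeOfOperators R a (W z D) β γ • (star (L γ) * L β),
    ⟨fun z D hD => (h.posSemidef z D hD).changeOfOperators R a,
      fun D β γ hD => hmeas _ (fun α α' => h.measurable D α α' hD) β γ,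
      fun β γ => hmeas _ h.measurable_diag β γ, fun z D β γ hD => hle z D β γ hD,
      mul_nonneg hA2 (by positivity), fun z D hD => ?_⟩, h0⟩
  rw [hT z D hD]
  exact hms z D hD

end FiniteDim

/-! ### The hybrid master equation -/

section Main

open TraceClass

variable {Z H : Type*} [MeasurableSpace Z] [NormedAddCommGroup H] [InnerProductSpace ℂ H]
  {μ : Measure Z}

/-- The coefficients of finitely many operators with respect to a spanning sequence. -/
theorem exists_coefficients {E L : ℕ → H →L[ℂ] H} (hL : Submodule.span ℂ (Set.range L) = ⊤)
    (R : ℕ) : ∃ (m : ℕ) (a : ℕ → ℕ → ℂ) (A : ℝ),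
      (∀ α, α < R → E α = ∑ β ∈ Finset.range (m + 1), a α β • L β) ∧
      (∀ α β, α < R → m + 1 ≤ β → a α β = 0) ∧ ∀ α β, α < R → ‖a α β‖ ≤ A := by
  have h1 : ∀ α, ∃ f : ℕ →₀ ℂ, (f.sum fun β c => c • L β) = E α := fun α =>
    Finsupp.mem_span_range_iff_exists_finsupp.1 (hL ▸ Submodule.mem_top)
  choose f hf using h1
  set s : Finset ℕ := (Finset.range R).biUnion fun α => (f α).support with hs
  have hsub : ∀ α, α < R → (f α).support ⊆ s := fun α hα =>
    Finset.subset_biUnion_of_mem (fun α => (f α).support) (Finset.mem_range.2 hα)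
  have hle : ∀ β ∈ s, β < s.sup id + 1 := fun β hβ =>
    Nat.lt_succ_of_le (Finset.le_sup (f := id) hβ)
  refine ⟨s.sup id, fun α β => f α β, ∑ α ∈ Finset.range R, ∑ β ∈ s, ‖f α β‖, fun α hα => ?_,
    fun α β hα hβ => ?_, fun α β hα => ?_⟩
  · rw [← hf α]
    exact Finsupp.sum_of_support_subset _
      (fun β hβ => Finset.mem_range.2 (hle β (hsub α hα hβ))) _ fun _ _ => zero_smul _ _
  · by_contra h
    exact absurd (hle β (hsub α hα (Finsupp.mem_support_iff.2 h))) (not_lt.2 hβ)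
  · refine le_trans ?_ (Finset.single_le_sum (f := fun α => ∑ β ∈ s, ‖f α β‖)
      (fun α _ => Finset.sum_nonneg fun β _ => norm_nonneg _) (Finset.mem_range.2 hα))
    by_cases h : β ∈ s
    · exact Finset.single_le_sum (f := fun β => ‖f α β‖) (fun β _ => norm_nonneg _) h
    · beta_reduce
      rw [Finsupp.notMem_support_iff.1 fun h' => h (hsub α hα h'), norm_zero]
      exact Finset.sum_nonneg fun β _ => norm_nonneg _

theorem measurable_inner_zeroDrift {L : ℕ → H →L[ℂ] H} {m : ℕ} {w : Z → Matrix ℕ ℕ ℂ}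
    (hw : ∀ α β, Measurable fun z => w z α β) (x y : H) :
    Measurable fun z => (inner ℂ x (zeroDrift L m (w z) y) : ℂ) := by
  simp only [zeroDrift, add_apply, sum_apply, smul_apply, one_apply_eq_self, inner_add_right,
    inner_sum, inner_smul_right]
  exact (((hw 0 0).div_const 2).mul_const _).add
    (Finset.measurable_fun_sum _ fun β _ => (hw _ _).mul_const _)

variable [CompleteSpace H]

/-- A kernel that does not involve the index `0` needs no reduction. -/
theorem IsMatrixKernel.isReducedJump_self {L : ℕ → H →L[ℂ] H} {B C : ℝ}
    {W : Z → VectorMeasure Z (Matrix ℕ ℕ ℂ)} {T : Z → Set Z → TraceClass H →L[ℂ] TraceClass H}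
    {M : Z → Set Z → H →L[ℂ] H} [MeasurableSingletonClass Z] (h : IsMatrixKernel L B C W T M)
    (h0 : ∀ z α, W z {z} 0 α = 0 ∧ W z {z} α 0 = 0) (z : Z) :
    IsReducedJump L (W z {z}) C (T z {z}) (T z {z}) (M z {z}) 0 := by
  have hs := measurableSet_singleton z
  refine ⟨h.posSemidef z _ hs, h0 z, h.hasMatrixSum z _ hs, ?_⟩
  rw [driftL, star_zero, sandwichL_zero_left, sandwichL_zero_right, add_zero, add_zero]

theorem norm_zeroDrift_le {L : ℕ → H →L[ℂ] H} {m : ℕ} {w : Matrix ℕ ℕ ℂ} {B : ℝ}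
    (hB : ∀ α β, ‖w α β‖ ≤ B) :
    ‖zeroDrift L m w‖ ≤ B + ∑ β ∈ Finset.range m, B * ‖L (β + 1)‖ := by
  refine (norm_add_le _ _).trans (add_le_add ?_ (norm_sum_le_of_le _ fun β _ => ?_))
  · have h1 : ‖(1 : H →L[ℂ] H)‖ ≤ 1 := ContinuousLinearMap.norm_id_le
    have h2 := hB 0 0
    rw [norm_smul, norm_div, Complex.norm_two]
    nlinarith [norm_nonneg (w 0 0), norm_nonneg (1 : H →L[ℂ] H)]
  · rw [norm_smul]
    exact mul_le_mul_of_nonneg_right (hB _ _) (norm_nonneg _)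

theorem isReducedJump_dropZero {L : ℕ → H →L[ℂ] H} (hL : L 0 = 1) {w : Matrix ℕ ℕ ℂ}
    (hw : w.PosSemidef) {m : ℕ} {B : ℝ} (hB : ∀ α β, ‖w α β‖ ≤ B)
    (h0 : ∀ α β, m + 1 ≤ α ∨ m + 1 ≤ β → w α β = 0) {C : ℝ}
    {T : TraceClass H →L[ℂ] TraceClass H} {M : H →L[ℂ] H} (hT : HasMatrixSum L w C T M) :
    IsReducedJump L (dropZero w) (B * (∑ β ∈ Finset.range (m + 1), ‖L β‖) ^ 2) T
      (∑ α ∈ Finset.range (m + 1), ∑ β ∈ Finset.range (m + 1),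
        dropZero w α β • sandwichL (L α) (star (L β)))
      (∑ α ∈ Finset.range (m + 1), ∑ β ∈ Finset.range (m + 1),
        dropZero w α β • (star (L β) * L α)) (zeroDrift L m w) := by
  have hB0 : 0 ≤ B := (norm_nonneg _).trans (hB 0 0)
  refine ⟨hw.dropZero, fun α => by simp [dropZero_apply], hasMatrixSum_of_finite L
    (fun α β => ?_) (fun α β h => ?_), ?_⟩
  · rw [dropZero_apply]
    split_ifs
    · simpa using hB0
    · exact hB α β
  · rw [dropZero_apply, h0 α β h, ite_self]
  · rw [← sum_eq_dropZero_add_drift hL hw.1]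
    ext1 σ
    exact tendsto_nhds_unique (hT.jump σ) ((hasMatrixSum_of_finite L hB h0).jump σ)

/-- The generator annihilates the total trace. -/
theorem integral_trace_generator {Λ : ℝ → HybridSpace H μ →L[ℂ] HybridSpace H μ}
    (hΛ : IsCQDynamics Λ) {S : HybridSpace H μ →L[ℂ] HybridSpace H μ}
    (hS : HasDerivWithinAt Λ S (Set.Ici 0) 0) (ψ : HybridSpace H μ) :
    ∫ z, (S ψ z).trace ∂μ = 0 := by
  let F : (HybridSpace H μ →L[ℂ] HybridSpace H μ) →L[ℂ] ℂ :=
    (traceL H ∘L setIntegralL H μ Set.univ).comp (ContinuousLinearMap.apply ℂ _ ψ)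
  have hF : ∀ R : HybridSpace H μ →L[ℂ] HybridSpace H μ, F R = ∫ z, (R ψ z).trace ∂μ := fun R => by
    have h1 := (traceL H).integral_comp_comm (L1.integrable_coeFn (R ψ))
    rw [← setIntegral_univ] at h1
    have h2 : F R = traceL H (∫ z, R ψ z ∂μ) := by
      rw [← setIntegral_univ (f := fun z => R ψ z)]
      rfl
    rw [h2, ← h1, setIntegral_univ]
    rfl
  have h1 : HasDerivWithinAt (fun t => F (Λ t)) (F S) (Set.Ici 0) 0 :=
    (F.restrictScalars ℝ).hasFDerivAt.comp_hasDerivWithinAt 0 hS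
  have h2 : HasDerivWithinAt (fun t => F (Λ t)) 0 (Set.Ici 0) 0 := by
    refine (hasDerivWithinAt_const (0 : ℝ) (Set.Ici 0) (F (Λ 0))).congr (fun t ht => ?_) rfl
    have h3 := fun t ht => hΛ.tracePreserving t ht ψ
    rw [hF, hF, h3 t ht, h3 0 le_rfl]
  rw [← hF]
  exact (uniqueDiffWithinAt_Ici 0).eq_deriv _ h1 h2

end Main

theorem mainTheorem2 {Z H : Type*} [MeasurableSpace Z] [StandardBorelSpace Z]
    (μ : Measure Z) [SigmaFinite μ]
    [NormedAddCommGroup H] [InnerProductSpace ℂ H] [CompleteSpace H]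
    [TopologicalSpace.SeparableSpace H]
    (Λ : ℝ → HybridSpace H μ →L[ℂ] HybridSpace H μ) (hΛ : IsCQDynamics Λ)
    (hcont : ContinuousWithinAt Λ (Set.Ici 0) 0) :
    ∃ 𝓛 : HybridSpace H μ →L[ℂ] HybridSpace H μ,
      (∀ t : ℝ, 0 ≤ t → HasDerivWithinAt Λ (𝓛 ∘L Λ t) (Set.Ici 0) t) ∧
      (∃ L : ℕ → H →L[ℂ] H, L 0 = 1 ∧
        ∃ c : CQCoefficients Z H, c.IsMasterEquation L 𝓛) ∧
      (FiniteDimensional ℂ H → ∀ L : ℕ → H →L[ℂ] H, L 0 = 1 →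
        Submodule.span ℂ (Set.range L) = ⊤ →
        ∃ c : CQCoefficients Z H, c.IsMasterEquation L 𝓛) := by
  obtain ⟨S, hS⟩ := exists_generator (A := HybridSpace H μ →L[ℂ] HybridSpace H μ) hΛ.map_zero
    hΛ.map_add hcont
  have hS0 : HasDerivWithinAt Λ S (Set.Ici 0) 0 := by
    have h1 := hS 0 le_rfl
    rwa [hΛ.map_zero, mul_one] at h1
  obtain ⟨ω⟩ := Weight.nonempty μ
  obtain ⟨K, C, hK, hKm, hKC, hCP⟩ := exists_drift_field ω hΛ.map_zero hΛ.completelyPositive hS0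
  set Φ := S - fieldL μ hK with hΦ
  have hSΦ : ∀ ψ, S ψ =ᵐ[μ] fun z => Φ ψ z + driftL (K z) (ψ z) := fun ψ => by
    filter_upwards [Lp.coeFn_sub (S ψ) (fieldL μ hK ψ), coe_fieldL hK ψ] with z h1 h2
    rw [hΦ, sub_apply, h1, Pi.sub_apply, h2, sub_add_cancel]
  have htr := integral_trace_generator hΛ hS0
  obtain ⟨e, he⟩ := exists_isParsevalSeq (H := H)
  obtain ⟨W, hW⟩ := exists_choiKernel ω hCP he
  obtain ⟨T, M, hTM, hT⟩ := hW.exists_isMatrixKernel he (norm_nonneg _)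
  refine ⟨S, hS, ⟨matUnit e, rfl, ?_⟩, fun _ L hL hspan => ?_⟩
  · exact exists_isMasterEquation ω hKm hKC hSΦ htr hTM hT hTM.measurable_diag (G := fun _ => 0)
      (CG := 0) (fun x y => by simp) (fun _ => by simp) fun z => hTM.isReducedJump_self
        (fun z α => ⟨(hW.isChoiMatrix z _ (measurableSet_singleton z)).zero_left α,
          (hW.isChoiMatrix z _ (measurableSet_singleton z)).zero_right α⟩) z
  · obtain ⟨R, hR⟩ := he.exists_matUnit_eq_zero
    obtain ⟨m, a, A, h1, h2, h3⟩ := exists_coefficients (E := matUnit e) hspan R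
    obtain ⟨M', hTM', h0⟩ := hTM.changeOfOperators hR h1 h2 h3 (norm_nonneg _)
    exact exists_isMasterEquation ω hKm hKC hSΦ htr hTM' hT
      (fun α β => by
        simp only [dropZero_apply]
        split_ifs
        · exact measurable_const
        · exact hTM'.measurable_diag α β)
      (measurable_inner_zeroDrift (L := L) (m := m) hTM'.measurable_diag)
      (fun z => norm_zeroDrift_le fun α β => hTM'.norm_le z _ α β (measurableSet_singleton z))
      fun z => isReducedJump_dropZero hL (hTM'.posSemidef z _ (measurableSet_singleton z))
        (fun α β => hTM'.norm_le z _ α β (measurableSet_singleton z))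
        (h0 _) (hTM'.hasMatrixSum z _ (measurableSet_singleton z))
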